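/- **Setting.** For $q\in(0,1)$ let $\mathbb P^q$ be the probability measure on the set of all integer partitions (of all sizes) given by $\mathbb P^q(\lambda)=q^{|\lambda|}/Z(q)$, where $|\lambda|$ is the area of the Young diagram of $\lambda$ and $Z(q)=\sum_\lambda q^{|\lambda|}=\prod_{i\ge 1}(1-q^i)^{-1}$. Place the diagram as a union of unit squares $[j,j+1]\times[i,i+1]$ in the corner of the quadrant $\{x,y\ge 0\}$, and use the rotated coordinates $(x-y,\,x+y)$. In these coordinates the boundary of the diagram, continued by the two half-axes, is the graph of a piecewise linear function $(X_s)_{s\in\mathbb R}$ with slopes $\pm1$ that takes integer values and changes slope only at integers, with $X_s=|s|$ for $|s|$ large. Let $L_\infty(s)=\log(2\cosh s)$, and let $D$ be the space of càdlàg functions $\mathbb R\to\mathbb R$ with the Skorokhod ($J_1$) topology. **Theorem.** Put $\varepsilon=\varepsilon(q)=\frac{1-q}{2}$. As $q\to1^-$, the random function $$s\longmapsto \frac{\sqrt2\,\cosh s}{\sqrt{\varepsilon}}\,\bigl\{\varepsilon\,X_{s/\varepsilon}-L_\infty(s)\bigr\},\qquad s\in\mathbb R,$$ under $\mathbb P^q$,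 converges weakly in $D$ to the two-sided stationary Ornstein–Uhlenbeck process $(Y_s)_{s\in\mathbb R}$, that is, the centred Gaussian process with continuous paths and covariance $$\mathbb E[Y_sY_t]=e^{-|t-s|},\qquad s,t\in\mathbb R.$$ -/

import Mathlib

open MeasureTheory ProbabilityTheory Filter Topology Set

namespace UnconfinedPartitions

/-! ### The Skorokhod space of two-sided càdlàg paths -/

/-- A path `x : ℝ → ℝ` is càdlàg: right-continuous with finite left limits at every point. -/
def IsCadlag (x : ℝ → ℝ) : Prop :=
  ∀ t : ℝ, ContinuousWithinAt x (Ici t) t ∧ ∃ l : ℝ, Tendsto x (𝓝[<] t) (𝓝 l)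

/-- The space `D = D(ℝ)` of càdlàg paths on the whole line. -/
def SkorokhodSpace : Type := {x : ℝ → ℝ // IsCadlag x}

namespace SkorokhodSpace

instance : CoeFun SkorokhodSpace (fun _ => ℝ → ℝ) := ⟨Subtype.val⟩

/-- The basic Skorokhod neighbourhood of `x` with window `[-T, T]` and tolerance `ε`: the paths `y`
which, after a time change `φ` (an increasing bijection of the line) that moves no
point by `ε` or more, differ from `x` by less than `ε` on `[-T, T]`. -/
def basicNhd (x : SkorokhodSpace) (T ε : ℝ) : Set SkorokhodSpace :=
  {y | ∃ φ : ℝ ≃o ℝ, (∀ t, |φ t - t| < ε) ∧ ∀ t ∈ Icc (-T) T, |y (φ t) - x t| < ε}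

theorem basicNhd_mono (x : SkorokhodSpace) {T T' ε ε' : ℝ} (hT : T' ≤ T) (hε : ε ≤ ε') :
    basicNhd x T ε ⊆ basicNhd x T' ε' := by
  rintro y ⟨φ, h1, h2⟩
  exact ⟨φ, fun t => (h1 t).trans_le hε,
    fun t ht => (h2 t ⟨by linarith [ht.1], ht.2.trans hT⟩).trans_le hε⟩

/-- The Skorokhod `J₁` topology on `D(ℝ)`: a set is open if it contains a basic Skorokhod
neighbourhood of each of its points. A sequence `xₙ` converges to `x` in it if and only if there
are time changes `φₙ` with `φₙ(t) - t → 0` uniformly on `ℝ` and `xₙ ∘ φₙ → x` uniformly on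
bounded intervals. -/
instance : TopologicalSpace SkorokhodSpace where
  IsOpen U := ∀ x ∈ U, ∃ T ε : ℝ, 0 < T ∧ 0 < ε ∧ basicNhd x T ε ⊆ U
  isOpen_univ := fun _ _ => ⟨1, 1, one_pos, one_pos, subset_univ _⟩
  isOpen_inter := by
    rintro U V hU hV x ⟨hxU, hxV⟩
    obtain ⟨T, ε, hT, hε, h⟩ := hU x hxU
    obtain ⟨T', ε', _, hε', h'⟩ := hV x hxV
    exact ⟨max T T', min ε ε', lt_max_of_lt_left hT, lt_min hε hε', subset_inter
      ((basicNhd_mono x (le_max_left _ _) (min_le_left _ _)).trans h)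
      ((basicNhd_mono x (le_max_right _ _) (min_le_right _ _)).trans h')⟩
  isOpen_sUnion := by
    rintro S hS x ⟨U, hU, hxU⟩
    obtain ⟨T, ε, hT, hε, h⟩ := hS U hU x hxU
    exact ⟨T, ε, hT, hε, h.trans (subset_sUnion_of_mem hU)⟩

instance : MeasurableSpace SkorokhodSpace := borel _

instance : BorelSpace SkorokhodSpace := ⟨rfl⟩

/-- A continuous function, as an element of `D(ℝ)`. -/
def ofContinuous (x : ℝ → ℝ) (hx : Continuous x) : SkorokhodSpace :=
  ⟨x, fun t => ⟨hx.continuousWithinAt, x t, hx.continuousAt.tendsto.mono_left inf_le_left⟩⟩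

end SkorokhodSpace

/-! ### Random partitions -/

section Summability

open Finset

theorem sum_range_rowLen (μ : YoungDiagram) (M : ℕ) (hM : μ.colLen 0 ≤ M) :
    ∑ i ∈ range M, μ.rowLen i = μ.card := by
  have h : ∀ c ∈ μ.cells, c.1 ∈ range M := by
    rintro ⟨i, j⟩ hc
    have h0 : (i, 0) ∈ μ := μ.up_left_mem le_rfl (Nat.zero_le j) hc
    exact Finset.mem_range.2 ((YoungDiagram.mem_iff_lt_colLen.1 h0).trans_le hM)
  rw [YoungDiagram.card, card_eq_sum_card_fiberwise h]
  refine sum_congr rfl fun i _ => ?_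
  rw [YoungDiagram.rowLen_eq_card]
  rfl

theorem sum_range_diff (r : ℕ → ℕ) (hr : Antitone r) (M : ℕ) :
    ∑ i ∈ range M, (i + 1) * (r i - r (i + 1)) + M * r M = ∑ i ∈ range M, r i := by
  induction M with
  | zero => simp
  | succ M ih =>
    rw [sum_range_succ, sum_range_succ, ← ih]
    obtain ⟨d, hd⟩ := Nat.exists_eq_add_of_le (hr (Nat.le_succ M))
    simp only [Nat.succ_eq_add_one] at hd
    rw [hd, Nat.add_sub_cancel_left]
    ring

theorem rowLen_eq_zero (μ : YoungDiagram) {i : ℕ} (h : μ.colLen 0 ≤ i) : μ.rowLen i = 0 := by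
  by_contra h0
  have h1 : (i, 0) ∈ μ := YoungDiagram.mem_iff_lt_rowLen.2 (Nat.pos_of_ne_zero h0)
  exact absurd (YoungDiagram.mem_iff_lt_colLen.1 h1) (not_lt.2 h)

theorem eq_of_diff_eq (μ ν : YoungDiagram) (M : ℕ) (hμ : μ.colLen 0 ≤ M) (hν : ν.colLen 0 ≤ M)
    (h : ∀ i < M, μ.rowLen i - μ.rowLen (i + 1) = ν.rowLen i - ν.rowLen (i + 1)) : μ = ν := by
  have key : ∀ k i, M ≤ i + k → μ.rowLen i = ν.rowLen i := by
    intro k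
    induction k with
    | zero => intro i hi; rw [rowLen_eq_zero μ (hμ.trans (by omega)), rowLen_eq_zero ν (hν.trans (by omega))]
    | succ k ih =>
      intro i hi
      rcases lt_or_ge i M with hiM | hiM
      · have h1 := ih (i + 1) (by omega)
        have h2 := h i hiM
        have h3 := μ.rowLen_anti i (i + 1) (Nat.le_succ i)
        have h4 := ν.rowLen_anti i (i + 1) (Nat.le_succ i)
        omega
      · exact ih i (by omega)
  apply SetLike.ext
  rintro ⟨i, j⟩
  rw [YoungDiagram.mem_iff_lt_rowLen, YoungDiagram.mem_iff_lt_rowLen, key M i (by omega)]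

/-- The generating function of all partitions converges for `0 < q < 1`. -/
theorem summable_pow_card (q : ℝ) (h0 : 0 < q) (h1 : q < 1) :
    Summable fun μ : YoungDiagram => q ^ μ.card := by
  classical
  refine summable_of_sum_le (c := Real.exp (q * (1 - q)⁻¹ * (1 - q)⁻¹))
    (fun μ => pow_nonneg h0.le _) fun S => ?_
  set M := S.sup fun μ => μ.colLen 0
  set K := S.sup fun μ => μ.rowLen 0
  have hM : ∀ μ ∈ S, μ.colLen 0 ≤ M := fun μ hμ => le_sup (f := fun μ => μ.colLen 0) hμ
  have hK : ∀ μ ∈ S, μ.rowLen 0 ≤ K := fun μ hμ => le_sup (f := fun μ => μ.rowLen 0) hμ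
  let d : YoungDiagram → Fin M → ℕ := fun μ i => μ.rowLen i - μ.rowLen (i + 1)
  let w : (Fin M → ℕ) → ℝ := fun m => ∏ i : Fin M, (q ^ ((i : ℕ) + 1)) ^ m i
  have hw : ∀ μ ∈ S, q ^ μ.card = w (d μ) := by
    intro μ hμ
    have h := sum_range_diff μ.rowLen (fun _ _ hab => μ.rowLen_anti _ _ hab) M
    rw [rowLen_eq_zero μ (hM μ hμ), mul_zero, add_zero, sum_range_rowLen μ M (hM μ hμ)] at h
    simp only [w, d, ← pow_mul]
    rw [Finset.prod_pow_eq_pow_sum, ← h, ← Fin.sum_univ_eq_sum_range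
      (fun i => (i + 1) * (μ.rowLen i - μ.rowLen (i + 1))) M]
  have hinj : Set.InjOn d S := by
    intro μ hμ ν hν h
    exact eq_of_diff_eq μ ν M (hM μ hμ) (hM ν hν) fun i hi => congrFun h ⟨i, hi⟩
  have hsub : S.image d ⊆ Fintype.piFinset fun _ : Fin M => range (K + 1) := by
    intro m hm
    obtain ⟨μ, hμ, rfl⟩ := Finset.mem_image.1 hm
    refine Fintype.mem_piFinset.2 fun i => Finset.mem_range.2 ?_
    have := μ.rowLen_anti 0 i (Nat.zero_le _)
    have := hK μ hμ
    simp only [d]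
    omega
  have hq : 0 < 1 - q := sub_pos.2 h1
  calc ∑ μ ∈ S, q ^ μ.card = ∑ μ ∈ S, w (d μ) := sum_congr rfl hw
    _ = ∑ m ∈ S.image d, w m := (sum_image hinj).symm
    _ ≤ ∑ m ∈ Fintype.piFinset fun _ : Fin M => range (K + 1), w m :=
        sum_le_sum_of_subset_of_nonneg hsub fun m _ _ =>
          prod_nonneg fun i _ => pow_nonneg (pow_nonneg h0.le _) _
    _ = ∏ i : Fin M, ∑ k ∈ range (K + 1), (q ^ ((i : ℕ) + 1)) ^ k :=
        (prod_univ_sum (fun _ => range (K + 1))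
          (fun (i : Fin M) k => (q ^ ((i : ℕ) + 1)) ^ k)).symm
    _ ≤ ∏ i : Fin M, Real.exp (q * (1 - q)⁻¹ * q ^ (i : ℕ)) := by
        refine prod_le_prod (fun i _ => sum_nonneg fun k _ => pow_nonneg (pow_nonneg h0.le _) _)
          fun i _ => ?_
        have hx0 : 0 ≤ q ^ ((i : ℕ) + 1) := pow_nonneg h0.le _
        have hxq : q ^ ((i : ℕ) + 1) ≤ q := pow_le_of_le_one h0.le h1.le (Nat.succ_ne_zero _)
        have hx1 : q ^ ((i : ℕ) + 1) < 1 := hxq.trans_lt h1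
        calc ∑ k ∈ range (K + 1), (q ^ ((i : ℕ) + 1)) ^ k ≤ (1 - q ^ ((i : ℕ) + 1))⁻¹ := by
              rw [← tsum_geometric_of_lt_one hx0 hx1]
              exact (summable_geometric_of_lt_one hx0 hx1).sum_le_tsum _
                fun k _ => pow_nonneg hx0 k
          _ = 1 + q ^ ((i : ℕ) + 1) * (1 - q ^ ((i : ℕ) + 1))⁻¹ := by
              have : 1 - q ^ ((i : ℕ) + 1) ≠ 0 := by linarith
              field_simp
              ring
          _ ≤ 1 + q ^ ((i : ℕ) + 1) * (1 - q)⁻¹ := by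
              gcongr
          _ = q * (1 - q)⁻¹ * q ^ (i : ℕ) + 1 := by ring
          _ ≤ _ := Real.add_one_le_exp _
    _ = Real.exp (q * (1 - q)⁻¹ * ∑ i ∈ range M, q ^ i) := by
        rw [← Real.exp_sum, ← mul_sum, Fin.sum_univ_eq_sum_range (fun i => q ^ i) M]
    _ ≤ _ := by
        have : ∑ i ∈ range M, q ^ i ≤ (1 - q)⁻¹ := by
          rw [← tsum_geometric_of_lt_one h0.le h1]
          exact (summable_geometric_of_lt_one h0.le h1).sum_le_tsum _
            fun k _ => pow_nonneg h0.le k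
        have : 0 ≤ q * (1 - q)⁻¹ := mul_nonneg h0.le (inv_nonneg.2 hq.le)
        gcongr

end Summability

/-- The discrete σ-algebra on the countable set of all partitions. -/
instance : MeasurableSpace YoungDiagram := ⊤

/-- The law `ℙ^q` on all partitions, identified with their Young diagrams:
`ℙ^q(λ) = q ^ |λ| / Z(q)` with `Z(q) = ∑ q ^ |λ|`, for `0 < q < 1`. -/
noncomputable def partitionPMF (q : Ioo (0 : ℝ) 1) : PMF YoungDiagram :=
  PMF.normalize (fun μ => ENNReal.ofReal ((q : ℝ) ^ μ.card))
    (fun h => by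
      have h' := ENNReal.tsum_eq_zero.1 h ⊥
      rw [ENNReal.ofReal_eq_zero] at h'
      exact absurd h' (not_le.2 (pow_pos q.2.1 _)))
    (summable_pow_card q q.2.1 q.2.2).tsum_ofReal_ne_top

/-- `ℙ^q` as a measure. -/
noncomputable def partitionLaw (q : Ioo (0 : ℝ) 1) : Measure YoungDiagram :=
  (partitionPMF q).toMeasure

instance (q : Ioo (0 : ℝ) 1) : IsProbabilityMeasure (partitionLaw q) :=
  inferInstanceAs (IsProbabilityMeasure (partitionPMF q).toMeasure)

/-! ### The boundary of a Young diagram in rotated coordinates -/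

/-- The boundary lattice path `X_k`, `k ∈ ℤ`, of a Young diagram. Place the cell in row `i` and
column `j` at the unit square `[j, j+1] × [i, i+1]` and use the coordinates `(x - y, x + y)` for the
point `(x, y)`. The boundary of the diagram, together with the two half-axes that continue it,
crosses the line `x - y = k` at height `|k|` if there is no cell `(i, j)` with `j - i = k`, and
each such cell, whose lower and upper corners lie on this line, lifts the crossing point by `2`. -/
def boundaryPath (μ : YoungDiagram) (k : ℤ) : ℤ :=
  |k| + 2 * ((μ.cells.filter fun c => (c.2 : ℤ) - c.1 = k).card : ℤ)

/-- The boundary `X_s`, `s ∈ ℝ`: the piecewise linear function interpolating the lattice path. -/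
noncomputable def boundary (μ : YoungDiagram) (s : ℝ) : ℝ :=
  (1 - Int.fract s) * boundaryPath μ ⌊s⌋ + Int.fract s * boundaryPath μ (⌊s⌋ + 1)

theorem boundary_eq_of_mem_Icc (μ : YoungDiagram) (k : ℤ) {s : ℝ}
    (hs : s ∈ Icc (k : ℝ) (k + 1)) :
    boundary μ s = (1 - (s - k)) * boundaryPath μ k + (s - k) * boundaryPath μ (k + 1) := by
  rcases hs.2.lt_or_eq with h | h
  · have hf : ⌊s⌋ = k := Int.floor_eq_iff.2 ⟨hs.1, h⟩
    rw [boundary, Int.fract, hf]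
  · have hf : ⌊s⌋ = k + 1 := by rw [h]; exact_mod_cast Int.floor_intCast (R := ℝ) (k + 1)
    rw [boundary, Int.fract, hf, h]
    push_cast
    ring

theorem continuous_boundary (μ : YoungDiagram) : Continuous (boundary μ) := by
  have hlf : LocallyFinite fun k : ℤ => Icc (k : ℝ) (k + 1) := by
    intro t
    refine ⟨Ioo (t - 1) (t + 1), Ioo_mem_nhds (by linarith) (by linarith),
      (Set.finite_Icc (⌊t⌋ - 3) (⌊t⌋ + 3)).subset ?_⟩
    rintro k ⟨u, hk, hu⟩
    have h1 := Int.floor_le t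
    have h2 := Int.lt_floor_add_one t
    have h3 : ((⌊t⌋ - 3 : ℤ) : ℝ) ≤ k := by push_cast; linarith [hk.2, hu.1]
    have h4 : (k : ℝ) ≤ ((⌊t⌋ + 3 : ℤ) : ℝ) := by push_cast; linarith [hk.1, hu.2]
    exact ⟨by exact_mod_cast h3, by exact_mod_cast h4⟩
  refine hlf.continuous (iUnion_eq_univ_iff.2 fun s => ⟨⌊s⌋, Int.floor_le s,
    (Int.lt_floor_add_one s).le⟩) (fun _ => isClosed_Icc) fun k => ?_
  refine ContinuousOn.congr (f := fun s : ℝ =>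
    (1 - (s - k)) * boundaryPath μ k + (s - k) * boundaryPath μ (k + 1)) ?_
    fun s hs => boundary_eq_of_mem_Icc μ k hs
  fun_prop

/-! ### Limit curve, fluctuations and limit process -/

/-- Vershik's curve `L_∞(s) = log (2 cosh s)`. -/
noncomputable def vershikCurve (s : ℝ) : ℝ := Real.log (2 * Real.cosh s)

theorem continuous_vershikCurve : Continuous vershikCurve :=
  Continuous.log (by fun_prop) fun s => (mul_pos two_pos (Real.cosh_pos s)).ne'

/-- The scale `ε = (1 - q) / 2` at which the lattice path follows Vershik's curve. -/
noncomputable def scale (q : ℝ) : ℝ := (1 - q) / 2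

/-- The rescaled fluctuation `s ↦ (√2 cosh s / √ε) (ε X_{s/ε} - L_∞(s))`, `ε = (1 - q) / 2`, of the
boundary of a partition, as an element of `D(ℝ)`. -/
noncomputable def fluctuation (q : ℝ) (μ : YoungDiagram) : SkorokhodSpace :=
  SkorokhodSpace.ofContinuous
    (fun s => Real.sqrt 2 * Real.cosh s / Real.sqrt (scale q) *
      (scale q * boundary μ (s / scale q) - vershikCurve s))
    (by
      have h1 := continuous_boundary μ
      have h2 := continuous_vershikCurve
      fun_prop)

/-- `Y` is a two-sided stationary Ornstein–Uhlenbeck process: a centred Gaussian process on `ℝ`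
with covariance `e^{-|t-s|}` and almost surely continuous paths. -/
structure IsStationaryOU {Ω : Type*} [MeasurableSpace Ω] (Y : ℝ → Ω → ℝ) (P : Measure Ω) :
    Prop where
  isGaussianProcess : IsGaussianProcess Y P
  centered : ∀ t, ∫ ω, Y t ω ∂P = 0
  covariance : ∀ s t, ∫ ω, Y s ω * Y t ω ∂P = Real.exp (-|t - s|)
  continuous_paths : ∀ᵐ ω ∂P, Continuous fun t => Y t ω

end UnconfinedPartitions

/-!
Let `A_k` be the number of down-steps of the boundary path to the right of `k` (`downSteps`), so
that `X_k = 2 A_k + k`. Adding one cell to each row whose down-step lies to the right of `k`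
(`insertStrip`) inserts an up-step at `k`, does not change the path to the left of `k`, and
multiplies the weight `q ^ |λ|` by `q ^ A_k`. It is a bijection onto the diagrams with an up-step
at `k`. Hence, given the path up to `k`, an up-step has probability `q ^ A_k`
(`setIntegral_upSteps`): the boundary is a Markov chain that comes from `-∞`.

With `Q_k = q ^ (-k)` (`expTime`) and `a = (1 - q) / q` (`growth`), the process
`N_k = Q_k (q ^ (-A_k) - 1)` (`expMart`) is a nonnegative martingale that starts from `1` at `-∞`.
Its increment is `a N_k` with probability `Q_k / (N_k + Q_k)` and `-a Q_k` otherwise (`integral_step`).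
Its moments up to the fourth follow from recursions in `k` and are polynomials in `a` and `Q`
(`expect_martAlg_sub_pow_four`). In particular `N` has variance `a Q_k`, so that `N` is close
to `1` for `q` near `1`, and the conditional variance `a ^ 2 N_k Q_k` of its increment is close to
the deterministic `a (Q_(k+1) - Q_k)`. So `(N_k - 1) / √a` resembles a Brownian motion at time
`Q_k`. A step-by-step comparison of characteristic functions, telescoped from `-∞`, proves
this quantitatively (`norm_charFun_stoppedSum_sub_one_le`).

The path is a function of the martingale: `X_k` is, up to the factor `-log q / 2`, Vershik's curve
plus `log ((N_k + Q_k) / (1 + Q_k))` (`logMart_eq`). Linearising the logarithm shows that the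
fluctuation at `t` is asymptotically `e ^ (-t) W(e ^ (2 t))` with a Brownian motion `W`, since
`Q → e ^ (2 t)` at `k = ⌊t / ε⌋`. This is the stationary Ornstein–Uhlenbeck process, and the
finite-dimensional distributions converge (`tendsto_charFun_fluctuation`).

For tightness, the fourth moments of `N_k - N_j` and of `N_j - 1`, together with the Lipschitz
continuity of the path at distances below the lattice spacing, give the Kolmogorov bound
`P(|F_s - F_t| > x) ≤ C |s - t| ^ 2 / x ^ 4` uniformly in `q ≥ 1 / 2`
(`exists_measure_fluctuation_sub_le`), hence tightness on `C(ℝ, ℝ)` by Arzelà–Ascoli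
(`isTightMeasureSet_of_increments`). By Prokhorov's theorem the laws converge on `C(ℝ, ℝ)`
(`exists_tendsto_of_isTightMeasureSet`), which also yields the existence of the limit process. The
inclusion of `C(ℝ, ℝ)` into the Skorokhod space is continuous (`continuous_toSkorokhod`) and
transports the convergence.
-/

namespace UnconfinedPartitions

/-! ### Down-steps of the boundary path and the strip insertion -/

/-- The number of down-steps of the boundary path of `μ` to the right of position `k`: the number
of cells on the diagonal `j - i = k`, plus `-k` if `k < 0`. -/
def downSteps (μ : YoungDiagram) (k : ℤ) : ℕ :=
  (μ.cells.filter fun c => (c.2 : ℤ) - c.1 = k).card + (-k).toNat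

/-- The down-steps right of `k` come from an initial segment of rows: row `i` contributes the
down-step that starts at position `rowLen i - i - 1`. -/
theorem lt_downSteps_iff (μ : YoungDiagram) (k : ℤ) (i : ℕ) :
    i < downSteps μ k ↔ k + i < μ.rowLen i := by
  classical
  have hex : ∃ n : ℕ, ¬ (k + n < μ.rowLen n) := by
    refine ⟨μ.rowLen 0 + (-k).toNat, ?_⟩
    have := μ.rowLen_anti 0 (μ.rowLen 0 + (-k).toNat) (Nat.zero_le _)
    push Not
    push_cast
    omega
  set n := Nat.find hex with hn
  have hP : ∀ i : ℕ, k + i < μ.rowLen i ↔ i < n := by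
    intro i
    constructor
    · intro h
      by_contra hni
      have h1 := Nat.find_spec hex
      have h2 := μ.rowLen_anti n i (not_lt.1 hni)
      have h3 := not_lt.1 hni
      rw [← hn] at h1
      omega
    · intro h
      exact not_not.1 (Nat.find_min hex h)
  have hkn : (-k).toNat ≤ n := by
    by_contra h
    have := mt (hP n).1 (lt_irrefl n)
    omega
  have hcard : (μ.cells.filter fun c => (c.2 : ℤ) - c.1 = k).card = n - (-k).toNat := by
    rw [← Nat.card_Ico]
    refine Finset.card_bij (fun c _ => c.1) ?_ ?_ ?_
    · rintro ⟨a, b⟩ hc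
      simp only [Finset.mem_filter, YoungDiagram.mem_cells, YoungDiagram.mem_iff_lt_rowLen] at hc
      simp only [Finset.mem_Ico]
      exact ⟨by omega, (hP a).1 (by omega)⟩
    · rintro ⟨a, b⟩ hc ⟨a', b'⟩ hc' h
      simp only [Finset.mem_filter] at hc hc'
      simp only at h
      ext <;> simp <;> omega
    · intro a ha
      rw [Finset.mem_Ico] at ha
      have h1 := (hP a).2 ha.2
      refine ⟨(a, (k + a).toNat), ?_, rfl⟩
      simp only [Finset.mem_filter, YoungDiagram.mem_cells, YoungDiagram.mem_iff_lt_rowLen]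
      omega
  rw [hP, downSteps, hcard]
  omega

theorem boundaryPath_eq (μ : YoungDiagram) (k : ℤ) :
    boundaryPath μ k = 2 * downSteps μ k + k := by
  rw [boundaryPath, downSteps]
  push_cast
  rcases le_total 0 k with h | h
  · rw [abs_of_nonneg h]; omega
  · rw [abs_of_nonpos h]; omega

theorem downSteps_succ_le (μ : YoungDiagram) (k : ℤ) : downSteps μ (k + 1) ≤ downSteps μ k := by
  refine le_of_forall_lt fun i hi => ?_
  rw [lt_downSteps_iff] at hi ⊢
  omega

theorem downSteps_le_succ (μ : YoungDiagram) (k : ℤ) :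
    downSteps μ k ≤ downSteps μ (k + 1) + 1 := by
  by_contra! h
  have h1 := (lt_downSteps_iff μ k _).1 h
  have h2 := mt (lt_downSteps_iff μ (k + 1) _).2 (lt_irrefl _)
  have h3 := μ.rowLen_anti (downSteps μ (k + 1)) (downSteps μ (k + 1) + 1) (Nat.le_succ _)
  push_cast at h1
  omega

theorem abs_boundaryPath_succ_sub (μ : YoungDiagram) (k : ℤ) :
    |boundaryPath μ (k + 1) - boundaryPath μ k| = 1 := by
  rw [boundaryPath_eq, boundaryPath_eq]
  have h1 := downSteps_succ_le μ k
  have h2 := downSteps_le_succ μ k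
  obtain h | h : downSteps μ k = downSteps μ (k + 1) ∨ downSteps μ k = downSteps μ (k + 1) + 1 := by
    omega
  · rw [h]; ring_nf; simp
  · rw [h]; push_cast; ring_nf; simp

/-- Far to the left the path follows the half-axis, where every step is a down-step. -/
theorem downSteps_eventually (μ : YoungDiagram) :
    ∀ᶠ k : ℤ in atBot, (downSteps μ k : ℤ) = -k := by
  refine eventually_atBot.2 ⟨-(μ.colLen 0 : ℤ) - 1, fun k hk => ?_⟩
  have h0 : μ.cells.filter (fun c => (c.2 : ℤ) - c.1 = k) = ∅ := by
    refine Finset.filter_eq_empty_iff.2 ?_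
    rintro ⟨a, b⟩ hc
    have h1 : (a, 0) ∈ μ := μ.up_left_mem le_rfl (Nat.zero_le b) hc
    have h2 := YoungDiagram.mem_iff_lt_colLen.1 h1
    simp only
    omega
  rw [downSteps, h0]
  simp
  omega

/-- For `k ≤ 0` the diagonal `k` is not longer than the main diagonal. -/
theorem downSteps_le_of_nonpos (μ : YoungDiagram) {k : ℤ} (hk : k ≤ 0) :
    (downSteps μ k : ℤ) ≤ downSteps μ 0 - k := by
  by_contra! h
  have h2 := (lt_downSteps_iff μ k (downSteps μ 0 + (-k).toNat)).1 (by omega)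
  have h3 := mt (lt_downSteps_iff μ 0 (downSteps μ 0)).2 (lt_irrefl _)
  have h4 := μ.rowLen_anti (downSteps μ 0) (downSteps μ 0 + (-k).toNat) (by omega)
  push_cast at h2
  omega

/-- The main diagonal spans a square inside the diagram. -/
theorem downSteps_zero_sq_le_card (μ : YoungDiagram) : downSteps μ 0 ^ 2 ≤ μ.card := by
  have hsub : Finset.range (downSteps μ 0) ×ˢ Finset.range (downSteps μ 0) ⊆ μ.cells := by
    rintro ⟨a, b⟩ hc
    simp only [Finset.mem_product, Finset.mem_range] at hc
    have h := (lt_downSteps_iff μ 0 (downSteps μ 0 - 1)).1 (by omega)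
    have h2 := μ.rowLen_anti a (downSteps μ 0 - 1) (by omega)
    rw [YoungDiagram.mem_cells, YoungDiagram.mem_iff_lt_rowLen]
    omega
  have := Finset.card_le_card hsub
  rwa [Finset.card_product, Finset.card_range, ← sq] at this

/-- The strip insertion at `k`: one more cell in each of the rows that have their down-step to the
right of `k`. On the boundary path it inserts an up-step at `k` and shifts the part of the path
to the right of `k` by one. -/
def insertStrip (k : ℤ) (μ : YoungDiagram) : YoungDiagram where
  cells := μ.cells ∪ (Finset.range (downSteps μ k)).image fun i => (i, μ.rowLen i)
  isLowerSet := by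
    rintro ⟨i, j⟩ ⟨i', j'⟩ ⟨hi, hj⟩ h
    simp only at hi hj
    simp only [Finset.coe_union, Set.mem_union, Finset.mem_coe, YoungDiagram.mem_cells,
      Finset.mem_image, Finset.mem_range, Prod.mk.injEq, YoungDiagram.mem_iff_lt_rowLen] at h ⊢
    have h1 := μ.rowLen_anti i' i hi
    rcases h with h | ⟨a, ha, rfl, rfl⟩
    · exact Or.inl (by omega)
    · by_cases hlt : j' < μ.rowLen i'
      · exact Or.inl hlt
      · exact Or.inr ⟨i', by omega, rfl, by omega⟩

theorem rowLen_insertStrip (k : ℤ) (μ : YoungDiagram) (i : ℕ) :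
    (insertStrip k μ).rowLen i = μ.rowLen i + if i < downSteps μ k then 1 else 0 := by
  refine eq_of_forall_lt_iff fun j => ?_
  rw [← YoungDiagram.mem_iff_lt_rowLen, ← YoungDiagram.mem_cells, insertStrip]
  simp only [Finset.mem_union, YoungDiagram.mem_cells, Finset.mem_image, Finset.mem_range,
    Prod.mk.injEq, YoungDiagram.mem_iff_lt_rowLen]
  constructor
  · rintro (h | ⟨a, ha, rfl, rfl⟩)
    · omega
    · rw [if_pos ha]; omega
  · intro h
    split_ifs at h with hi
    · by_cases hlt : j < μ.rowLen i
      · exact Or.inl hlt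
      · exact Or.inr ⟨i, hi, rfl, by omega⟩
    · exact Or.inl h

theorem card_insertStrip (k : ℤ) (μ : YoungDiagram) :
    (insertStrip k μ).card = μ.card + downSteps μ k := by
  rw [YoungDiagram.card, insertStrip, Finset.card_union_of_disjoint,
    Finset.card_image_of_injective, Finset.card_range]
  · intro a b h
    exact (Prod.mk.inj h).1
  · rw [Finset.disjoint_left]
    intro c hc h
    obtain ⟨i, -, rfl⟩ := Finset.mem_image.1 h
    rw [YoungDiagram.mem_cells, YoungDiagram.mem_iff_lt_rowLen] at hc
    exact lt_irrefl _ hc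

/-- The strip insertion at `k` does not change the path to the left of `k`. -/
theorem downSteps_insertStrip {j k : ℤ} (h : j ≤ k) (μ : YoungDiagram) :
    downSteps (insertStrip k μ) j = downSteps μ j := by
  refine eq_of_forall_lt_iff fun i => ?_
  rw [lt_downSteps_iff, lt_downSteps_iff, rowLen_insertStrip]
  have := lt_downSteps_iff μ k i
  split_ifs <;> omega

/-- After the strip insertion at `k` the path makes an up-step at `k`. -/
theorem downSteps_insertStrip_succ (k : ℤ) (μ : YoungDiagram) :
    downSteps (insertStrip k μ) (k + 1) = downSteps μ k := by
  refine eq_of_forall_lt_iff fun i => ?_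
  rw [lt_downSteps_iff, rowLen_insertStrip]
  have := lt_downSteps_iff μ k i
  split_ifs <;> omega

theorem ext_rowLen {μ ν : YoungDiagram} (h : ∀ i, μ.rowLen i = ν.rowLen i) : μ = ν := by
  apply SetLike.ext
  rintro ⟨i, j⟩
  rw [YoungDiagram.mem_iff_lt_rowLen, YoungDiagram.mem_iff_lt_rowLen, h]

theorem insertStrip_injective (k : ℤ) : Function.Injective (insertStrip k) := by
  intro μ ν h
  refine ext_rowLen fun i => ?_
  have h1 := downSteps_insertStrip le_rfl μ (k := k)
  have h2 := downSteps_insertStrip le_rfl ν (k := k)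
  have h3 := rowLen_insertStrip k μ i
  have h4 := rowLen_insertStrip k ν i
  rw [h] at h1 h3
  rw [h1] at h2
  rw [h2] at h3
  omega

/-- The path of `μ` makes an up-step from `k` to `k + 1`. -/
def upSteps (k : ℤ) : Set YoungDiagram := {μ | downSteps μ (k + 1) = downSteps μ k}

theorem range_insertStrip (k : ℤ) : range (insertStrip k) = upSteps k := by
  ext μ
  constructor
  · rintro ⟨ν, rfl⟩
    rw [upSteps, mem_ofPred_eq, downSteps_insertStrip_succ, downSteps_insertStrip le_rfl]
  · intro h
    have hup : ∀ i, i < downSteps μ k → k + 1 + i < μ.rowLen i := fun i hi =>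
      (lt_downSteps_iff μ (k + 1) i).1 (by rw [h]; exact hi)
    have hle : ∀ i, ¬ i < downSteps μ k → μ.rowLen i ≤ k + i := fun i hi =>
      not_lt.1 (mt (lt_downSteps_iff μ k i).2 hi)
    have hm : ∀ i, i < downSteps μ k → 0 < μ.rowLen i := by
      intro i hi
      have h1 := hup (downSteps μ k - 1) (by omega)
      have h2 := hle (downSteps μ k) (by omega)
      have h3 := μ.rowLen_anti i (downSteps μ k - 1) (by omega)
      omega
    let ν : YoungDiagram :=
      { cells := μ.cells.filter fun c => c.2 + (if c.1 < downSteps μ k then 1 else 0) <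
          μ.rowLen c.1
        isLowerSet := by
          rintro ⟨i, j⟩ ⟨i', j'⟩ ⟨hi, hj⟩ hc
          simp only at hi hj
          simp only [Finset.coe_filter, mem_ofPred_eq, YoungDiagram.mem_cells,
            YoungDiagram.mem_iff_lt_rowLen] at hc ⊢
          have h1 := μ.rowLen_anti i' i hi
          refine ⟨by omega, ?_⟩
          by_cases hi1 : i < downSteps μ k
          · rw [if_pos hi1] at hc
            rw [if_pos (by omega)]
            omega
          · by_cases hi2 : i' < downSteps μ k
            · rw [if_pos hi2]
              have := hup i' hi2
              have := hup (downSteps μ k - 1) (by omega)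
              have := μ.rowLen_anti i' (downSteps μ k - 1) (by omega)
              have := hle i hi1
              have := hle (downSteps μ k) (by omega)
              have := μ.rowLen_anti (downSteps μ k) i (by omega)
              omega
            · rw [if_neg hi2]
              omega }
    have hν : ∀ i, ν.rowLen i = μ.rowLen i - if i < downSteps μ k then 1 else 0 := by
      intro i
      refine eq_of_forall_lt_iff fun j => ?_
      rw [← YoungDiagram.mem_iff_lt_rowLen, ← YoungDiagram.mem_cells]
      simp only [ν, Finset.mem_filter, YoungDiagram.mem_cells, YoungDiagram.mem_iff_lt_rowLen]
      omega
    have hd : downSteps ν k = downSteps μ k := by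
      refine eq_of_forall_lt_iff fun i => ?_
      rw [lt_downSteps_iff, hν]
      by_cases hi : i < downSteps μ k
      · have := hup i hi
        have := hm i hi
        simp only [hi, if_true, iff_true]
        omega
      · have := hle i hi
        simp only [hi, if_false, iff_false]
        omega
    refine ⟨ν, ext_rowLen fun i => ?_⟩
    rw [rowLen_insertStrip, hd, hν]
    by_cases hi : i < downSteps μ k
    · have := hm i hi
      simp only [hi, if_true]
      omega
    · simp [hi]

/-! ### One step of the boundary path under `ℙ^q` -/

instance : DiscreteMeasurableSpace YoungDiagram := ⟨fun _ => trivial⟩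

instance : Countable YoungDiagram :=
  Function.Injective.countable (f := YoungDiagram.cells) fun _ _ h => YoungDiagram.ext h

theorem partitionLaw_singleton (q : Ioo (0 : ℝ) 1) (μ : YoungDiagram) :
    partitionLaw q {μ} = ENNReal.ofReal ((q : ℝ) ^ μ.card) *
      (∑' ν : YoungDiagram, ENNReal.ofReal ((q : ℝ) ^ ν.card))⁻¹ := by
  rw [partitionLaw, PMF.toMeasure_apply_singleton _ _ (.of_discrete), partitionPMF,
    PMF.normalize_apply]

/-- The strip insertion at `k` multiplies the weight of `μ` by `q ^ A`, where `A` is the number of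
down-steps to the right of `k`, and it is a bijection onto the diagrams with an up-step at `k`. -/
theorem map_insertStrip_withDensity (q : Ioo (0 : ℝ) 1) (k : ℤ) :
    ((partitionLaw q).withDensity fun μ => ENNReal.ofReal ((q : ℝ) ^ downSteps μ k)).map
      (insertStrip k) = (partitionLaw q).restrict (upSteps k) := by
  have hq := q.2.1
  refine Measure.ext_of_singleton fun ν => ?_
  rw [Measure.map_apply (measurable_of_countable _) (MeasurableSet.singleton ν),
    Measure.restrict_apply (MeasurableSet.singleton ν)]
  by_cases hν : ν ∈ upSteps k
  · rw [inter_eq_left.2 (singleton_subset_iff.2 hν)]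
    rw [← range_insertStrip] at hν
    obtain ⟨μ, rfl⟩ := hν
    have : insertStrip k ⁻¹' {insertStrip k μ} = {μ} := by
      ext ρ
      simp [(insertStrip_injective k).eq_iff]
    rw [this, withDensity_apply _ (MeasurableSet.singleton μ), lintegral_singleton,
      partitionLaw_singleton, partitionLaw_singleton, card_insertStrip, ← mul_assoc,
      ← ENNReal.ofReal_mul (by positivity), pow_add, mul_comm ((q : ℝ) ^ μ.card)]
  · rw [singleton_inter_eq_empty.2 hν, measure_empty]
    have : insertStrip k ⁻¹' {ν} = ∅ := by
      rw [preimage_singleton_eq_empty, range_insertStrip]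
      exact hν
    rw [this, measure_empty]

/-- Given the path up to `k`, an up-step at `k` has probability `q ^ A`, where `A` is the number of
remaining down-steps: functions of the path up to `k` are invariant under the strip insertion. -/
theorem setIntegral_upSteps {E : Type*} [NormedAddCommGroup E] [NormedSpace ℝ E]
    (q : Ioo (0 : ℝ) 1) (k : ℤ) (g : YoungDiagram → E) (hg : ∀ μ, g (insertStrip k μ) = g μ) :
    ∫ μ in upSteps k, g μ ∂(partitionLaw q) =
      ∫ μ, (q : ℝ) ^ downSteps μ k • g μ ∂(partitionLaw q) := by
  have hq := q.2.1
  rw [← map_insertStrip_withDensity, integral_map (measurable_of_countable _).aemeasurable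
    .of_discrete, integral_withDensity_eq_integral_toReal_smul (measurable_of_countable _)
      (by simp)]
  refine integral_congr_ae (.of_forall fun μ => ?_)
  simp only
  rw [ENNReal.toReal_ofReal (by positivity), hg]

/-! ### Moderate growth -/

/-- Functions of a partition that grow at most like a power of `q ^ (-d)`, where `d` is the length
of the main diagonal. They are integrable under `ℙ^q` and form an algebra. -/
def Moderate (q : ℝ) {E : Type*} [NormedAddCommGroup E] (f : YoungDiagram → E) : Prop :=
  ∃ (C : ℝ) (p : ℕ), ∀ μ, ‖f μ‖ ≤ C * ((q ^ downSteps μ 0)⁻¹) ^ p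

section Moderate

variable {q : ℝ} {E : Type*} [NormedAddCommGroup E]

theorem one_le_inv_pow_downSteps (h0 : 0 < q) (h1 : q ≤ 1) (μ : YoungDiagram) (k : ℤ) :
    1 ≤ (q ^ downSteps μ k)⁻¹ :=
  (one_le_inv₀ (pow_pos h0 _)).2 (pow_le_one₀ h0.le h1)

theorem Moderate.exists_bound (hq : q ∈ Ioo (0 : ℝ) 1) {f : YoungDiagram → E}
    (hf : Moderate q f) : ∃ C : ℝ, 0 ≤ C ∧ ∃ p₀ : ℕ, ∀ p, p₀ ≤ p → ∀ μ,
      ‖f μ‖ ≤ C * ((q ^ downSteps μ 0)⁻¹) ^ p := by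
  obtain ⟨C, p, h⟩ := hf
  refine ⟨|C|, abs_nonneg C, p, fun p' hp μ => (h μ).trans ?_⟩
  have h1 := one_le_inv_pow_downSteps hq.1 hq.2.le μ 0
  calc C * ((q ^ downSteps μ 0)⁻¹) ^ p ≤ |C| * ((q ^ downSteps μ 0)⁻¹) ^ p := by
        gcongr
        exact le_abs_self C
    _ ≤ _ := by gcongr

theorem Moderate.of_bound (C : ℝ) {f : YoungDiagram → E} (h : ∀ μ, ‖f μ‖ ≤ C) :
    Moderate q f := ⟨C, 0, fun μ => by simpa using h μ⟩

theorem Moderate.const (c : E) : Moderate q fun _ : YoungDiagram => c :=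
  .of_bound ‖c‖ fun _ => le_rfl

theorem Moderate.mono {F : Type*} [NormedAddCommGroup F] {f : YoungDiagram → E}
    {g : YoungDiagram → F} (hg : Moderate q g) (h : ∀ μ, ‖f μ‖ ≤ ‖g μ‖) : Moderate q f := by
  obtain ⟨C, p, hC⟩ := hg
  exact ⟨C, p, fun μ => (h μ).trans (hC μ)⟩

theorem Moderate.add (hq : q ∈ Ioo (0 : ℝ) 1) {f g : YoungDiagram → E} (hf : Moderate q f)
    (hg : Moderate q g) : Moderate q fun μ => f μ + g μ := by
  obtain ⟨C, -, p, h⟩ := hf.exists_bound hq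
  obtain ⟨C', -, p', h'⟩ := hg.exists_bound hq
  refine ⟨C + C', max p p', fun μ => ?_⟩
  rw [add_mul]
  exact (norm_add_le _ _).trans (add_le_add (h _ (le_max_left _ _) μ) (h' _ (le_max_right _ _) μ))

theorem Moderate.sub (hq : q ∈ Ioo (0 : ℝ) 1) {f g : YoungDiagram → E} (hf : Moderate q f)
    (hg : Moderate q g) : Moderate q fun μ => f μ - g μ := by
  simp_rw [sub_eq_add_neg]
  exact hf.add hq (hg.mono fun μ => (norm_neg _).le)

theorem Moderate.smul [NormedSpace ℝ E] (hq : q ∈ Ioo (0 : ℝ) 1) {f : YoungDiagram → ℝ}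
    {g : YoungDiagram → E} (hf : Moderate q f) (hg : Moderate q g) :
    Moderate q fun μ => f μ • g μ := by
  obtain ⟨C, hC, p, h⟩ := hf.exists_bound hq
  obtain ⟨C', hC', p', h'⟩ := hg.exists_bound hq
  refine ⟨C * C', p + p', fun μ => ?_⟩
  have h1 := one_le_inv_pow_downSteps hq.1 hq.2.le μ 0
  rw [norm_smul, pow_add, mul_mul_mul_comm]
  exact mul_le_mul (h _ le_rfl μ) (h' _ le_rfl μ) (norm_nonneg _) (by positivity)

theorem Moderate.mul (hq : q ∈ Ioo (0 : ℝ) 1) {f g : YoungDiagram → ℝ} (hf : Moderate q f)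
    (hg : Moderate q g) : Moderate q fun μ => f μ * g μ :=
  hf.smul hq hg

theorem Moderate.pow (hq : q ∈ Ioo (0 : ℝ) 1) {f : YoungDiagram → ℝ} (hf : Moderate q f)
    (n : ℕ) : Moderate q fun μ => f μ ^ n := by
  induction n with
  | zero => simpa using Moderate.const (q := q) (1 : ℝ)
  | succ n ih => simpa only [pow_succ] using ih.mul hq hf

theorem Moderate.integrable (q : Ioo (0 : ℝ) 1) {f : YoungDiagram → E} (hf : Moderate q f) :
    Integrable f (partitionLaw q) := by
  obtain ⟨C, hC, p, h⟩ := hf.exists_bound q.2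
  have h := h p le_rfl
  refine ⟨.of_discrete, ?_⟩
  set r : ℝ := Real.sqrt q with hr
  have hq := q.2.1
  have hr0 : 0 < r := Real.sqrt_pos.2 hq
  have hr1 : r < 1 := by
    rw [hr, Real.sqrt_lt' one_pos, one_pow]
    exact q.2.2
  have hrq : (q : ℝ) = r ^ 2 := (Real.sq_sqrt hq.le).symm
  -- `2 p d ≤ d ^ 2 + p ^ 2` and `d ^ 2 ≤ |μ|`: half of the weight `q ^ |μ|` absorbs the growth
  have key : ∀ μ : YoungDiagram, ‖f μ‖ * (q : ℝ) ^ μ.card ≤ C * (r ^ p ^ 2)⁻¹ * r ^ μ.card := by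
    intro μ
    have h1 : r ^ (μ.card + p ^ 2) ≤ r ^ (2 * (downSteps μ 0 * p)) := by
      refine pow_le_pow_of_le_one hr0.le hr1.le ?_
      have := downSteps_zero_sq_le_card μ
      zify at this ⊢
      nlinarith [sq_nonneg ((downSteps μ 0 : ℤ) - p)]
    have h2 : ((q : ℝ) ^ downSteps μ 0)⁻¹ ^ p * (q : ℝ) ^ μ.card ≤
        (r ^ p ^ 2)⁻¹ * r ^ μ.card := by
      rw [hrq, inv_pow, ← pow_mul, ← pow_mul, ← pow_mul, inv_mul_le_iff₀ (by positivity)]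
      calc r ^ (2 * μ.card) = r ^ μ.card * (r ^ (μ.card + p ^ 2) * (r ^ p ^ 2)⁻¹) := by
            rw [pow_add]; field_simp; ring
        _ ≤ r ^ μ.card * (r ^ (2 * (downSteps μ 0 * p)) * (r ^ p ^ 2)⁻¹) := by gcongr
        _ = _ := by ring_nf
    calc ‖f μ‖ * (q : ℝ) ^ μ.card
        ≤ C * ((q : ℝ) ^ downSteps μ 0)⁻¹ ^ p * (q : ℝ) ^ μ.card := by gcongr; exact h μ
      _ = C * (((q : ℝ) ^ downSteps μ 0)⁻¹ ^ p * (q : ℝ) ^ μ.card) := by ring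
      _ ≤ C * ((r ^ p ^ 2)⁻¹ * r ^ μ.card) := by gcongr
      _ = _ := by ring
  rw [HasFiniteIntegral, lintegral_countable']
  set Z := ∑' ν : YoungDiagram, ENNReal.ofReal ((q : ℝ) ^ ν.card) with hZ
  have hZ0 : Z⁻¹ ≠ ⊤ := by
    rw [ENNReal.inv_ne_top]
    intro h0
    have h' := ENNReal.tsum_eq_zero.1 h0 ⊥
    rw [ENNReal.ofReal_eq_zero] at h'
    exact absurd h' (not_le.2 (pow_pos q.2.1 _))
  have hsum : Summable fun μ : YoungDiagram => C * (r ^ p ^ 2)⁻¹ * r ^ μ.card :=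
    (summable_pow_card r hr0 hr1).mul_left _
  calc ∑' μ, ‖f μ‖ₑ * partitionLaw q {μ}
      ≤ ∑' μ : YoungDiagram, ENNReal.ofReal (C * (r ^ p ^ 2)⁻¹ * r ^ μ.card) * Z⁻¹ := by
        refine ENNReal.tsum_le_tsum fun μ => ?_
        rw [partitionLaw_singleton, ← mul_assoc, ← ofReal_norm,
          ← ENNReal.ofReal_mul (norm_nonneg _)]
        gcongr ENNReal.ofReal ?_ * _
        exact key μ
    _ = (∑' μ : YoungDiagram, ENNReal.ofReal (C * (r ^ p ^ 2)⁻¹ * r ^ μ.card)) * Z⁻¹ :=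
        ENNReal.tsum_mul_right
    _ < ⊤ := ENNReal.mul_lt_top hsum.tsum_ofReal_ne_top.lt_top hZ0.lt_top

end Moderate

/-! ### The exponential martingale of the boundary path -/

/-- The deterministic factor `q ^ (-k)`, which is `e ^ (2 s)` in the limit `k = s / ε`. -/
noncomputable def expTime (q : ℝ) (k : ℤ) : ℝ := q ^ (-k)

/-- The relative increment `(1 - q) / q` of `expTime q`. -/
noncomputable def growth (q : ℝ) : ℝ := (1 - q) / q

/-- The exponential martingale `q ^ (-k) (q ^ (-A_k) - 1) = q ^ (-(X_k + k) / 2) - q ^ (-k)` of the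
boundary path, where `A_k` is the number of down-steps right of `k`. -/
noncomputable def expMart (q : ℝ) (k : ℤ) (μ : YoungDiagram) : ℝ :=
  expTime q k * ((q ^ downSteps μ k)⁻¹ - 1)

section ExpMart

variable {q : ℝ}

theorem expTime_pos (h0 : 0 < q) (k : ℤ) : 0 < expTime q k := zpow_pos h0 _

theorem expTime_succ (h0 : 0 < q) (k : ℤ) :
    expTime q (k + 1) = (1 + growth q) * expTime q k := by
  rw [expTime, expTime, growth, neg_add, zpow_add₀ h0.ne', zpow_neg_one]
  field_simp
  ring

theorem growth_pos (hq : q ∈ Ioo (0 : ℝ) 1) : 0 < growth q :=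
  div_pos (sub_pos.2 hq.2) hq.1

theorem expTime_mono (hq : q ∈ Ioo (0 : ℝ) 1) : Monotone (expTime q) := by
  refine monotone_int_of_le_succ fun k => ?_
  rw [expTime_succ hq.1]
  have := growth_pos hq
  have := expTime_pos hq.1 k
  nlinarith

theorem tendsto_expTime_atBot (hq : q ∈ Ioo (0 : ℝ) 1) :
    Tendsto (expTime q) atBot (𝓝 0) := by
  have h : Tendsto (fun k : ℤ => q ^ (-k).toNat) atBot (𝓝 0) :=
    (tendsto_pow_atTop_nhds_zero_of_lt_one hq.1.le hq.2).comp
      (tendsto_atTop.2 fun n => (eventually_le_atBot (-(n : ℤ))).mono fun k hk => by omega)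
  refine h.congr' ((eventually_le_atBot 0).mono fun k hk => ?_)
  rw [expTime, ← zpow_natCast, Int.toNat_of_nonneg (by omega)]

theorem expMart_nonneg (hq : q ∈ Ioo (0 : ℝ) 1) (k : ℤ) (μ : YoungDiagram) :
    0 ≤ expMart q k μ :=
  mul_nonneg (expTime_pos hq.1 k).le
    (sub_nonneg.2 (one_le_inv_pow_downSteps hq.1 hq.2.le μ k))

theorem pow_downSteps_eq (hq : q ∈ Ioo (0 : ℝ) 1) (k : ℤ) (μ : YoungDiagram) :
    q ^ downSteps μ k = expTime q k / (expMart q k μ + expTime q k) := by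
  have h1 := pow_pos hq.1 (downSteps μ k)
  have h2 := expTime_pos hq.1 k
  rw [expMart]
  have : expTime q k * ((q ^ downSteps μ k)⁻¹ - 1) + expTime q k =
    expTime q k * (q ^ downSteps μ k)⁻¹ := by ring
  rw [this]
  field_simp

theorem expMart_insertStrip {j k : ℤ} (h : j ≤ k) (μ : YoungDiagram) :
    expMart q j (insertStrip k μ) = expMart q j μ := by
  rw [expMart, expMart, downSteps_insertStrip h]

theorem expMart_succ_of_mem (h0 : 0 < q) {k : ℤ} {μ : YoungDiagram} (h : μ ∈ upSteps k) :
    expMart q (k + 1) μ - expMart q k μ = growth q * expMart q k μ := by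
  rw [expMart, expMart, expTime_succ h0, show downSteps μ (k + 1) = downSteps μ k from h]
  ring

theorem expMart_succ_of_notMem (h0 : 0 < q) {k : ℤ} {μ : YoungDiagram} (h : μ ∉ upSteps k) :
    expMart q (k + 1) μ - expMart q k μ = -(growth q * expTime q k) := by
  have h1 : downSteps μ k = downSteps μ (k + 1) + 1 := by
    have h2 := downSteps_succ_le μ k
    have h3 := downSteps_le_succ μ k
    have h4 : downSteps μ (k + 1) ≠ downSteps μ k := h
    omega
  rw [expMart, expMart, expTime_succ h0, h1, growth, pow_succ]
  have := pow_pos h0 (downSteps μ (k + 1))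
  field_simp
  ring

theorem downSteps_le_add (μ : YoungDiagram) (k : ℤ) :
    downSteps μ k ≤ downSteps μ 0 + k.natAbs := by
  rcases le_total k 0 with h | h
  · have := downSteps_le_of_nonpos μ h
    omega
  · have : ∀ n : ℕ, downSteps μ n ≤ downSteps μ 0 := by
      intro n
      induction n with
      | zero => simp
      | succ n ih =>
        have h1 := downSteps_succ_le μ n
        push_cast
        omega
    have h1 := this k.toNat
    rw [Int.toNat_of_nonneg h] at h1
    omega

theorem moderate_expMart (hq : q ∈ Ioo (0 : ℝ) 1) (k : ℤ) : Moderate q (expMart q k) := by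
  refine ⟨expTime q k * (q ^ k.natAbs)⁻¹, 1, fun μ => ?_⟩
  have h2 := expTime_pos hq.1 k
  have h3 := hq.1
  rw [Real.norm_of_nonneg (expMart_nonneg hq k μ), expMart, pow_one, mul_assoc]
  gcongr
  calc (q ^ downSteps μ k)⁻¹ - 1 ≤ (q ^ downSteps μ k)⁻¹ := by linarith
    _ ≤ (q ^ (k.natAbs + downSteps μ 0))⁻¹ := by
        gcongr ?_⁻¹
        exact pow_le_pow_of_le_one hq.1.le hq.2.le (by rw [add_comm]; exact downSteps_le_add μ k)
    _ = _ := by rw [pow_add, mul_inv]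

end ExpMart

/-- The one-step formula: the increment of the martingale at `k` is `growth q` times its value `N`
with probability `Q / (N + Q)`, `Q = expTime q k`, and `-growth q * Q` otherwise, independently of
the past. -/
theorem integral_step {E : Type*} [NormedAddCommGroup E] [NormedSpace ℝ E] [CompleteSpace E]
    (q : Ioo (0 : ℝ) 1) (k : ℤ) (g : ℝ → YoungDiagram → E)
    (hg : ∀ x μ, g x (insertStrip k μ) = g x μ)
    (hup : Moderate q fun μ => g (growth q * expMart q k μ) μ)
    (hdown : Moderate q fun μ => g (-(growth q * expTime q k)) μ) :
    ∫ μ, g (expMart q (k + 1) μ - expMart q k μ) μ ∂(partitionLaw q) =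
      ∫ μ, ((expTime q k / (expMart q k μ + expTime q k)) • g (growth q * expMart q k μ) μ +
        (expMart q k μ / (expMart q k μ + expTime q k)) • g (-(growth q * expTime q k)) μ)
        ∂(partitionLaw q) := by
  have hms : MeasurableSet (upSteps k) := trivial
  set fu := fun μ => g (growth q * expMart q k μ) μ with hfu
  set fd := fun μ => g (-(growth q * expTime q k)) μ with hfd
  have hfu' : ∀ μ, fu (insertStrip k μ) = fu μ := fun μ => by
    simp only [hfu, hg, expMart_insertStrip le_rfl]
  have hfd' : ∀ μ, fd (insertStrip k μ) = fd μ := fun μ => by simp only [hfd, hg]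
  have hp : ∀ μ, expTime (q : ℝ) k / (expMart q k μ + expTime q k) = (q : ℝ) ^ downSteps μ k :=
    fun μ => (pow_downSteps_eq q.2 k μ).symm
  have hp' : ∀ μ, expMart (q : ℝ) k μ / (expMart q k μ + expTime q k) =
      1 - (q : ℝ) ^ downSteps μ k := fun μ => by
    have h1 := expTime_pos q.2.1 k
    have h2 := expMart_nonneg q.2 k μ
    rw [pow_downSteps_eq q.2]
    field_simp
    ring
  have hmp : Moderate (q : ℝ) fun μ => (q : ℝ) ^ downSteps μ k := .of_bound 1 fun μ => by
    rw [Real.norm_of_nonneg (pow_nonneg q.2.1.le _)]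
    exact pow_le_one₀ q.2.1.le q.2.2.le
  have hIu := hup.integrable
  have hId := hdown.integrable
  have h1 := integral_add_compl (f := fun μ => g (expMart q (k + 1) μ - expMart q k μ) μ) hms
    (μ := partitionLaw q) (by
      refine (hIu.norm.add hId.norm).mono .of_discrete (.of_forall fun μ => ?_)
      simp only [Pi.add_apply]
      rw [Real.norm_of_nonneg (by positivity)]
      by_cases h : μ ∈ upSteps k
      · rw [expMart_succ_of_mem q.2.1 h]
        exact le_add_of_nonneg_right (norm_nonneg _)
      · rw [expMart_succ_of_notMem q.2.1 h]
        exact le_add_of_nonneg_left (norm_nonneg _))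
  rw [← h1, setIntegral_congr_fun (g := fu) hms fun μ h => by
      simp only [expMart_succ_of_mem q.2.1 h, hfu],
    setIntegral_congr_fun (g := fd) hms.compl fun μ h => by
      simp only [expMart_succ_of_notMem q.2.1 h, hfd],
    setIntegral_compl hms hId, setIntegral_upSteps q k fu hfu', setIntegral_upSteps q k fd hfd',
    ← integral_sub hId (hmp.smul q.2 hdown).integrable,
    ← integral_add (hmp.smul q.2 hup).integrable
      (hdown.sub q.2 (hmp.smul q.2 hdown)).integrable]
  refine integral_congr_ae (.of_forall fun μ => ?_)
  simp only [hp, hp', sub_smul, one_smul]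
  simp only [hfu, hfd]

/-! ### Moments of the martingale -/

/-- The algebra of real functions of a partition of moderate growth. -/
def moderateAlg (q : Ioo (0 : ℝ) 1) : Subalgebra ℝ (YoungDiagram → ℝ) where
  carrier := {f | Moderate (q : ℝ) f}
  mul_mem' hf hg := hf.mul q.2 hg
  add_mem' hf hg := hf.add q.2 hg
  algebraMap_mem' c := .const c

/-- The expectation under `ℙ^q`, as a linear functional on functions of moderate growth. -/
noncomputable def expect (q : Ioo (0 : ℝ) 1) : moderateAlg q →ₗ[ℝ] ℝ where
  toFun f := ∫ μ, (f : YoungDiagram → ℝ) μ ∂(partitionLaw q)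
  map_add' f g := integral_add (Moderate.integrable q f.2) (Moderate.integrable q g.2)
  map_smul' c _ := integral_const_mul c _

theorem expect_apply (q : Ioo (0 : ℝ) 1) (f : moderateAlg q) :
    expect q f = ∫ μ, (f : YoungDiagram → ℝ) μ ∂(partitionLaw q) := rfl

theorem expect_one (q : Ioo (0 : ℝ) 1) : expect q 1 = 1 := by
  simp [expect_apply]

/-- The martingale, as an element of the algebra of functions of moderate growth. -/
noncomputable def martAlg (q : Ioo (0 : ℝ) 1) (k : ℤ) : moderateAlg q :=
  ⟨expMart q k, moderate_expMart q.2 k⟩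

theorem martAlg_apply (q : Ioo (0 : ℝ) 1) (k : ℤ) (μ : YoungDiagram) :
    (martAlg q k : YoungDiagram → ℝ) μ = expMart q k μ := rfl

section Step

variable (q : Ioo (0 : ℝ) 1) (k : ℤ) (H R : moderateAlg q)
  (hH : ∀ μ, (H : YoungDiagram → ℝ) (insertStrip k μ) = (H : YoungDiagram → ℝ) μ)
  (hR : ∀ μ, (R : YoungDiagram → ℝ) (insertStrip k μ) = (R : YoungDiagram → ℝ) μ)

include hH hR in
/-- The conditional expectation, given the path up to `k`, of `(N_(k+1) - R) ^ n` for a random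
variable `R` determined by this path: with `d = N_k - R` it is the average of `(d + growth q * N) ^ n` and
`(d - growth q * Q) ^ n` with the weights `Q / (N + Q)` and `N / (N + Q)`. The function `m` is this
average in a form without denominators. -/
theorem expect_step_pow (n : ℕ) (m : moderateAlg q)
    (hm : ∀ d N Q : ℝ, ∀ μ, d = expMart q k μ - (R : YoungDiagram → ℝ) μ → N = expMart q k μ →
      Q = expTime q k → (m : YoungDiagram → ℝ) μ * (N + Q) =
        Q * (d + growth q * N) ^ n + N * (d + -(growth q * Q)) ^ n) :
    expect q (H * (martAlg q (k + 1) - R) ^ n) = expect q (H * m) := by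
  have h := integral_step q k
    (fun x μ => (H : YoungDiagram → ℝ) μ * (expMart q k μ - (R : YoungDiagram → ℝ) μ + x) ^ n)
    (fun x μ => by rw [hH, hR, expMart_insertStrip le_rfl])
    (H * (martAlg q k - R + growth q • martAlg q k) ^ n : moderateAlg q).2
    (H * (martAlg q k - R + algebraMap ℝ _ (-(growth q * expTime q k))) ^ n : moderateAlg q).2
  rw [expect_apply, expect_apply]
  convert! h using 1
  · refine integral_congr_ae (.of_forall fun μ => ?_)
    simp [martAlg_apply]
  · refine integral_congr_ae (.of_forall fun μ => ?_)
    have h1 := expTime_pos q.2.1 k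
    have h2 := expMart_nonneg q.2 k μ
    have h3 := hm _ _ _ μ rfl rfl rfl
    have h4 : expMart (q : ℝ) k μ + expTime (q : ℝ) k ≠ 0 := by positivity
    rw [← eq_div_iff h4] at h3
    simp only [MulMemClass.coe_mul, Pi.mul_apply, h3, smul_eq_mul]
    field_simp

end Step

/-- A random variable `R` measured at a starting position, with the moments that the martingale has
when `expTime q` has the value `y`, together with a set `S` of later positions. The last condition
says that the identity `𝔼 (R ^ b (N_k - R) ^ p) = c (expTime q k)` with `c y = 0` holds at the
start, hence on all of `S` if the difference of its two sides does not depend on `k`. -/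
structure StartingPoint (q : Ioo (0 : ℝ) 1) (S : Set ℤ) (R : moderateAlg q) (y : ℝ) : Prop where
  invariant : ∀ k ∈ S, ∀ μ, (R : YoungDiagram → ℝ) (insertStrip k μ) = (R : YoungDiagram → ℝ) μ
  moment_one : expect q R = 1
  moment_two : expect q (R ^ 2) = 1 + growth q * y
  moment_three : expect q (R ^ 3) =
    1 + (3 * growth q + growth q ^ 2) * y + growth q ^ 2 * y ^ 2
  start : ∀ (b p : ℕ) (c : ℝ → ℝ), p ≠ 0 → Continuous c → c y = 0 →
    (∀ k ∈ S, expect q (R ^ b * (martAlg q (k + 1) - R) ^ p) - c (expTime q (k + 1)) =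
      expect q (R ^ b * (martAlg q k - R) ^ p) - c (expTime q k)) →
    ∀ k ∈ S, expect q (R ^ b * (martAlg q k - R) ^ p) = c (expTime q k)

namespace StartingPoint

variable {q : Ioo (0 : ℝ) 1} {S : Set ℤ} {R : moderateAlg q} {y : ℝ} (h : StartingPoint q S R y)
include h

theorem invariant_pow (b : ℕ) {k : ℤ} (hk : k ∈ S) (μ : YoungDiagram) :
    ((R ^ b : moderateAlg q) : YoungDiagram → ℝ) (insertStrip k μ) =
      ((R ^ b : moderateAlg q) : YoungDiagram → ℝ) μ := by
  simp [h.invariant k hk]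

theorem moment_increment_one (b : ℕ) : ∀ k ∈ S,
    expect q (R ^ b * (martAlg q k - R) ^ 1) = 0 := by
  refine h.start b 1 (fun _ => 0) one_ne_zero continuous_const rfl fun k hk => ?_
  rw [expect_step_pow q k _ R (h.invariant_pow b hk) (h.invariant k hk) 1 ((martAlg q k - R) ^ 1)]
  rintro d N Q μ rfl rfl rfl
  simp [martAlg_apply]
  ring

theorem step_two (b : ℕ) {k : ℤ} (hk : k ∈ S) :
    expect q (R ^ b * (martAlg q (k + 1) - R) ^ 2) =
      expect q (R ^ b * (martAlg q k - R) ^ 2) + growth q ^ 2 * expTime q k *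
        (expect q (R ^ b * (martAlg q k - R) ^ 1) + expect q (R ^ (b + 1))) := by
  rw [expect_step_pow q k _ R (h.invariant_pow b hk) (h.invariant k hk) 2
    ((martAlg q k - R) ^ 2 + (growth q ^ 2 * expTime q k) • martAlg q k)]
  · simp only [← smul_eq_mul (a := growth (q : ℝ) ^ 2 * expTime q k), ← map_add, ← map_smul]
    congr 1
    ext μ
    simp
    ring
  · rintro d N Q μ rfl rfl rfl
    simp [martAlg_apply]
    ring

theorem moment_increment_two : ∀ k ∈ S,
    expect q (R ^ 0 * (martAlg q k - R) ^ 2) = growth q * (expTime q k - y) := by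
  refine h.start 0 2 (fun x => growth q * (x - y)) two_ne_zero (by fun_prop) (by simp)
    fun k hk => ?_
  rw [h.step_two 0 hk, h.moment_increment_one 0 k hk, zero_add 1, pow_one, h.moment_one,
    expTime_succ q.2.1]
  ring

theorem moment_increment_two_mul : ∀ k ∈ S,
    expect q (R ^ 1 * (martAlg q k - R) ^ 2) =
      growth q * (expTime q k - y) * (1 + growth q * y) := by
  refine h.start 1 2 (fun x => growth q * (x - y) * (1 + growth q * y)) two_ne_zero
    (by fun_prop) (by simp) fun k hk => ?_
  rw [h.step_two 1 hk, h.moment_increment_one 1 k hk, one_add_one_eq_two, h.moment_two,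
    expTime_succ q.2.1]
  ring

theorem moment_increment_three : ∀ k ∈ S,
    expect q (R ^ 0 * (martAlg q k - R) ^ 3) =
      growth q ^ 2 * (expTime q k - y) * (1 + expTime q k - 2 * y) := by
  refine h.start 0 3 (fun x => growth q ^ 2 * (x - y) * (1 + x - 2 * y)) three_ne_zero
    (by fun_prop) (by simp) fun k hk => ?_
  have e1 := h.moment_increment_one 0 k hk
  have e1' := h.moment_increment_one 1 k hk
  have e2 := h.moment_increment_two k hk
  have f1 := h.moment_one
  have f2 := h.moment_two
  set a := growth (q : ℝ)
  set Q := expTime (q : ℝ) k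
  have key : expect q (R ^ 0 * (martAlg q (k + 1) - R) ^ 3) =
      expect q (R ^ 0 * (martAlg q k - R) ^ 3) +
      (3 * a ^ 2 * Q) * (expect q (R ^ 0 * (martAlg q k - R) ^ 2) +
        expect q (R ^ 1 * (martAlg q k - R) ^ 1)) +
      (a ^ 3 * Q) * (expect q (R ^ 0 * (martAlg q k - R) ^ 2) +
        (2 : ℝ) * expect q (R ^ 1 * (martAlg q k - R) ^ 1) + expect q (R ^ 2) +
        (-Q) * (expect q (R ^ 0 * (martAlg q k - R) ^ 1) + expect q R)) := by
    rw [expect_step_pow q k _ R (h.invariant_pow 0 hk) (h.invariant k hk) 3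
      ((martAlg q k - R) ^ 3 + (3 * a ^ 2 * Q) • ((martAlg q k - R) * martAlg q k) +
        (a ^ 3 * Q) • (martAlg q k * (martAlg q k - algebraMap ℝ _ Q)))]
    · simp only [← smul_eq_mul (a := (3 * a ^ 2 * Q)), ← smul_eq_mul (a := (a ^ 3 * Q)),
        ← smul_eq_mul (a := (2 : ℝ)), ← smul_eq_mul (a := -Q), ← map_add, ← map_smul]
      congr 1
      ext μ
      simp
      ring
    · rintro d N Q μ rfl rfl rfl
      simp [martAlg_apply]
      ring
  rw [key, e1, e1', e2, f1, f2, expTime_succ q.2.1]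
  ring

theorem moment_increment_four : ∀ k ∈ S,
    expect q (R ^ 0 * (martAlg q k - R) ^ 4) =
      growth q ^ 2 * (expTime q k - y) * (3 * (expTime q k - y) + growth q *
        (expTime q k ^ 2 + (5 - 3 * y) * expTime q k + 3 * y ^ 2 - 9 * y + 1) +
        growth q ^ 2 * (expTime q k - 3 * y)) := by
  refine h.start 0 4 (fun x => growth q ^ 2 * (x - y) * (3 * (x - y) + growth q *
    (x ^ 2 + (5 - 3 * y) * x + 3 * y ^ 2 - 9 * y + 1) + growth q ^ 2 * (x - 3 * y)))
    four_ne_zero (by fun_prop) (by simp) fun k hk => ?_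
  have e1 := h.moment_increment_one 0 k hk
  have e1' := h.moment_increment_one 1 k hk
  have e1'' := h.moment_increment_one 2 k hk
  have e2 := h.moment_increment_two k hk
  have e2' := h.moment_increment_two_mul k hk
  have e3 := h.moment_increment_three k hk
  have f1 := h.moment_one
  have f2 := h.moment_two
  have f3 := h.moment_three
  set a := growth (q : ℝ)
  set Q := expTime (q : ℝ) k
  have key : expect q (R ^ 0 * (martAlg q (k + 1) - R) ^ 4) =
      expect q (R ^ 0 * (martAlg q k - R) ^ 4) +
      (6 * a ^ 2 * Q) * (expect q (R ^ 0 * (martAlg q k - R) ^ 3) +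
        expect q (R ^ 1 * (martAlg q k - R) ^ 2)) +
      (4 * a ^ 3 * Q) * (expect q (R ^ 0 * (martAlg q k - R) ^ 3) +
        (2 : ℝ) * expect q (R ^ 1 * (martAlg q k - R) ^ 2) +
        expect q (R ^ 2 * (martAlg q k - R) ^ 1) +
        (-Q) * (expect q (R ^ 0 * (martAlg q k - R) ^ 2) +
          expect q (R ^ 1 * (martAlg q k - R) ^ 1))) +
      (a ^ 4 * Q) * (expect q (R ^ 0 * (martAlg q k - R) ^ 3) +
        (3 : ℝ) * expect q (R ^ 1 * (martAlg q k - R) ^ 2) +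
        (3 : ℝ) * expect q (R ^ 2 * (martAlg q k - R) ^ 1) + expect q (R ^ 3) +
        (-Q) * (expect q (R ^ 0 * (martAlg q k - R) ^ 2) +
          (2 : ℝ) * expect q (R ^ 1 * (martAlg q k - R) ^ 1) + expect q (R ^ 2)) +
        Q ^ 2 * (expect q (R ^ 0 * (martAlg q k - R) ^ 1) + expect q R)) := by
    rw [expect_step_pow q k _ R (h.invariant_pow 0 hk) (h.invariant k hk) 4
      ((martAlg q k - R) ^ 4 + (6 * a ^ 2 * Q) • ((martAlg q k - R) ^ 2 * martAlg q k) +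
        (4 * a ^ 3 * Q) • ((martAlg q k - R) * martAlg q k *
          (martAlg q k - algebraMap ℝ _ Q)) +
        (a ^ 4 * Q) • (martAlg q k *
          (martAlg q k ^ 2 - Q • martAlg q k + algebraMap ℝ _ (Q ^ 2))))]
    · simp only [← smul_eq_mul (a := (6 * a ^ 2 * Q)), ← smul_eq_mul (a := (4 * a ^ 3 * Q)),
        ← smul_eq_mul (a := (a ^ 4 * Q)), ← smul_eq_mul (a := (2 : ℝ)),
        ← smul_eq_mul (a := (3 : ℝ)), ← smul_eq_mul (a := -Q),
        ← smul_eq_mul (a := Q ^ 2), ← map_add, ← map_smul]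
      congr 1
      ext μ
      simp
      ring
    · rintro d N Q μ rfl rfl rfl
      simp [martAlg_apply]
      ring
  rw [key, e1, e1', e1'', e2, e2', e3, f1, f2, f3, expTime_succ q.2.1]
  ring

end StartingPoint

/-- A sequence indexed by `ℤ` whose increments are dominated by those of `g`, where `g` tends to `0`
at `-∞`, stays within `g` of its limit at `-∞`. -/
theorem norm_sub_le_of_step {E : Type*} [NormedAddCommGroup E] {f : ℤ → E} {g : ℤ → ℝ} {K : ℤ}
    {f₀ : E} (h : ∀ k < K, ‖f (k + 1) - f k‖ ≤ g (k + 1) - g k) (hf : Tendsto f atBot (𝓝 f₀))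
    (hg : Tendsto g atBot (𝓝 0)) : ‖f K - f₀‖ ≤ g K := by
  have key : ∀ n : ℕ, ‖f K - f (K - n)‖ ≤ g K - g (K - n) := by
    intro n
    induction n with
    | zero => simp
    | succ n ih =>
      have h1 := h (K - (n + 1 : ℕ)) (by omega)
      rw [show K - ((n + 1 : ℕ) : ℤ) + 1 = K - n by push_cast; ring] at h1
      calc ‖f K - f (K - (n + 1 : ℕ))‖
          = ‖(f K - f (K - n)) + (f (K - n) - f (K - (n + 1 : ℕ)))‖ := by rw [sub_add_sub_cancel]
        _ ≤ _ := norm_add_le _ _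
        _ ≤ _ := by linarith
  have hK : Tendsto (fun n : ℕ => K - (n : ℤ)) atTop atBot :=
    tendsto_atBot.2 fun m => (eventually_ge_atTop (K - m).toNat).mono fun n hn => by omega
  have h1 := ((tendsto_const_nhds (x := f K)).sub (hf.comp hK)).norm
  have h2 := (tendsto_const_nhds (x := g K)).sub (hg.comp hK)
  rw [sub_zero] at h2
  exact le_of_tendsto_of_tendsto' h1 h2 key

theorem tendsto_expMart_atBot {q : ℝ} (hq : q ∈ Ioo (0 : ℝ) 1) (μ : YoungDiagram) :
    Tendsto (fun k => expMart q k μ) atBot (𝓝 1) := by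
  have h : Tendsto (fun k => 1 - expTime q k) atBot (𝓝 (1 - 0)) :=
    tendsto_const_nhds.sub (tendsto_expTime_atBot hq)
  rw [sub_zero] at h
  refine h.congr' ((downSteps_eventually μ).mono fun k hk => ?_)
  change 1 - q ^ (-k) = q ^ (-k) * ((q ^ downSteps μ k)⁻¹ - 1)
  rw [← hk, zpow_natCast]
  have := pow_pos hq.1 (downSteps μ k)
  field_simp

/-- Left of `0` the martingale is bounded by an integrable function, uniformly in the position. -/
theorem expMart_le_of_nonpos {q : ℝ} (hq : q ∈ Ioo (0 : ℝ) 1) {k : ℤ} (hk : k ≤ 0)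
    (μ : YoungDiagram) : expMart q k μ ≤ (q ^ downSteps μ 0)⁻¹ := by
  have h := downSteps_le_of_nonpos μ hk
  have h0 := hq.1
  have h1 := pow_pos h0 (downSteps μ k)
  have h2 := expTime_pos h0 k
  calc expMart q k μ ≤ expTime q k * (q ^ downSteps μ k)⁻¹ := by
        rw [expMart]; gcongr; linarith
    _ = q ^ (-k - downSteps μ k : ℤ) := by rw [zpow_sub₀ h0.ne', zpow_natCast]; rfl
    _ ≤ q ^ (-(downSteps μ 0 : ℤ)) :=
        zpow_le_zpow_right_of_le_one₀ h0 hq.2.le (by omega)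
    _ = _ := by rw [zpow_neg, zpow_natCast]

theorem tendsto_moment_atBot (q : Ioo (0 : ℝ) 1) {p : ℕ} (hp : p ≠ 0) :
    Tendsto (fun k => expect q ((martAlg q k - 1) ^ p)) atBot (𝓝 0) := by
  have hB : Moderate (q : ℝ) fun μ => (((q : ℝ) ^ downSteps μ 0)⁻¹ + 1) ^ p := by
    refine Moderate.pow q.2 (Moderate.add q.2 ⟨1, 1, fun μ => ?_⟩ (.const 1)) p
    rw [Real.norm_of_nonneg (inv_nonneg.2 (pow_nonneg q.2.1.le _)), one_mul, pow_one]
  have h0 : (0 : ℝ) = ∫ _, 0 ∂(partitionLaw q) := by simp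
  simp_rw [expect_apply]
  rw [h0]
  refine tendsto_integral_filter_of_dominated_convergence
    (fun μ => (((q : ℝ) ^ downSteps μ 0)⁻¹ + 1) ^ p) (.of_forall fun k => .of_discrete) ?_
    hB.integrable (.of_forall fun μ => ?_)
  · refine (eventually_le_atBot 0).mono fun k hk => .of_forall fun μ => ?_
    have h1 := expMart_le_of_nonpos q.2 hk μ
    have h2 := expMart_nonneg q.2 k μ
    simp only [SubmonoidClass.coe_pow, AddSubgroupClass.coe_sub, OneMemClass.coe_one,
      Pi.pow_apply, Pi.sub_apply, Pi.one_apply, martAlg_apply, norm_pow]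
    gcongr
    rw [Real.norm_eq_abs, abs_le]
    constructor <;> linarith
  · have := ((tendsto_expMart_atBot q.2 μ).sub_const 1).pow p
    simpa [hp, martAlg_apply] using this

/-- The position `-∞`, where the martingale has the value `1`, as a starting point. -/
theorem startingPoint_one (q : Ioo (0 : ℝ) 1) : StartingPoint q univ 1 0 where
  invariant _ _ _ := rfl
  moment_one := expect_one q
  moment_two := by simp [expect_one]
  moment_three := by simp [expect_one]
  start b p c hp hc h0 hstep k _ := by
    have h1 : Tendsto (fun k => expect q ((martAlg q k - 1) ^ p) - c (expTime q k)) atBot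
        (𝓝 (0 - c 0)) :=
      (tendsto_moment_atBot q hp).sub ((hc.tendsto 0).comp (tendsto_expTime_atBot q.2))
    rw [h0, sub_zero] at h1
    have h2 := norm_sub_le_of_step (g := 0) (K := k) (fun l _ => by
      have := hstep l trivial
      simp only [one_pow, one_mul] at this
      simp only [this, sub_self, norm_zero, Pi.zero_apply, le_refl]) h1 tendsto_const_nhds
    rw [sub_zero, Pi.zero_apply, norm_le_zero_iff, sub_eq_zero] at h2
    simpa using h2

section Moments

variable (q : Ioo (0 : ℝ) 1) (k : ℤ)

theorem expect_martAlg : expect q (martAlg q k) = 1 := by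
  have h := (startingPoint_one q).moment_increment_one 0 k trivial
  rw [pow_zero, one_mul, pow_one, map_sub, expect_one, sub_eq_zero] at h
  exact h

theorem expect_martAlg_sub_one_sq :
    expect q ((martAlg q k - 1) ^ 2) = growth q * expTime q k := by
  have h := (startingPoint_one q).moment_increment_two k trivial
  rwa [pow_zero, one_mul, sub_zero] at h

theorem expect_martAlg_sub_one_pow_four :
    expect q ((martAlg q k - 1) ^ 4) = growth q ^ 2 * expTime q k * (3 * expTime q k +
      growth q * (expTime q k ^ 2 + 5 * expTime q k + 1) + growth q ^ 2 * expTime q k) := by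
  have h := (startingPoint_one q).moment_increment_four k trivial
  rw [pow_zero, one_mul] at h
  rw [h]
  ring

theorem expect_martAlg_sq : expect q (martAlg q k ^ 2) = 1 + growth q * expTime q k := by
  have h : martAlg q k ^ 2 = (martAlg q k - 1) ^ 2 + (2 : ℝ) • martAlg q k - 1 := by
    ext μ
    simp
    ring
  rw [h, map_sub, map_add, map_smul, expect_martAlg_sub_one_sq, expect_martAlg, expect_one]
  simp
  ring

theorem expect_martAlg_pow_three : expect q (martAlg q k ^ 3) =
    1 + (3 * growth q + growth q ^ 2) * expTime q k + growth q ^ 2 * expTime q k ^ 2 := by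
  have h3 := (startingPoint_one q).moment_increment_three k trivial
  rw [pow_zero, one_mul] at h3
  have h : martAlg q k ^ 3 = (martAlg q k - 1) ^ 3 + (3 : ℝ) • (martAlg q k - 1) ^ 2 +
      (3 : ℝ) • martAlg q k - (2 : ℝ) • 1 := by
    ext μ
    simp
    ring
  rw [h, map_sub, map_add, map_add, map_smul, map_smul, map_smul, h3,
    expect_martAlg_sub_one_sq, expect_martAlg, expect_one]
  simp
  ring

/-- The position `j` as a starting point. -/
theorem startingPoint_martAlg (j : ℤ) :
    StartingPoint q (Ici j) (martAlg q j) (expTime q j) where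
  invariant k hk μ := expMart_insertStrip hk μ
  moment_one := expect_martAlg q j
  moment_two := expect_martAlg_sq q j
  moment_three := expect_martAlg_pow_three q j
  start b p c hp hc h0 hstep k hk := by
    induction k, hk using Int.leInduction with
    | base => rw [sub_self, zero_pow hp, mul_zero, map_zero, h0]
    | succ k hk ih =>
      have := hstep k hk
      rwa [ih, sub_self, sub_eq_zero] at this

/-- The fourth moment of an increment of the martingale. -/
theorem expect_martAlg_sub_pow_four {j k : ℤ} (hjk : j ≤ k) :
    expect q ((martAlg q k - martAlg q j) ^ 4) =
      growth q ^ 2 * (expTime q k - expTime q j) * (3 * (expTime q k - expTime q j) + growth q *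
        (expTime q k ^ 2 + (5 - 3 * expTime q j) * expTime q k + 3 * expTime q j ^ 2 -
          9 * expTime q j + 1) + growth q ^ 2 * (expTime q k - 3 * expTime q j)) := by
  have h := (startingPoint_martAlg q j).moment_increment_four k hjk
  rwa [pow_zero, one_mul] at h

end Moments

/-! ### Central limit theorem for the martingale -/

/-- The second-order Taylor bound for the characteristic function, with a constant that is valid for
all real `x`. -/
theorem norm_cexp_mul_I_sub_taylor_le (x : ℝ) :
    ‖Complex.exp (x * Complex.I) - (1 + x * Complex.I - (x ^ 2 / 2 : ℝ))‖ ≤ 4 * |x| ^ 3 := by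
  have hI : ‖(x * Complex.I : ℂ)‖ = |x| := by simp
  rcases le_total |x| 1 with h | h
  · have h1 := Complex.exp_bound (x := x * Complex.I) (by rwa [hI]) (n := 3) (by norm_num)
    rw [hI] at h1
    have h2 : ∑ m ∈ Finset.range 3, (x * Complex.I : ℂ) ^ m / m.factorial =
        1 + x * Complex.I - (x ^ 2 / 2 : ℝ) := by
      simp [Finset.sum_range_succ, mul_pow]
      ring
    rw [h2] at h1
    refine h1.trans ?_
    rw [mul_comm]
    gcongr
    norm_num [Nat.factorial]
  · calc _ ≤ ‖Complex.exp (x * Complex.I)‖ + (‖(1 : ℂ)‖ + ‖(x * Complex.I : ℂ)‖ +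
          ‖((x ^ 2 / 2 : ℝ) : ℂ)‖) :=
          (norm_sub_le _ _).trans (by
            gcongr
            exact (norm_sub_le _ _).trans (by gcongr; exact norm_add_le _ _))
      _ = 1 + (1 + |x| + |x| ^ 2 / 2) := by
          rw [Complex.norm_exp_ofReal_mul_I, hI, norm_one, Complex.norm_real,
            Real.norm_of_nonneg (by positivity : 0 ≤ x ^ 2 / 2), sq_abs]
      _ ≤ _ := by nlinarith [mul_nonneg (sub_nonneg.2 h) (sub_nonneg.2 h),
          mul_nonneg (mul_nonneg (sub_nonneg.2 h) (sub_nonneg.2 h)) (sub_nonneg.2 h)]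

theorem abs_exp_neg_sub_le {x : ℝ} (hx : 0 ≤ x) : |Real.exp (-x) - (1 - x)| ≤ x ^ 2 := by
  rcases le_total x 1 with h | h
  · have := Real.abs_exp_sub_one_sub_id_le (x := -x) (by rwa [abs_neg, abs_of_nonneg hx])
    rw [neg_sq] at this
    convert this using 2
    ring
  · have h1 := Real.add_one_le_exp (-x)
    have h2 : Real.exp (-x) ≤ 1 := Real.exp_le_one_iff.2 (by linarith)
    rw [abs_of_nonneg (by linarith)]
    nlinarith

/-- The normalised fluctuation of the martingale; its variance is `expTime q k`. -/
noncomputable def normMart (q : ℝ) (k : ℤ) (μ : YoungDiagram) : ℝ :=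
  (expMart q k μ - 1) / √(growth q)

theorem integral_abs_expMart_sub_one_le (q : Ioo (0 : ℝ) 1) (k : ℤ) :
    ∫ μ, |expMart q k μ - 1| ∂(partitionLaw q) ≤ √(growth q * expTime q k) := by
  set v := growth (q : ℝ) * expTime q k with hv
  have hv0 : 0 < v := mul_pos (growth_pos q.2) (expTime_pos q.2.1 k)
  have hs := Real.sqrt_pos.2 hv0
  have hsq := Real.sq_sqrt hv0.le
  have hI : Integrable (fun μ => (expMart q k μ - 1) ^ 2) (partitionLaw q) :=
    Moderate.integrable q ((martAlg q k - 1) ^ 2).2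
  have h2 : ∫ μ, (expMart q k μ - 1) ^ 2 ∂(partitionLaw q) = v :=
    expect_martAlg_sub_one_sq q k
  calc ∫ μ, |expMart q k μ - 1| ∂(partitionLaw q)
      ≤ ∫ μ, (√v / 2 + (2 * √v)⁻¹ * (expMart q k μ - 1) ^ 2) ∂(partitionLaw q) := by
        refine integral_mono_of_nonneg (.of_forall fun μ => abs_nonneg _)
          ((integrable_const _).add (hI.const_mul _)) (.of_forall fun μ => ?_)
        simp only
        rw [← sq_abs (expMart q k μ - 1), ← sub_nonneg]
        have : √v / 2 + (2 * √v)⁻¹ * |expMart q k μ - 1| ^ 2 - |expMart q k μ - 1| =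
            (2 * √v)⁻¹ * (|expMart q k μ - 1| - √v) ^ 2 := by
          field_simp
          ring
        rw [this]
        positivity
    _ = √v / 2 + (2 * √v)⁻¹ * v := by
        rw [integral_add (integrable_const _) (hI.const_mul _), integral_const_mul, h2]
        simp
    _ = √v := by
        nth_rewrite 3 [← hsq]
        field_simp
        ring

/-- One step of the characteristic function: given the past, the increment of the normalised
martingale acts like a centred Gaussian of variance `growth q * expTime q k`. -/
theorem norm_charFun_step_le (q : Ioo (0 : ℝ) 1) (k : ℤ) (c : ℝ) (S : YoungDiagram → ℝ)
    (hS : ∀ μ, S (insertStrip k μ) = S μ) :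
    ‖∫ μ, Complex.exp ((S μ + c * (normMart q (k + 1) μ - normMart q k μ) : ℝ) * Complex.I)
        ∂(partitionLaw q) - (Real.exp (-(c ^ 2 * growth q * expTime q k / 2)) : ℝ) *
        ∫ μ, Complex.exp (S μ * Complex.I) ∂(partitionLaw q)‖ ≤
      4 * |c| ^ 3 * √(growth q) ^ 3 * expTime q k *
        (1 + growth q * expTime q k + expTime q k ^ 2) +
      c ^ 2 * growth q * expTime q k / 2 * √(growth q * expTime q k) +
      (c ^ 2 * growth q * expTime q k / 2) ^ 2 := by
  have ha := growth_pos q.2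
  have hQ := expTime_pos q.2.1 k
  have hm1 := integral_abs_expMart_sub_one_le q k
  set a := growth (q : ℝ) with ha'
  set Q := expTime (q : ℝ) k with hQ'
  set s := √a with hs'
  have hs : 0 < s := Real.sqrt_pos.2 ha
  have hss : s ^ 2 = a := Real.sq_sqrt ha.le
  set x := c ^ 2 * a * Q / 2 with hx
  have hx0 : 0 ≤ x := by positivity
  let g : ℝ → YoungDiagram → ℂ := fun z μ => Complex.exp ((S μ + c * (z / s) : ℝ) * Complex.I)
  have hg1 : ∀ z μ, ‖g z μ‖ = 1 := fun z μ => Complex.norm_exp_ofReal_mul_I _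
  have hstep := integral_step q k g (fun z μ => by simp only [g, hS])
    (.of_bound 1 fun μ => (hg1 _ μ).le) (.of_bound 1 fun μ => (hg1 _ μ).le)
  have hL : ∫ μ, Complex.exp ((S μ + c * (normMart q (k + 1) μ - normMart q k μ) : ℝ) *
      Complex.I) ∂(partitionLaw q) =
      ∫ μ, g (expMart q (k + 1) μ - expMart q k μ) μ ∂(partitionLaw q) := by
    refine integral_congr_ae (.of_forall fun μ => ?_)
    simp only [g, normMart]
    rw [← sub_div, sub_sub_sub_cancel_right]
  have hIS : Integrable (fun μ => Complex.exp (S μ * Complex.I)) (partitionLaw q) :=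
    Moderate.integrable q (.of_bound 1 fun μ => (Complex.norm_exp_ofReal_mul_I _).le)
  rw [hL, hstep, ← integral_const_mul, ← integral_sub]
  rotate_left
  · refine Moderate.integrable q (.of_bound 2 fun μ => ?_)
    have hN := expMart_nonneg q.2 k μ
    refine (norm_add_le _ _).trans ?_
    rw [norm_smul, norm_smul, hg1, hg1, Real.norm_of_nonneg (by positivity),
      Real.norm_of_nonneg (by positivity), mul_one, mul_one, ← add_div]
    exact (div_le_one_of_le₀ (by linarith) (by positivity)).trans one_le_two
  · exact hIS.const_mul _
  have hIN2 : Integrable (fun μ => expMart q k μ ^ 2) (partitionLaw q) :=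
    Moderate.integrable q ((moderate_expMart q.2 k).pow q.2 2)
  have hIabs : Integrable (fun μ => |expMart q k μ - 1|) (partitionLaw q) :=
    (Moderate.integrable q (martAlg q k - 1).2).norm
  have hN2 : ∫ μ, expMart q k μ ^ 2 ∂(partitionLaw q) = 1 + a * Q := expect_martAlg_sq q k
  have hA : Integrable (fun μ => 4 * |c| ^ 3 * s ^ 3 * Q * (expMart q k μ ^ 2 + Q ^ 2))
      (partitionLaw q) := (hIN2.add (integrable_const _)).const_mul _
  have hB : Integrable (fun μ => x * |expMart q k μ - 1|) (partitionLaw q) := hIabs.const_mul _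
  have hAB : Integrable (fun μ => 4 * |c| ^ 3 * s ^ 3 * Q * (expMart q k μ ^ 2 + Q ^ 2) +
      x * |expMart q k μ - 1|) (partitionLaw q) := hA.add hB
  calc _ ≤ ∫ μ, (4 * |c| ^ 3 * s ^ 3 * Q * (expMart q k μ ^ 2 + Q ^ 2) +
          x * |expMart q k μ - 1| + x ^ 2) ∂(partitionLaw q) := by
        refine norm_integral_le_of_norm_le (hAB.add (integrable_const _))
          (.of_forall fun μ => ?_)
        have hN := expMart_nonneg q.2 k μ
        set N := expMart q k μ with hN'
        have hNQ : 0 < N + Q := by positivity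
        set p := Q / (N + Q) with hp
        have hp0 : 0 ≤ p := by positivity
        have hp' : N / (N + Q) = 1 - p := by rw [hp]; field_simp; ring
        have hp1 : 0 ≤ 1 - p := by rw [← hp']; positivity
        rw [hp']
        have e1 : c * (a * N / s) = c * s * N := by rw [← hss]; field_simp
        have e2 : c * (-(a * Q) / s) = -(c * s * Q) := by rw [← hss]; field_simp
        have r1 := norm_cexp_mul_I_sub_taylor_le (c * s * N)
        have r2 := norm_cexp_mul_I_sub_taylor_le (-(c * s * Q))
        have r3 := abs_exp_neg_sub_le hx0
        set T1 := Complex.exp ((c * s * N : ℝ) * Complex.I) with hT1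
        set T2 := Complex.exp ((-(c * s * Q) : ℝ) * Complex.I) with hT2
        have eg1 : g (a * N) μ = Complex.exp (S μ * Complex.I) * T1 := by
          simp only [g, hT1]
          rw [e1, ← Complex.exp_add, Complex.ofReal_add, add_mul]
        have eg2 : g (-(a * Q)) μ = Complex.exp (S μ * Complex.I) * T2 := by
          simp only [g, hT2]
          rw [e2, ← Complex.exp_add, Complex.ofReal_add, add_mul]
        have hpN : p * N = (1 - p) * Q := by rw [hp]; field_simp; ring
        have hpNC : (p : ℂ) * N = (1 - p) * Q := by exact_mod_cast hpN
        have hpN2C : (p : ℂ) * N ^ 2 + (1 - p) * Q ^ 2 = Q * N := by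
          have : p * N ^ 2 + (1 - p) * Q ^ 2 = Q * N := by rw [hp]; field_simp; ring
          exact_mod_cast this
        have hsC : (s : ℂ) ^ 2 = a := by exact_mod_cast hss
        have hxC : (x : ℂ) = c ^ 2 * a * Q / 2 := by rw [hx]; push_cast; ring
        -- the Taylor polynomials of order two average to `1 - x - x * (N - 1)`
        have decomp : p • g (a * N) μ + (1 - p) • g (-(a * Q)) μ -
            (Real.exp (-x) : ℝ) * Complex.exp (S μ * Complex.I) = Complex.exp (S μ * Complex.I) *
            (p * (T1 - (1 + (c * s * N : ℝ) * Complex.I - ((c * s * N) ^ 2 / 2 : ℝ))) +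
            (1 - p : ℝ) * (T2 - (1 + (-(c * s * Q) : ℝ) * Complex.I -
              ((-(c * s * Q)) ^ 2 / 2 : ℝ))) +
            ((-(x * (N - 1)) : ℝ) : ℂ) - ((Real.exp (-x) - (1 - x) : ℝ) : ℂ)) := by
          rw [eg1, eg2, Complex.real_smul, Complex.real_smul]
          push_cast
          rw [hxC, ← hsC]
          linear_combination (Complex.exp (S μ * Complex.I) * c * s * Complex.I) * hpNC -
            (Complex.exp (S μ * Complex.I) * c ^ 2 * s ^ 2 / 2) * hpN2C
        rw [decomp, norm_mul, Complex.norm_exp_ofReal_mul_I, one_mul]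
        have n1 : ‖((-(x * (N - 1)) : ℝ) : ℂ)‖ = x * |N - 1| := by
          rw [Complex.norm_real, Real.norm_eq_abs, abs_neg, abs_mul, abs_of_nonneg hx0]
        have n2 : ‖((Real.exp (-x) - (1 - x) : ℝ) : ℂ)‖ ≤ x ^ 2 := by
          rwa [Complex.norm_real]
        have hcub : p * |c * s * N| ^ 3 + (1 - p) * |-(c * s * Q)| ^ 3 ≤
            |c| ^ 3 * s ^ 3 * Q * (N ^ 2 + Q ^ 2) := by
          rw [abs_neg, abs_mul, abs_mul, abs_mul, abs_mul, abs_of_pos hs, abs_of_nonneg hN,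
            abs_of_pos hQ]
          have : p * (|c| * s * N) ^ 3 + (1 - p) * (|c| * s * Q) ^ 3 =
              |c| ^ 3 * s ^ 3 * ((1 - p) * Q * (N ^ 2 + Q ^ 2)) := by
            linear_combination (|c| ^ 3 * s ^ 3 * N ^ 2) * hpN
          rw [this, mul_assoc (|c| ^ 3 * s ^ 3)]
          gcongr
          nlinarith
        calc _ ≤ p * (4 * |c * s * N| ^ 3) + (1 - p) * (4 * |-(c * s * Q)| ^ 3) +
              x * |N - 1| + x ^ 2 := by
              refine (norm_sub_le _ _).trans (add_le_add ((norm_add_le _ _).trans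
                (add_le_add ((norm_add_le _ _).trans (add_le_add ?_ ?_)) n1.le)) n2)
              · rw [norm_mul, Complex.norm_real, Real.norm_of_nonneg hp0]
                gcongr
              · rw [norm_mul, Complex.norm_real, Real.norm_of_nonneg hp1]
                gcongr
          _ ≤ _ := by linarith
    _ ≤ _ := by
        rw [integral_add hAB (integrable_const _), integral_add hA hB, integral_const_mul,
          integral_const_mul, integral_add hIN2 (integrable_const _), hN2]
        simp only [integral_const, probReal_univ, one_smul]
        gcongr

section CLT

variable {ι : Type*} [Fintype ι]

/-- A linear combination of values of the normalised martingale stopped at time `k`. -/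
noncomputable def stoppedSum (q : ℝ) (β : ι → ℝ) (κ : ι → ℤ) (k : ℤ) (μ : YoungDiagram) : ℝ :=
  ∑ i, β i * normMart q (min k (κ i)) μ

/-- The variance of `stoppedSum`. -/
noncomputable def stoppedVar (q : ℝ) (β : ι → ℝ) (κ : ι → ℤ) (k : ℤ) : ℝ :=
  ∑ i, ∑ j, β i * β j * expTime q (min k (min (κ i) (κ j)))

theorem stoppedSum_succ (q : ℝ) (β : ι → ℝ) (κ : ι → ℤ) (k : ℤ) (μ : YoungDiagram) :
    stoppedSum q β κ (k + 1) μ = stoppedSum q β κ k μ +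
      (∑ i, if k < κ i then β i else 0) * (normMart q (k + 1) μ - normMart q k μ) := by
  rw [stoppedSum, stoppedSum, Finset.sum_mul, ← Finset.sum_add_distrib]
  refine Finset.sum_congr rfl fun i _ => ?_
  split_ifs with h
  · rw [min_eq_left (by omega : k + 1 ≤ κ i), min_eq_left h.le]
    ring
  · rw [min_eq_right (by omega : κ i ≤ k + 1), min_eq_right (not_lt.1 h)]
    ring

theorem stoppedVar_succ {q : ℝ} (h0 : 0 < q) (β : ι → ℝ) (κ : ι → ℤ) (k : ℤ) :
    stoppedVar q β κ (k + 1) = stoppedVar q β κ k +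
      (∑ i, if k < κ i then β i else 0) ^ 2 * growth q * expTime q k := by
  have : (∑ i, if k < κ i then β i else 0) ^ 2 * growth q * expTime q k =
      ∑ i, ∑ j, (if k < κ i then β i else 0) * (if k < κ j then β j else 0) *
        (growth q * expTime q k) := by
    rw [sq, Finset.sum_mul_sum, mul_assoc, Finset.sum_mul]
    exact Finset.sum_congr rfl fun i _ => Finset.sum_mul _ _ _
  rw [this, stoppedVar, stoppedVar, ← Finset.sum_add_distrib]
  refine Finset.sum_congr rfl fun i _ => ?_
  rw [← Finset.sum_add_distrib]
  refine Finset.sum_congr rfl fun j _ => ?_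
  by_cases hi : k < κ i
  · by_cases hj : k < κ j
    · rw [if_pos hi, if_pos hj, min_eq_left (by omega), min_eq_left (by omega), expTime_succ h0]
      ring
    · have h : min (k + 1) (min (κ i) (κ j)) = min k (min (κ i) (κ j)) := by omega
      rw [if_neg hj, h]
      ring
  · have h : min (k + 1) (min (κ i) (κ j)) = min k (min (κ i) (κ j)) := by omega
    rw [if_neg hi, h]
    ring

/-- The characteristic function of a linear combination of values of the normalised martingale is
Gaussian up to an error of order `√(growth q)`. The bound is obtained by telescoping from `-∞`,
where the martingale is deterministic. -/
theorem norm_charFun_stoppedSum_sub_one_le (q : Ioo (0 : ℝ) 1) (ha1 : growth (q : ℝ) ≤ 1)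
    (β : ι → ℝ) (κ : ι → ℤ) {K : ℤ} {B : ℝ} (hB : 1 ≤ B) (hK : expTime (q : ℝ) K ≤ B) :
    ‖(Real.exp (stoppedVar q β κ K / 2) : ℝ) *
        ∫ μ, Complex.exp (stoppedSum q β κ K μ * Complex.I) ∂(partitionLaw q) - 1‖ ≤
      Real.exp ((∑ i, |β i|) ^ 2 * B / 2) * (4 * (∑ i, |β i|) ^ 3 * (1 + B + B ^ 2) +
        (∑ i, |β i|) ^ 2 * B + (∑ i, |β i|) ^ 4 * B) * √(growth q) * expTime q K := by
  have ha := growth_pos q.2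
  set a := growth (q : ℝ) with ha'
  set s := √a with hs'
  have hs : 0 < s := Real.sqrt_pos.2 ha
  have hs1 : s ≤ 1 := Real.sqrt_le_one.2 ha1
  have hss : s ^ 2 = a := Real.sq_sqrt ha.le
  set b := ∑ i, |β i| with hb
  have hb0 : 0 ≤ b := Finset.sum_nonneg fun i _ => abs_nonneg _
  set C₀ := 4 * b ^ 3 * (1 + B + B ^ 2) + b ^ 2 * B + b ^ 4 * B with hC₀
  have hQlim := tendsto_expTime_atBot q.2
  have hmin : ∀ m : ℤ, Tendsto (fun k : ℤ => min k m) atBot atBot := fun m =>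
    tendsto_atBot_mono (fun k => min_le_left k m) tendsto_id
  refine norm_sub_le_of_step (f := fun k => (Real.exp (stoppedVar q β κ k / 2) : ℝ) *
    ∫ μ, Complex.exp (stoppedSum q β κ k μ * Complex.I) ∂(partitionLaw q))
    (g := fun k => Real.exp (b ^ 2 * B / 2) * C₀ * s * expTime q k) ?_ ?_ ?_
  · intro k hk
    have hQ := expTime_pos q.2.1 k
    have hQB : expTime (q : ℝ) k ≤ B := (expTime_mono q.2 hk.le).trans hK
    set Q := expTime (q : ℝ) k with hQ'
    set c := ∑ i, if k < κ i then β i else 0 with hc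
    have hcb : |c| ≤ b := by
      refine (Finset.abs_sum_le_sum_abs _ _).trans (Finset.sum_le_sum fun i _ => ?_)
      split_ifs
      · exact le_rfl
      · rw [abs_zero]; exact abs_nonneg _
    have hc2 : c ^ 2 ≤ b ^ 2 := sq_le_sq.2 (by rwa [abs_of_nonneg hb0])
    have hV : stoppedVar q β κ (k + 1) ≤ b ^ 2 * B := by
      rw [stoppedVar, hb, sq, Finset.sum_mul_sum, Finset.sum_mul]
      refine Finset.sum_le_sum fun i _ => ?_
      rw [Finset.sum_mul]
      refine Finset.sum_le_sum fun j _ => ?_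
      rw [← abs_mul]
      have h1 : expTime (q : ℝ) (min (k + 1) (min (κ i) (κ j))) ≤ B :=
        (expTime_mono q.2 ((min_le_left _ _).trans (by omega))).trans hK
      have h2 := expTime_pos q.2.1 (min (k + 1) (min (κ i) (κ j)))
      calc _ ≤ |β i * β j| * expTime (q : ℝ) (min (k + 1) (min (κ i) (κ j))) := by
            gcongr; exact le_abs_self _
        _ ≤ _ := by gcongr
    have hstep := norm_charFun_step_le q k c (stoppedSum q β κ k) (fun μ => by
      refine Finset.sum_congr rfl fun i _ => ?_
      rw [normMart, expMart_insertStrip (min_le_left _ _), normMart])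
    simp_rw [hc, ← stoppedSum_succ] at hstep
    rw [← hc] at hstep
    have hexp : Real.exp (stoppedVar q β κ k / 2) = Real.exp (stoppedVar q β κ (k + 1) / 2) *
        Real.exp (-(c ^ 2 * a * Q / 2)) := by
      rw [← Real.exp_add, stoppedVar_succ q.2.1]
      congr 1
      ring
    have herr : 4 * |c| ^ 3 * s ^ 3 * Q * (1 + a * Q + Q ^ 2) + c ^ 2 * a * Q / 2 * √(a * Q) +
        (c ^ 2 * a * Q / 2) ^ 2 ≤ C₀ * s ^ 3 * Q := by
      have t1 : 4 * |c| ^ 3 * s ^ 3 * Q * (1 + a * Q + Q ^ 2) ≤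
          4 * b ^ 3 * s ^ 3 * Q * (1 + 1 * B + B ^ 2) := by gcongr
      have t2 : c ^ 2 * a * Q / 2 * √(a * Q) ≤ b ^ 2 * s ^ 3 * Q * B := by
        rw [Real.sqrt_mul ha.le]
        have hsB : √Q ≤ B := by
          rw [Real.sqrt_le_left (by linarith)]
          nlinarith
        calc c ^ 2 * a * Q / 2 * (√a * √Q) ≤ b ^ 2 * a * Q / 2 * (s * B) := by gcongr
          _ = b ^ 2 * s ^ 3 * Q * B / 2 := by rw [← hss]; ring
          _ ≤ _ := half_le_self (by positivity)
      have t3 : (c ^ 2 * a * Q / 2) ^ 2 ≤ b ^ 4 * B * (s ^ 3 * Q) := by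
        calc (c ^ 2 * a * Q / 2) ^ 2 ≤ (b ^ 2 * a * Q / 2) ^ 2 := by gcongr
          _ = b ^ 4 * Q * (s ^ 3 * Q) * s / 4 := by rw [← hss]; ring
          _ ≤ b ^ 4 * B * (s ^ 3 * Q) * 1 / 1 := by gcongr; norm_num
          _ = _ := by ring
      calc _ ≤ _ := add_le_add (add_le_add t1 t2) t3
        _ = _ := by rw [hC₀]; ring
    rw [hexp, expTime_succ q.2.1, Complex.ofReal_mul, mul_assoc, ← mul_sub, norm_mul,
      Complex.norm_real, Real.norm_of_nonneg (Real.exp_pos _).le]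
    calc _ ≤ Real.exp (b ^ 2 * B / 2) * (C₀ * s ^ 3 * Q) := by
          gcongr
          exact hstep.trans herr
      _ = _ := by rw [← ha', ← hss]; ring
  · have h1 : Tendsto (fun k => Real.exp (stoppedVar q β κ k / 2)) atBot (𝓝 1) := by
      have : Tendsto (fun k => stoppedVar q β κ k) atBot (𝓝 (∑ i, ∑ j, β i * β j * 0)) :=
        tendsto_finsetSum _ fun i _ => tendsto_finsetSum _ fun j _ =>
          (hQlim.comp (hmin _)).const_mul _
      have h2 := (Real.continuous_exp.tendsto _).comp (this.div_const 2)
      simpa [Function.comp_def] using h2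
    have h2 : Tendsto (fun k => ∫ μ, Complex.exp (stoppedSum q β κ k μ * Complex.I)
        ∂(partitionLaw q)) atBot (𝓝 1) := by
      have h0 : (1 : ℂ) = ∫ _, 1 ∂(partitionLaw q) := by simp
      rw [h0]
      refine tendsto_integral_filter_of_dominated_convergence (fun _ => 1)
        (.of_forall fun k => .of_discrete)
        (.of_forall fun k => .of_forall fun μ => (Complex.norm_exp_ofReal_mul_I _).le)
        (integrable_const _) (.of_forall fun μ => ?_)
      have h3 : Tendsto (fun k => stoppedSum q β κ k μ) atBot (𝓝 (∑ i, β i * ((1 - 1) / s))) :=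
        tendsto_finsetSum _ fun i _ => ((((tendsto_expMart_atBot q.2 μ).comp
          (hmin (κ i))).sub_const 1).div_const s).const_mul _
      simp only [sub_self, zero_div, mul_zero, Finset.sum_const_zero] at h3
      have h4 : Continuous fun x : ℝ => Complex.exp (x * Complex.I) := by fun_prop
      simpa [Function.comp_def] using (h4.tendsto 0).comp h3
    have h3 := (Complex.continuous_ofReal.tendsto _).comp h1
    simpa [Function.comp_def] using h3.mul h2
  · simpa using hQlim.const_mul (Real.exp (b ^ 2 * B / 2) * C₀ * s)

end CLT

/-! ### Tightness on the space of continuous functions -/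

section Dyadic

variable {f : ℝ → ℝ} {r : ℝ} {n m : ℕ}

/-- The dyadic increments of `f` of level `l` in the window `[-n, n]` are at most `r ^ l`, for all
levels `l ≥ m`. -/
def DyadicBound (f : ℝ → ℝ) (r : ℝ) (n m : ℕ) : Prop :=
  ∀ l ≥ m, ∀ i : ℤ, -(n * 2 ^ l) ≤ i → i < n * 2 ^ l →
    |f ((i + 1) / 2 ^ l) - f (i / 2 ^ l)| ≤ r ^ l

/-- Chaining: the dyadic approximations of `x` from level `l` on give a geometric series. -/
theorem DyadicBound.abs_sub_floor_le (h : DyadicBound f r n m) (hf : Continuous f) (hr0 : 0 < r)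
    (hr1 : r < 1) {l : ℕ} (hl : m ≤ l) {x : ℝ} (hx : x ∈ Ico (-n : ℝ) n) :
    |f (⌊x * 2 ^ l⌋ / 2 ^ l) - f x| ≤ r ^ l / (1 - r) := by
  let u : ℕ → ℝ := fun j => ⌊x * 2 ^ j⌋ / 2 ^ j
  have hu : Tendsto u atTop (𝓝 x) := by
    have h1 : Tendsto (fun j : ℕ => x - (1 / 2 : ℝ) ^ j) atTop (𝓝 (x - 0)) :=
      tendsto_const_nhds.sub (tendsto_pow_atTop_nhds_zero_of_lt_one (by norm_num) (by norm_num))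
    rw [sub_zero] at h1
    refine tendsto_of_tendsto_of_tendsto_of_le_of_le h1 tendsto_const_nhds (fun j => ?_)
      fun j => ?_
    · have h2 : (0 : ℝ) < 2 ^ j := by positivity
      have := Int.lt_floor_add_one (x * 2 ^ j)
      simp only [u]
      rw [le_div_iff₀ h2, sub_mul, ← mul_pow]
      norm_num
      linarith
    · have h2 : (0 : ℝ) < 2 ^ j := by positivity
      simp only [u]
      rw [div_le_iff₀ h2]
      exact Int.floor_le _
  have hstep : ∀ j, dist (f (u (l + j))) (f (u (l + (j + 1)))) ≤ r ^ l * r ^ j := by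
    intro j
    set y := x * 2 ^ (l + j) with hy
    have h2 : (0 : ℝ) < 2 ^ (l + j) := by positivity
    have hy2 : x * 2 ^ (l + (j + 1)) = 2 * y := by rw [hy]; ring
    have hpos : (0 : ℝ) ≤ r ^ l * r ^ j := by positivity
    have hw : -((n : ℤ) * 2 ^ (l + (j + 1))) ≤ 2 * ⌊y⌋ ∧ 2 * ⌊y⌋ < n * 2 ^ (l + (j + 1)) := by
      have e1 : -((n : ℤ) * 2 ^ (l + j)) ≤ ⌊y⌋ := by
        rw [Int.le_floor]
        push_cast
        rw [hy, ← neg_mul]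
        exact mul_le_mul_of_nonneg_right hx.1 h2.le
      have e2 : ⌊y⌋ < n * 2 ^ (l + j) := by
        rw [Int.floor_lt]
        push_cast
        exact mul_lt_mul_of_pos_right hx.2 h2
      have e3 : ((n : ℤ) * 2 ^ (l + (j + 1))) = 2 * (n * 2 ^ (l + j)) := by ring
      rw [e3]
      omega
    have hu0 : u (l + j) = ((2 * ⌊y⌋ : ℤ) : ℝ) / 2 ^ (l + (j + 1)) := by
      simp only [u]
      rw [← hy, ← add_assoc, pow_succ]
      push_cast
      field_simp
    have hfl : ⌊2 * y⌋ = 2 * ⌊y⌋ ∨ ⌊2 * y⌋ = 2 * ⌊y⌋ + 1 := by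
      have e1 := Int.floor_le y
      have e2 := Int.lt_floor_add_one y
      have e3 : 2 * ⌊y⌋ ≤ ⌊2 * y⌋ := Int.le_floor.2 (by push_cast; linarith)
      have e4 : ⌊2 * y⌋ < 2 * ⌊y⌋ + 2 := Int.floor_lt.2 (by push_cast; linarith)
      omega
    have hu1 : u (l + (j + 1)) = ⌊2 * y⌋ / 2 ^ (l + (j + 1)) := by
      simp only [u]
      rw [hy2]
    rw [hu0, hu1]
    rcases hfl with e | e
    · rw [e, dist_self]
      exact hpos
    · rw [e, dist_comm, Real.dist_eq]
      have := h (l + (j + 1)) (by omega) (2 * ⌊y⌋) hw.1 hw.2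
      push_cast at this ⊢
      refine this.trans ?_
      rw [← pow_add]
      exact pow_le_pow_of_le_one hr0.le hr1.le (by omega)
  have hlim : Tendsto (fun j => f (u (l + j))) atTop (𝓝 (f x)) :=
    (hf.tendsto x).comp (hu.comp (tendsto_add_atTop_nat l |>.congr fun j => by simp [add_comm]))
  have := dist_le_of_le_geometric_of_tendsto₀ r (r ^ l) hr1 hstep hlim
  rwa [Real.dist_eq, add_zero] at this

theorem DyadicBound.abs_sub_le (h : DyadicBound f r n m) (hf : Continuous f) (hr0 : 0 < r)
    (hr1 : r < 1) {l : ℕ} (hl : m ≤ l) {s t : ℝ} (hs : s ∈ Ico (-n : ℝ) n)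
    (ht : t ∈ Ico (-n : ℝ) n) (hst : |s - t| ≤ 1 / 2 ^ l) :
    |f s - f t| ≤ r ^ l * (1 + 2 / (1 - r)) := by
  wlog hle : s ≤ t generalizing s t
  · rw [abs_sub_comm]
    exact this ht hs (by rwa [abs_sub_comm]) (not_le.1 hle).le
  have h2 : (0 : ℝ) < 2 ^ l := by positivity
  have e1 := h.abs_sub_floor_le hf hr0 hr1 hl hs
  have e2 := h.abs_sub_floor_le hf hr0 hr1 hl ht
  have e3 : |f (⌊t * 2 ^ l⌋ / 2 ^ l) - f (⌊s * 2 ^ l⌋ / 2 ^ l)| ≤ r ^ l := by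
    have hpos : (0 : ℝ) ≤ r ^ l := by positivity
    have g1 : ⌊s * 2 ^ l⌋ ≤ ⌊t * 2 ^ l⌋ := Int.floor_le_floor (by gcongr)
    have g2 : ⌊t * 2 ^ l⌋ ≤ ⌊s * 2 ^ l⌋ + 1 := by
      rw [← Int.floor_add_one]
      refine Int.floor_le_floor ?_
      rw [abs_sub_comm, abs_of_nonneg (sub_nonneg.2 hle), le_div_iff₀ h2] at hst
      linarith
    obtain g | g : ⌊t * 2 ^ l⌋ = ⌊s * 2 ^ l⌋ ∨ ⌊t * 2 ^ l⌋ = ⌊s * 2 ^ l⌋ + 1 := by omega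
    · rw [g, sub_self, abs_zero]
      exact hpos
    · rw [g]
      have h3 : -((n : ℤ) * 2 ^ l) ≤ ⌊s * 2 ^ l⌋ := by
        rw [Int.le_floor]
        push_cast
        rw [← neg_mul]
        exact mul_le_mul_of_nonneg_right hs.1 h2.le
      have h4 : ⌊s * 2 ^ l⌋ < n * 2 ^ l := by
        rw [Int.floor_lt]
        push_cast
        exact mul_lt_mul_of_pos_right hs.2 h2
      have := h l hl _ h3 h4
      push_cast
      exact this
  rw [abs_le] at e1 e2 e3 ⊢
  have : r ^ l * (1 + 2 / (1 - r)) = r ^ l + r ^ l / (1 - r) + r ^ l / (1 - r) := by ring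
  constructor <;> linarith [e1.1, e1.2, e2.1, e2.2, e3.1, e3.2]

theorem DyadicBound.abs_apply_le (h : DyadicBound f r n m) (hf : Continuous f) (hr0 : 0 < r)
    (hr1 : r < 1) {x : ℝ} (hx : x ∈ Ico (-n : ℝ) n) :
    |f x| ≤ |f 0| + n * 2 ^ m * r ^ m + r ^ m / (1 - r) := by
  have h2 : (0 : ℝ) < 2 ^ m := by positivity
  have key : ∀ j : ℕ, j ≤ n * 2 ^ m → |f ((j : ℤ) / 2 ^ m) - f 0| ≤ j * r ^ m ∧
      |f ((-j : ℤ) / 2 ^ m) - f 0| ≤ j * r ^ m := by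
    intro j
    induction j with
    | zero => simp
    | succ j ih =>
      intro hj
      obtain ⟨i1, i2⟩ := ih (by omega)
      have hj' : ((j + 1 : ℕ) : ℤ) ≤ n * 2 ^ m := by exact_mod_cast hj
      push_cast at hj'
      have s1 := h m le_rfl j ((neg_nonpos.2 (by positivity)).trans (by positivity)) (by omega)
      have s2 := h m le_rfl (-(j + 1)) (by omega) (by omega)
      push_cast at i1 i2 s1 s2 ⊢
      rw [show (-((j : ℝ) + 1) + 1) = -j by ring] at s2
      rw [abs_le] at i1 i2 s1 s2
      constructor <;> rw [abs_le] <;> constructor <;> linarith [i1.1, i1.2, i2.1, i2.2, s1.1, s1.2,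
        s2.1, s2.2]
  have e1 := h.abs_sub_floor_le hf hr0 hr1 le_rfl hx
  set i := ⌊x * 2 ^ m⌋ with hi
  have h3 : -((n : ℤ) * 2 ^ m) ≤ i := by
    rw [hi, Int.le_floor]
    push_cast
    rw [← neg_mul]
    exact mul_le_mul_of_nonneg_right hx.1 h2.le
  have h4 : i < n * 2 ^ m := by
    rw [hi, Int.floor_lt]
    push_cast
    exact mul_lt_mul_of_pos_right hx.2 h2
  have h5 : i.natAbs ≤ n * 2 ^ m := by zify; rw [abs_le]; exact ⟨h3, h4.le⟩
  have h6 : |f (i / 2 ^ m) - f 0| ≤ n * 2 ^ m * r ^ m := by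
    have h7 : (i.natAbs : ℝ) * r ^ m ≤ n * 2 ^ m * r ^ m := by
      gcongr
      exact_mod_cast h5
    refine le_trans ?_ h7
    rcases Int.natAbs_eq i with g | g
    · have := (key _ h5).1
      rwa [← g] at this
    · have := (key _ h5).2
      rwa [← g] at this
  have h8 : |f x| ≤ |f x - f (i / 2 ^ m)| + |f (i / 2 ^ m) - f 0| + |f 0| := by
    have := abs_add_three (f x - f (i / 2 ^ m)) (f (i / 2 ^ m) - f 0) (f 0)
    rwa [sub_add_sub_cancel, sub_add_cancel] at this
  rw [abs_sub_comm] at e1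
  linarith

end Dyadic

/-- Continuous functions that are bounded at `0` and satisfy dyadic bounds in every window form a
relatively compact set. -/
theorem isCompact_closure_dyadicBound {r : ℝ} (hr0 : 0 < r) (hr1 : r < 1) (m : ℕ → ℕ) (R : ℝ) :
    IsCompact (closure {f : C(ℝ, ℝ) | |f 0| ≤ R ∧ ∀ n, DyadicBound f r n (m n)}) := by
  have hwin : ∀ x : ℝ, ∃ n : ℕ, Ico (-n : ℝ) n ∈ 𝓝 x := by
    intro x
    obtain ⟨n, hn⟩ := exists_nat_gt |x|
    rw [abs_lt] at hn
    exact ⟨n, Ico_mem_nhds hn.1 hn.2⟩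
  have : T2Space (UniformOnFun ℝ ℝ {K | IsCompact K}) :=
    UniformOnFun.t2Space_of_covering (sUnion_eq_univ_iff.2 fun x => ⟨{x}, isCompact_singleton, rfl⟩)
  refine ArzelaAscoli.isCompact_closure_of_isClosedEmbedding (𝔖 := {K | IsCompact K})
    (F := fun f : C(ℝ, ℝ) => (f : ℝ → ℝ)) (fun K hK => hK)
    ContinuousMap.isUniformEmbedding_toUniformOnFunIsCompact.isClosedEmbedding ?_ ?_
  · intro K _ x _
    refine EquicontinuousAt.equicontinuousWithinAt ?_ _
    rw [Metric.equicontinuousAt_iff_right]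
    intro ε hε
    obtain ⟨n, hn⟩ := hwin x
    have hlim : Tendsto (fun l : ℕ => r ^ l * (1 + 2 / (1 - r))) atTop (𝓝 0) := by
      simpa using (tendsto_pow_atTop_nhds_zero_of_lt_one hr0.le hr1).mul_const (1 + 2 / (1 - r))
    obtain ⟨l, hl, hlm⟩ := ((hlim.eventually_lt_const hε).and (eventually_ge_atTop (m n))).exists
    filter_upwards [hn, Metric.closedBall_mem_nhds x (by positivity : (0 : ℝ) < 1 / 2 ^ l)]
      with y hy hyx f
    rw [Metric.mem_closedBall, dist_comm, Real.dist_eq] at hyx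
    exact ((f.2.2 n).abs_sub_le f.1.continuous hr0 hr1 hlm (mem_of_mem_nhds hn) hy hyx).trans_lt hl
  · intro K _ x _
    obtain ⟨n, hn⟩ := hwin x
    refine ⟨Metric.closedBall 0 (R + n * 2 ^ m n * r ^ m n + r ^ m n / (1 - r)),
      isCompact_closedBall _ _, fun f hf => ?_⟩
    rw [mem_closedBall_zero_iff, Real.norm_eq_abs]
    exact ((hf.2 n).abs_apply_le f.continuous hr0 hr1 (mem_of_mem_nhds hn)).trans
      (by gcongr; exact hf.1)

/-- **Kolmogorov's tightness criterion**, with the exponents `4` and `2`. -/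
theorem isTightMeasureSet_of_increments [MeasurableSpace C(ℝ, ℝ)] {S : Set (Measure C(ℝ, ℝ))}
    (h0 : ∀ ε : ENNReal, 0 < ε → ∃ R : ℝ, ∀ μ ∈ S, μ {f | R < |f 0|} ≤ ε)
    (h : ∀ n : ℕ, ∃ C : ℝ, ∀ μ ∈ S, ∀ s ∈ Icc (-n : ℝ) n, ∀ t ∈ Icc (-n : ℝ) n, ∀ a > 0,
      μ {f | a < |f s - f t|} ≤ ENNReal.ofReal (C * |s - t| ^ 2 / a ^ 4)) :
    IsTightMeasureSet S := by
  rw [isTightMeasureSet_iff_exists_isCompact_measure_compl_le]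
  intro ε hε
  -- `1 / 2 < r ^ 4` makes the union bound over dyadic increments summable
  set r : ℝ := 9 / 10 with hr
  have hr0 : 0 < r := by norm_num
  have hr1 : r < 1 := by norm_num
  set ρ : ℝ := 1 / (2 * r ^ 4) with hρ
  have hρ0 : 0 < ρ := by positivity
  have hρ1 : ρ < 1 := by norm_num [hρ, hr]
  choose C hC using h
  obtain ⟨R, hR⟩ := h0 (ε / 2) (ENNReal.half_pos hε.ne')
  obtain ⟨δ, hδ0, hδ⟩ := ENNReal.exists_pos_sum_of_countable (ENNReal.half_pos hε.ne').ne' ℕ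
  have hm : ∀ n : ℕ, ∃ m : ℕ, 2 * n * |C n| * ρ ^ m / (1 - ρ) ≤ δ n := by
    intro n
    have hlim : Tendsto (fun m : ℕ => 2 * n * |C n| * ρ ^ m / (1 - ρ)) atTop (𝓝 0) := by
      simpa using ((tendsto_pow_atTop_nhds_zero_of_lt_one hρ0.le hρ1).const_mul
        (2 * n * |C n|)).div_const (1 - ρ)
    exact ((hlim.eventually_lt_const (NNReal.coe_pos.2 (hδ0 n))).exists).imp fun m hm => hm.le
  choose m hm using hm
  refine ⟨_, isCompact_closure_dyadicBound hr0 hr1 m R, fun μ hμ => ?_⟩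
  let bad : ℕ → ℕ → ℤ → Set C(ℝ, ℝ) := fun n l i =>
    {f | r ^ (m n + l) < |f ((i + 1) / 2 ^ (m n + l)) - f (i / 2 ^ (m n + l))|}
  have hbad : ∀ n l : ℕ, μ (⋃ i ∈ Finset.Ico (-((n : ℤ) * 2 ^ (m n + l))) (n * 2 ^ (m n + l)),
      bad n l i) ≤ ENNReal.ofReal (2 * n * |C n| * ρ ^ m n * ρ ^ l) := by
    intro n l
    have h2 : (0 : ℝ) < 2 ^ (m n + l) := by positivity
    calc _ ≤ ∑ i ∈ Finset.Ico (-((n : ℤ) * 2 ^ (m n + l))) (n * 2 ^ (m n + l)), μ (bad n l i) :=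
          measure_biUnion_finset_le _ _
      _ ≤ ∑ i ∈ Finset.Ico (-((n : ℤ) * 2 ^ (m n + l))) (n * 2 ^ (m n + l)),
          ENNReal.ofReal (|C n| * (1 / 2 ^ (m n + l)) ^ 2 / (r ^ (m n + l)) ^ 4) := by
          refine Finset.sum_le_sum fun i hi => ?_
          rw [Finset.mem_Ico] at hi
          have hi1 : -((n : ℝ) * 2 ^ (m n + l)) ≤ i := by exact_mod_cast hi.1
          have hi2 : (i : ℝ) + 1 ≤ n * 2 ^ (m n + l) := by exact_mod_cast hi.2
          have hd : ((i : ℝ) + 1) / 2 ^ (m n + l) - i / 2 ^ (m n + l) = 1 / 2 ^ (m n + l) := by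
            rw [← sub_div]; ring
          refine (hC n μ hμ ((i + 1) / 2 ^ (m n + l)) ⟨?_, ?_⟩ (i / 2 ^ (m n + l)) ⟨?_, ?_⟩
            (r ^ (m n + l)) (by positivity)).trans ?_
          · rw [le_div_iff₀ h2]; linarith
          · rw [div_le_iff₀ h2]; linarith
          · rw [le_div_iff₀ h2]; linarith
          · rw [div_le_iff₀ h2]; linarith
          · rw [hd, abs_of_pos (by positivity : (0 : ℝ) < 1 / 2 ^ (m n + l))]
            gcongr
            exact le_abs_self _
      _ = ENNReal.ofReal (2 * n * |C n| * ρ ^ m n * ρ ^ l) := by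
          rw [Finset.sum_const, Int.card_Ico, nsmul_eq_mul,
            show ((n : ℤ) * 2 ^ (m n + l) - -(n * 2 ^ (m n + l))).toNat =
              2 * n * 2 ^ (m n + l) by
                rw [show ((n : ℤ) * 2 ^ (m n + l) - -(n * 2 ^ (m n + l))) =
                  ((2 * n * 2 ^ (m n + l) : ℕ) : ℤ) by push_cast; ring, Int.toNat_natCast],
            ← ENNReal.ofReal_natCast, ← ENNReal.ofReal_mul (by positivity)]
          congr 1
          have e : ρ ^ (m n + l) = 1 / (2 ^ (m n + l) * (r ^ (m n + l)) ^ 4) := by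
            rw [hρ, one_div_pow, mul_pow, ← pow_mul, ← pow_mul, mul_comm 4]
          rw [mul_assoc (2 * (n : ℝ) * |C n|), ← pow_add, e]
          push_cast
          field_simp
  have hsub : (closure {f : C(ℝ, ℝ) | |f 0| ≤ R ∧ ∀ n, DyadicBound f r n (m n)})ᶜ ⊆
      {f | R < |f 0|} ∪ ⋃ n : ℕ, ⋃ l : ℕ,
        ⋃ i ∈ Finset.Ico (-((n : ℤ) * 2 ^ (m n + l))) (n * 2 ^ (m n + l)), bad n l i := by
    refine (compl_subset_compl.2 subset_closure).trans ?_
    intro f hf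
    by_contra hcon
    simp only [mem_union, mem_iUnion, not_or, not_exists, Finset.mem_Ico] at hcon
    refine hf ⟨not_lt.1 hcon.1, fun n l hl i hi1 hi2 => ?_⟩
    obtain ⟨l', rfl⟩ := Nat.exists_eq_add_of_le hl
    exact not_lt.1 (hcon.2 n l' i ⟨hi1, hi2⟩)
  calc _ ≤ _ := measure_mono hsub
    _ ≤ ε / 2 + ∑' n, ∑' l, ENNReal.ofReal (2 * n * |C n| * ρ ^ m n * ρ ^ l) := by
        refine (measure_union_le _ _).trans (add_le_add (hR μ hμ) ?_)
        refine (measure_iUnion_le _).trans (ENNReal.tsum_le_tsum fun n => ?_)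
        exact (measure_iUnion_le _).trans (ENNReal.tsum_le_tsum fun l => hbad n l)
    _ ≤ ε / 2 + ∑' n, (δ n : ENNReal) := by
        gcongr with n
        rw [← ENNReal.ofReal_tsum_of_nonneg (fun l => by positivity)
          ((summable_geometric_of_lt_one hρ0.le hρ1).mul_left _), tsum_mul_left,
          tsum_geometric_of_lt_one hρ0.le hρ1, ← div_eq_mul_inv, ← ENNReal.ofReal_coe_nnreal]
        exact ENNReal.ofReal_le_ofReal (hm n)
    _ ≤ ε / 2 + ε / 2 := by gcongr
    _ = ε := ENNReal.add_halves ε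

/-! ### Borel sets of the Skorokhod space -/

namespace SkorokhodSpace

theorem isOpen_setOf_exists_lt (a b c : ℝ) :
    IsOpen {Y : SkorokhodSpace | ∃ s ∈ Ioo a b, Y s < c} := by
  rintro Y ⟨s, hs, hYs⟩
  refine ⟨|s| + 1, min (c - Y s) (min (s - a) (b - s)), by positivity,
    lt_min (sub_pos.2 hYs) (lt_min (sub_pos.2 hs.1) (sub_pos.2 hs.2)), ?_⟩
  rintro y ⟨φ, h1, h2⟩
  have h3 := h1 s
  have h4 := h2 s (abs_le.1 (by linarith))
  rw [lt_min_iff, lt_min_iff, abs_lt, abs_lt, abs_lt] at h3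
  rw [lt_min_iff, abs_lt] at h4
  exact ⟨φ s, ⟨by linarith [h3.2.1.1], by linarith [h3.2.2.2]⟩, by linarith [h4.1.2]⟩

/-- The coordinates of the Skorokhod space are Borel: by right continuity `c < Y t` means that
`Y` is at least some `c' > c` on an interval to the right of `t`, which is a closed condition. -/
theorem measurable_eval (t : ℝ) : Measurable fun Y : SkorokhodSpace => Y t := by
  refine measurable_of_Ioi fun c => ?_
  have : (fun Y : SkorokhodSpace => Y t) ⁻¹' Ioi c = ⋃ (r : ℚ) (_ : c < r) (n : ℕ),
      {Y : SkorokhodSpace | ∃ s ∈ Ioo t (t + 1 / (n + 1)), Y s < r}ᶜ := by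
    ext Y
    simp only [mem_preimage, mem_Ioi, mem_iUnion, mem_compl_iff, exists_prop]
    constructor
    · intro h
      obtain ⟨r, hr1, hr2⟩ := exists_rat_btwn h
      have h1 := (Y.2 t).1.eventually (lt_mem_nhds hr2)
      rw [eventually_nhdsWithin_iff, Metric.eventually_nhds_iff] at h1
      obtain ⟨δ, hδ, h1⟩ := h1
      obtain ⟨n, hn⟩ := exists_nat_one_div_lt hδ
      refine ⟨r, hr1, n, ?_⟩
      rintro ⟨s, hs, hsr⟩
      refine lt_asymm hsr (h1 ?_ hs.1.le)
      rw [Real.dist_eq, abs_of_pos (sub_pos.2 hs.1)]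
      linarith [hs.2]
    · rintro ⟨r, hr, n, h⟩
      refine hr.trans_le ?_
      have h1 : Tendsto Y (𝓝[>] t) (𝓝 (Y t)) :=
        (Y.2 t).1.mono_left (nhdsWithin_mono _ Ioi_subset_Ici_self)
      refine ge_of_tendsto h1 ?_
      have h2 : Ioo t (t + 1 / (n + 1)) ∈ 𝓝[>] t :=
        Ioo_mem_nhdsGT (by linarith [Nat.one_div_pos_of_nat (α := ℝ) (n := n)])
      filter_upwards [h2] with s hs
      by_contra hlt
      exact h ⟨s, hs, not_le.1 hlt⟩
  rw [this]
  exact .iUnion fun r => .iUnion fun _ => .iUnion fun n =>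
    (isOpen_setOf_exists_lt _ _ _).measurableSet.compl

/-- A jump of size `η` persists under perturbations of size less than `η / 2`. -/
theorem isClosed_setOf_continuous : IsClosed {Y : SkorokhodSpace | Continuous Y} := by
  rw [← isOpen_compl_iff]
  intro x hx
  have : ∃ t, ¬ ContinuousAt x t := by
    by_contra! h
    exact hx (continuous_iff_continuousAt.2 h)
  obtain ⟨t, ht⟩ := this
  obtain ⟨hr, l, hl⟩ := x.2 t
  have hne : l ≠ x t := by
    rintro rfl
    exact ht (continuousAt_iff_continuous_left'_right'.2
      ⟨hl, hr.mono Ioi_subset_Ici_self⟩)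
  have hpos : 0 < |l - x t| := abs_pos.2 (sub_ne_zero.2 hne)
  refine ⟨|t| + 1, |l - x t| / 3, by positivity, by positivity, ?_⟩
  rintro y ⟨φ, -, h2⟩ hy
  have hyφ : Continuous fun s => y (φ s) := Continuous.comp hy φ.continuous
  have h3 := h2 t (abs_le.1 (by linarith))
  have h4 : Tendsto (fun s => |y (φ s) - x s|) (𝓝[<] t) (𝓝 |y (φ t) - l|) :=
    ((hyφ.tendsto t |>.mono_left inf_le_left).sub hl).abs
  have h5 : |y (φ t) - l| ≤ |l - x t| / 3 := by
    refine le_of_tendsto h4 ?_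
    have h6 : Ioo (t - 1) t ∈ 𝓝[<] t := Ioo_mem_nhdsLT (by linarith)
    filter_upwards [h6] with s hs
    refine (h2 s ⟨?_, ?_⟩).le
    · linarith [neg_abs_le t, hs.1]
    · linarith [le_abs_self t, hs.2]
  have h7 := abs_sub_le l (y (φ t)) (x t)
  rw [abs_sub_comm l (y (φ t))] at h7
  linarith

end SkorokhodSpace

/-- A continuous function, viewed in the Skorokhod space. -/
def toSkorokhod (f : C(ℝ, ℝ)) : SkorokhodSpace := SkorokhodSpace.ofContinuous f f.continuous

/-- Locally uniform convergence implies Skorokhod convergence, with the identity as time change. -/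
theorem continuous_toSkorokhod : Continuous toSkorokhod := by
  refine continuous_def.2 fun U hU => isOpen_iff_mem_nhds.2 fun f hf => ?_
  obtain ⟨T, ε, -, hε, hsub⟩ := hU _ hf
  have h1 := ContinuousMap.tendsto_iff_forall_isCompact_tendstoUniformlyOn.1
    (tendsto_id (x := 𝓝 f)) (Icc (-T) T) isCompact_Icc
  filter_upwards [Metric.tendstoUniformlyOn_iff.1 h1 ε hε] with g hg
  refine hsub ⟨OrderIso.refl ℝ, fun t => by simpa using hε, fun t ht => ?_⟩
  have := hg t ht
  rwa [dist_comm, Real.dist_eq] at this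

/-! ### Convergence on the space of continuous functions -/

instance : MeasurableSpace C(ℝ, ℝ) := borel _

instance : BorelSpace C(ℝ, ℝ) := ⟨rfl⟩

instance : PolishSpace C(ℝ, ℝ) where

/-- The linear combination `∑ t, w t * f t` of values of `f`. -/
noncomputable def evalSum (w : ℝ →₀ ℝ) (f : ℝ → ℝ) : ℝ := w.sum fun t θ => θ * f t

/-- The pairing of continuous functions with finitely supported weights. -/
noncomputable def evalPairing : C(ℝ, ℝ) →ₗ[ℝ] (ℝ →₀ ℝ) →ₗ[ℝ] ℝ :=
  (Finsupp.bilinearCombination ℝ ℝ) ∘ₗ (ContinuousMap.coeFnLinearMap ℝ)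

theorem evalPairing_apply (f : C(ℝ, ℝ)) (w : ℝ →₀ ℝ) : evalPairing f w = evalSum w f := by
  simp [evalPairing, evalSum, Finsupp.linearCombination_apply]

theorem continuous_evalSum (w : ℝ →₀ ℝ) : Continuous fun f : C(ℝ, ℝ) => evalSum w f := by
  unfold evalSum Finsupp.sum
  fun_prop

/-- Finite-dimensional convergence of a tight family implies weak convergence: **Prokhorov's
theorem** provides a limit along an ultrafilter, and its finite-dimensional distributions identify
it. -/
theorem exists_tendsto_of_isTightMeasureSet {ι : Type*} {l : Filter ι} [l.NeBot]
    (μ : ι → ProbabilityMeasure C(ℝ, ℝ))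
    (htight : IsTightMeasureSet {(μ i : Measure C(ℝ, ℝ)) | i}) (Φ : (ℝ →₀ ℝ) → ℂ)
    (hfdd : ∀ w, Tendsto (fun i => ∫ f : C(ℝ, ℝ), Complex.exp (evalSum w f * Complex.I)
      ∂(μ i : Measure _)) l (𝓝 (Φ w))) :
    ∃ μ₀ : ProbabilityMeasure C(ℝ, ℝ), Tendsto μ l (𝓝 μ₀) ∧
      ∀ w, ∫ f : C(ℝ, ℝ), Complex.exp (evalSum w f * Complex.I) ∂(μ₀ : Measure _) = Φ w := by
  have hcomp : IsCompact (closure (range μ)) := by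
    refine isCompact_closure_of_isTightMeasureSet ?_
    convert! htight using 1
    ext ν
    simp
  have hmem : closure (range μ) ∈ (Ultrafilter.of l).map μ :=
    mem_of_superset (range_mem_map (m := μ)) subset_closure
  obtain ⟨μ₀, -, hμ₀⟩ := hcomp.ultrafilter_le_nhds' _ hmem
  have hlim : ∀ w,
      ∫ f : C(ℝ, ℝ), Complex.exp (evalSum w f * Complex.I) ∂(μ₀ : Measure _) = Φ w := by
    intro w
    have h1 : Tendsto μ (Ultrafilter.of l) (𝓝 μ₀) := hμ₀
    rw [ProbabilityMeasure.tendsto_iff_forall_integral_rclike_tendsto ℂ] at h1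
    have hc : Continuous fun f : C(ℝ, ℝ) => Complex.exp (evalSum w f * Complex.I) := by
      have := continuous_evalSum w
      fun_prop
    have h2 := h1 (BoundedContinuousFunction.ofNormedAddCommGroup _ hc 1
      fun f => (Complex.norm_exp_ofReal_mul_I _).le)
    exact tendsto_nhds_unique h2 ((hfdd w).mono_left (Ultrafilter.of_le l))
  refine ⟨μ₀, ?_, hlim⟩
  let _ : TopologicalSpace (ℝ →₀ ℝ) := ⊥
  have : DiscreteTopology (ℝ →₀ ℝ) := ⟨rfl⟩
  have hL : Continuous fun p : C(ℝ, ℝ) × (ℝ →₀ ℝ) => evalPairing p.1 p.2 := by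
    refine continuous_prod_of_discrete_right.2 fun w => ?_
    simp_rw [evalPairing_apply]
    exact continuous_evalSum w
  refine ProbabilityMeasure.tendsto_of_tight_of_separatesPoints ℂ htight
    (A := BoundedContinuousFunction.charPoly Real.continuous_probChar hL)
    (BoundedContinuousFunction.separatesPoints_charPoly Real.continuous_probChar
      Real.probChar_ne_one hL
      fun f hf h => hf ?_) ?_
  · ext t
    have := congrArg (fun L => L (Finsupp.single t 1)) h
    simpa [evalPairing_apply, evalSum] using this
  · intro g hg
    rw [BoundedContinuousFunction.mem_charPoly] at hg
    obtain ⟨w, hw⟩ := hg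
    have h_eq : ∀ ν : ProbabilityMeasure C(ℝ, ℝ), ∫ f, g f ∂(ν : Measure C(ℝ, ℝ)) =
        w.coeff.sum fun a z =>
          z * ∫ f : C(ℝ, ℝ), Complex.exp (evalSum a f * Complex.I) ∂(ν : Measure C(ℝ, ℝ)) := by
      intro ν
      simp_rw [hw, Finsupp.sum]
      rw [integral_finsetSum]
      · refine Finset.sum_congr rfl fun a _ => ?_
        rw [integral_const_mul]
        simp [Real.probChar, evalPairing_apply, Circle.coe_exp]
      · intro a _
        refine Integrable.const_mul ?_ _
        refine (integrable_const (1 : ℝ)).mono' ?_ (.of_forall fun f => ?_)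
        · refine Continuous.aestronglyMeasurable ?_
          have h1 := continuous_evalSum a
          simp_rw [evalPairing_apply]
          exact continuous_induced_dom.comp (Real.continuous_probChar.comp h1)
        · exact (Circle.norm_coe _).le
    simp_rw [h_eq, Finsupp.sum]
    refine tendsto_finsetSum _ fun a _ => Tendsto.const_mul _ ?_
    rw [hlim]
    exact hfdd a

/-! ### The limit process -/

/-- The variance of `∑ t, w t * Y t` for the stationary Ornstein–Uhlenbeck process `Y`. -/
noncomputable def ouVar (w : ℝ →₀ ℝ) : ℝ :=
  w.sum fun s a => w.sum fun t b => a * b * Real.exp (-|t - s|)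

theorem ouVar_smul (u : ℝ) (w : ℝ →₀ ℝ) : ouVar (u • w) = u ^ 2 * ouVar w := by
  unfold ouVar
  rw [Finsupp.sum_smul_index (by intro s; simp), Finsupp.sum, Finsupp.sum, Finset.mul_sum]
  refine Finset.sum_congr rfl fun s _ => ?_
  rw [Finsupp.sum_smul_index (by intro s; simp), Finsupp.sum, Finsupp.sum, Finset.mul_sum]
  exact Finset.sum_congr rfl fun t _ => by ring

theorem ouVar_single_add_single (s t b : ℝ) :
    ouVar (Finsupp.single s 1 + Finsupp.single t b) = 1 + 2 * b * Real.exp (-|t - s|) + b ^ 2 := by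
  have h : ∀ (w : ℝ →₀ ℝ) (F : ℝ → ℝ → ℝ), (∀ x, F x 0 = 0) →
      (∀ x a b, F x (a + b) = F x a + F x b) →
      (Finsupp.single s 1 + Finsupp.single t b).sum F = F s 1 + F t b := by
    intro w F h1 h2
    rw [Finsupp.sum_add_index' h1 h2, Finsupp.sum_single_index (h1 s),
      Finsupp.sum_single_index (h1 t)]
  have hin : ∀ x a, ((Finsupp.single s 1 + Finsupp.single t b).sum fun t b =>
      a * b * Real.exp (-|t - x|)) = a * 1 * Real.exp (-|s - x|) + a * b * Real.exp (-|t - x|) :=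
    fun x a => h 0 _ (by simp) (by intros; ring)
  unfold ouVar
  simp_rw [hin]
  rw [h 0 _ (by simp) (by intros; ring), abs_sub_comm s t]
  simp
  ring

theorem evalSum_single_add_single (s t b : ℝ) (f : ℝ → ℝ) :
    evalSum (Finsupp.single s 1 + Finsupp.single t b) f = f s + b * f t := by
  unfold evalSum
  rw [Finsupp.sum_add_index' (by simp) (by intros; ring), Finsupp.sum_single_index (by simp),
    Finsupp.sum_single_index (by simp), one_mul]

theorem evalSum_smul (u : ℝ) (w : ℝ →₀ ℝ) (f : C(ℝ, ℝ)) : evalSum (u • w) f = u * evalSum w f := by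
  rw [← evalPairing_apply, map_smul, evalPairing_apply, smul_eq_mul]

section Limit

variable {μ₀ : Measure C(ℝ, ℝ)} [IsProbabilityMeasure μ₀]
  (h : ∀ w, ∫ f : C(ℝ, ℝ), Complex.exp (evalSum w f * Complex.I) ∂μ₀ =
    (Real.exp (-(ouVar w / 2)) : ℝ))
include h

/-- The linear combination of coordinates with weights `w` is Gaussian, because its characteristic
function at `u` is the one given by `u • w`. -/
theorem map_evalSum_eq_gaussianReal (w : ℝ →₀ ℝ) :
    μ₀.map (fun f : C(ℝ, ℝ) => evalSum w f) = gaussianReal 0 (ouVar w).toNNReal := by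
  have hmeas : Measurable fun f : C(ℝ, ℝ) => evalSum w f := (continuous_evalSum w).measurable
  have hV : 0 ≤ ouVar w := by
    have h1 : ‖∫ f : C(ℝ, ℝ), Complex.exp (evalSum w f * Complex.I) ∂μ₀‖ ≤ 1 := by
      refine (norm_integral_le_of_norm_le (g := fun _ => (1 : ℝ)) (integrable_const _)
        (.of_forall fun f => (Complex.norm_exp_ofReal_mul_I _).le)).trans (by simp)
    rw [h, Complex.norm_real, Real.norm_of_nonneg (Real.exp_pos _).le, Real.exp_le_one_iff] at h1
    linarith
  have : IsProbabilityMeasure (μ₀.map fun f : C(ℝ, ℝ) => evalSum w f) :=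
    Measure.isProbabilityMeasure_map hmeas.aemeasurable
  refine Measure.ext_of_charFun ?_
  ext u
  rw [charFun_apply_real, integral_map hmeas.aemeasurable
    (by fun_prop : Continuous fun x : ℝ => Complex.exp (u * x * Complex.I)).aestronglyMeasurable,
    charFun_gaussianReal]
  have h1 := h (u • w)
  simp_rw [evalSum_smul, Complex.ofReal_mul] at h1
  rw [h1, ouVar_smul, Complex.ofReal_exp, Real.coe_toNNReal _ hV]
  congr 1
  push_cast
  ring

theorem integral_evalSum_sq (w : ℝ →₀ ℝ) (hw : 0 ≤ ouVar w) :
    Integrable (fun f : C(ℝ, ℝ) => evalSum w f ^ 2) μ₀ ∧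
      ∫ f : C(ℝ, ℝ), evalSum w f ^ 2 ∂μ₀ = ouVar w := by
  have hmeas : Measurable fun f : C(ℝ, ℝ) => evalSum w f := (continuous_evalSum w).measurable
  have hmap := map_evalSum_eq_gaussianReal h w
  have hsq : Integrable (fun x : ℝ => x ^ 2) (gaussianReal 0 (ouVar w).toNNReal) :=
    (memLp_id_gaussianReal 2).integrable_sq
  constructor
  · rw [← hmap] at hsq
    exact hsq.comp_measurable hmeas
  · have h1 := variance_id_gaussianReal (μ := 0) (v := (ouVar w).toNNReal)
    rw [variance_of_integral_eq_zero (by fun_prop) (by simp), Real.coe_toNNReal _ hw, ← hmap,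
      integral_map hmeas.aemeasurable (by fun_prop)] at h1
    exact h1

/-- A measure on `C(ℝ, ℝ)` with the characteristic functions of the stationary Ornstein–Uhlenbeck
process makes the coordinates of the Skorokhod space such a process. -/
theorem isStationaryOU_map_toSkorokhod :
    IsStationaryOU (fun (t : ℝ) (Y : SkorokhodSpace) => Y t) (μ₀.map toSkorokhod) := by
  have hm := continuous_toSkorokhod.measurable
  refine ⟨⟨fun I => ⟨?_⟩⟩, fun t => ?_, fun s t => ?_, ?_⟩
  · have hmI : Measurable fun Y : SkorokhodSpace => I.restrict (Y ·) :=
      measurable_pi_lambda _ fun i => SkorokhodSpace.measurable_eval _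
    refine isGaussian_of_map_eq_gaussianReal fun L =>
      ⟨0, (ouVar (∑ i : I, Finsupp.single (i : ℝ) (L (Pi.single i 1)))).toNNReal, ?_⟩
    rw [Measure.map_map L.continuous.measurable hmI,
      Measure.map_map (L.continuous.measurable.comp hmI) hm, ← map_evalSum_eq_gaussianReal h]
    congr 1
    ext f
    rw [← evalPairing_apply, map_sum]
    simp only [evalPairing_apply, Function.comp_apply]
    have h1 : I.restrict (toSkorokhod f : ℝ → ℝ) =
        ∑ i : I, f i • (Pi.single i (1 : ℝ) : I → ℝ) := by
      ext j
      simp [Finset.sum_apply, Pi.single_apply, toSkorokhod, SkorokhodSpace.ofContinuous]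
    rw [h1, map_sum]
    refine Finset.sum_congr rfl fun i _ => ?_
    rw [map_smul, evalSum, Finsupp.sum_single_index (by simp), smul_eq_mul, mul_comm]
  · rw [integral_map hm.aemeasurable (SkorokhodSpace.measurable_eval t).aestronglyMeasurable]
    have h1 := map_evalSum_eq_gaussianReal h (Finsupp.single t 1)
    have h2 := integral_id_gaussianReal (μ := 0) (v := (ouVar (Finsupp.single t 1)).toNNReal)
    rw [← h1, integral_map (continuous_evalSum _).measurable.aemeasurable (by fun_prop)] at h2
    rw [← h2]
    refine integral_congr_ae (.of_forall fun f => ?_)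
    simp [evalSum, toSkorokhod, SkorokhodSpace.ofContinuous]
  · have hst : Measurable fun Y : SkorokhodSpace => Y s * Y t :=
      (SkorokhodSpace.measurable_eval s).mul (SkorokhodSpace.measurable_eval t)
    rw [integral_map hm.aemeasurable hst.aestronglyMeasurable]
    have he : Real.exp (-|t - s|) ≤ 1 := Real.exp_le_one_iff.2 (neg_nonpos.2 (abs_nonneg _))
    have he' := Real.exp_pos (-|t - s|)
    obtain ⟨i1, e1⟩ := integral_evalSum_sq h (Finsupp.single s 1 + Finsupp.single t 1)
      (by rw [ouVar_single_add_single]; linarith)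
    obtain ⟨i2, e2⟩ := integral_evalSum_sq h (Finsupp.single s 1 + Finsupp.single t (-1))
      (by rw [ouVar_single_add_single]; linarith)
    -- polarization
    have h1 : ∀ f : C(ℝ, ℝ), toSkorokhod f s * toSkorokhod f t =
        4⁻¹ * (evalSum (Finsupp.single s 1 + Finsupp.single t 1) f ^ 2 -
          evalSum (Finsupp.single s 1 + Finsupp.single t (-1)) f ^ 2) := by
      intro f
      rw [evalSum_single_add_single, evalSum_single_add_single]
      simp only [toSkorokhod, SkorokhodSpace.ofContinuous]
      ring
    simp_rw [h1]
    rw [integral_const_mul, integral_sub i1 i2, e1, e2, ouVar_single_add_single,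
      ouVar_single_add_single]
    ring
  · rw [ae_map_iff hm.aemeasurable SkorokhodSpace.isClosed_setOf_continuous.measurableSet]
    exact .of_forall fun f => f.continuous

end Limit

/-! ### From the martingale to the boundary path -/

theorem abs_boundary_sub_le (μ : YoungDiagram) (s t : ℝ) :
    |boundary μ s - boundary μ t| ≤ |s - t| := by
  -- on an interval between consecutive integers the path is affine with slope `1` or `-1`
  have hcell : ∀ (k : ℤ) (s t : ℝ), s ∈ Icc (k : ℝ) (k + 1) → t ∈ Icc (k : ℝ) (k + 1) →
      |boundary μ s - boundary μ t| ≤ |s - t| := by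
    intro k s t hs ht
    rw [boundary_eq_of_mem_Icc μ k hs, boundary_eq_of_mem_Icc μ k ht]
    have h1 : |(boundaryPath μ (k + 1) : ℝ) - boundaryPath μ k| = 1 := by
      exact_mod_cast abs_boundaryPath_succ_sub μ k
    have h2 : (1 - (s - k)) * (boundaryPath μ k : ℝ) + (s - k) * boundaryPath μ (k + 1) -
        ((1 - (t - k)) * boundaryPath μ k + (t - k) * boundaryPath μ (k + 1)) =
        (s - t) * (boundaryPath μ (k + 1) - boundaryPath μ k) := by ring
    rw [h2, abs_mul, h1, mul_one]
  have hint : ∀ (j : ℤ) (n : ℕ), |boundary μ ((j + n : ℤ) : ℝ) - boundary μ (j : ℝ)| ≤ n := by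
    intro j n
    induction n with
    | zero => simp
    | succ n ih =>
      have h1 := hcell (j + n) ((j + n : ℤ) + 1) (j + n : ℤ) ⟨by simp, le_rfl⟩
        ⟨le_rfl, by linarith⟩
      have h2 := abs_sub_le (boundary μ (((j + n : ℤ) : ℝ) + 1)) (boundary μ ((j + n : ℤ) : ℝ))
        (boundary μ (j : ℝ))
      rw [add_sub_cancel_left, abs_one] at h1
      have h3 : (((j + (n + 1 : ℕ) : ℤ)) : ℝ) = ((j + n : ℤ) : ℝ) + 1 := by push_cast; ring
      rw [h3]
      push_cast at *
      linarith
  wlog hle : t ≤ s generalizing s t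
  · rw [abs_sub_comm, abs_sub_comm s]
    exact this t s (not_le.1 hle).le
  have hs1 := Int.floor_le s
  have hs2 := (Int.lt_floor_add_one s).le
  have ht1 := Int.floor_le t
  have ht2 := (Int.lt_floor_add_one t).le
  rcases (Int.floor_le_floor hle).eq_or_lt with h | h
  · exact hcell ⌊t⌋ s t ⟨by rw [h]; exact hs1, by rw [h]; exact hs2⟩ ⟨ht1, ht2⟩
  · obtain ⟨n, hn⟩ := Int.le.dest (show ⌊t⌋ + 1 ≤ ⌊s⌋ from h)
    have e1 := hcell ⌊s⌋ s ⌊s⌋ ⟨hs1, hs2⟩ ⟨le_rfl, by linarith⟩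
    have e2 := hcell ⌊t⌋ (⌊t⌋ + 1) t ⟨by linarith, le_rfl⟩ ⟨ht1, ht2⟩
    have e3 := hint (⌊t⌋ + 1) n
    rw [hn] at e3
    have hn' : (n : ℝ) = ⌊s⌋ - (⌊t⌋ + 1) := by
      have : (n : ℤ) = ⌊s⌋ - (⌊t⌋ + 1) := by omega
      exact_mod_cast this
    rw [abs_of_nonneg (sub_nonneg.2 hs1)] at e1
    rw [abs_of_nonneg (sub_nonneg.2 ht2)] at e2
    rw [abs_of_nonneg (sub_nonneg.2 hle)]
    push_cast at e3
    calc |boundary μ s - boundary μ t|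
        = |(boundary μ s - boundary μ ⌊s⌋) + (boundary μ ⌊s⌋ - boundary μ (⌊t⌋ + 1)) +
          (boundary μ (⌊t⌋ + 1) - boundary μ t)| := by congr 1; ring
      _ ≤ _ := abs_add_three _ _ _
      _ ≤ _ := by linarith

theorem boundary_intCast (μ : YoungDiagram) (k : ℤ) : boundary μ k = boundaryPath μ k := by
  rw [boundary_eq_of_mem_Icc μ k ⟨le_rfl, by linarith⟩]
  ring

theorem vershikCurve_eq (s : ℝ) : vershikCurve s = Real.log (1 + Real.exp (2 * s)) - s := by
  have h1 : 2 * Real.cosh s = (1 + Real.exp (2 * s)) * Real.exp (-s) := by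
    rw [Real.cosh_eq, add_mul, one_mul, ← Real.exp_add]
    ring_nf
  rw [vershikCurve, h1, Real.log_mul (by positivity) (Real.exp_pos _).ne', Real.log_exp]
  ring

theorem abs_vershikCurve_sub_le (s t : ℝ) : |vershikCurve s - vershikCurve t| ≤ |s - t| := by
  have key : ∀ s t : ℝ, vershikCurve s ≤ vershikCurve t + |s - t| := by
    intro s t
    have h : 2 * Real.cosh s ≤ 2 * Real.cosh t * Real.exp |s - t| := by
      rw [Real.cosh_eq, Real.cosh_eq]
      have h1 : Real.exp s ≤ Real.exp t * Real.exp |s - t| := by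
        rw [← Real.exp_add]
        exact Real.exp_le_exp.2 (by linarith [le_abs_self (s - t)])
      have h2 : Real.exp (-s) ≤ Real.exp (-t) * Real.exp |s - t| := by
        rw [← Real.exp_add]
        exact Real.exp_le_exp.2 (by linarith [neg_abs_le (s - t)])
      linarith
    have hs := Real.cosh_pos s
    have ht := Real.cosh_pos t
    calc vershikCurve s ≤ Real.log (2 * Real.cosh t * Real.exp |s - t|) :=
          Real.log_le_log (by positivity) h
      _ = _ := by rw [Real.log_mul (by positivity) (Real.exp_pos _).ne', Real.log_exp]; rfl
  rw [abs_le]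
  constructor
  · have := key t s
    rw [abs_sub_comm] at this
    linarith
  · linarith [key s t]

theorem abs_vershikCurve_le (s : ℝ) : |vershikCurve s| ≤ |s| + 1 := by
  have h := abs_vershikCurve_sub_le s 0
  have h0 : vershikCurve 0 = Real.log 2 := by simp [vershikCurve]
  have h1 := Real.log_two_lt_d9
  have h2 := Real.log_two_gt_d9
  rw [h0, sub_zero] at h
  rw [abs_le] at h ⊢
  constructor <;> linarith [h.1, h.2]

/-- Half of the logarithm of `1 / q`, so that `expTime q k = exp (2 * rate q * k)`. It agrees with
`scale q` to first order as `q → 1`. -/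
noncomputable def rate (q : ℝ) : ℝ := -Real.log q / 2

theorem expTime_eq_exp {q : ℝ} (h0 : 0 < q) (k : ℤ) :
    expTime q k = Real.exp (2 * (rate q * k)) := by
  rw [expTime, rate, ← Real.rpow_intCast, Real.rpow_def_of_pos h0]
  push_cast
  ring_nf

section Rate

variable {q : ℝ}

theorem scale_pos (hq : q ∈ Ioo (0 : ℝ) 1) : 0 < scale q := half_pos (sub_pos.2 hq.2)

theorem scale_le_rate (hq : q ∈ Ioo (0 : ℝ) 1) : scale q ≤ rate q := by
  have := Real.log_le_sub_one_of_pos hq.1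
  rw [scale, rate]
  linarith

theorem growth_eq (q : ℝ) : growth q = 2 * scale q / q := by
  rw [growth, scale]
  ring

theorem growth_le (hq : q ∈ Ioo (0 : ℝ) 1) (h2 : 1 / 2 ≤ q) : growth q ≤ 4 * scale q := by
  rw [growth_eq, div_le_iff₀ hq.1]
  nlinarith [scale_pos hq]

theorem scale_le (h2 : 1 / 2 ≤ q) : scale q ≤ 1 / 4 := by
  rw [scale]
  linarith

theorem growth_le_one (hq : q ∈ Ioo (0 : ℝ) 1) (h2 : 1 / 2 ≤ q) : growth q ≤ 1 := by
  have := growth_le hq h2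
  have := scale_le h2
  linarith

theorem rate_sub_scale_le (hq : q ∈ Ioo (0 : ℝ) 1) : rate q - scale q ≤ scale q * growth q := by
  have h := Real.one_sub_inv_le_log_of_pos hq.1
  have h1 := hq.1
  rw [growth_eq, scale, rate]
  have : (1 - q) / 2 * (2 * ((1 - q) / 2) / q) = (q⁻¹ - 1) / 2 - (1 - q) / 2 := by
    field_simp
  rw [this]
  linarith

theorem rate_sub_scale_le_sq (hq : q ∈ Ioo (0 : ℝ) 1) (h2 : 1 / 2 ≤ q) :
    rate q - scale q ≤ 4 * scale q ^ 2 := by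
  have h := rate_sub_scale_le hq
  have h1 := growth_le hq h2
  have h3 := scale_pos hq
  nlinarith

theorem rate_le (hq : q ∈ Ioo (0 : ℝ) 1) (h2 : 1 / 2 ≤ q) : rate q ≤ 2 * scale q := by
  have h := rate_sub_scale_le_sq hq h2
  have h1 := scale_le h2
  have h3 := scale_pos hq
  nlinarith

/-- The lattice position to the left of the macroscopic position `t`. -/
noncomputable def latticePos (q t : ℝ) : ℤ := ⌊t / scale q⌋

theorem scale_mul_latticePos_le (hq : q ∈ Ioo (0 : ℝ) 1) (t : ℝ) :
    scale q * latticePos q t ≤ t := by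
  have h := Int.floor_le (t / scale q)
  rw [le_div_iff₀ (scale_pos hq)] at h
  rw [mul_comm]
  exact h

theorem lt_scale_mul_latticePos (hq : q ∈ Ioo (0 : ℝ) 1) (t : ℝ) :
    t < scale q * latticePos q t + scale q := by
  have h := Int.lt_floor_add_one (t / scale q)
  rw [div_lt_iff₀ (scale_pos hq)] at h
  rw [latticePos]
  linarith

theorem abs_scale_mul_latticePos_le (hq : q ∈ Ioo (0 : ℝ) 1) (h2 : 1 / 2 ≤ q) {T t : ℝ}
    (ht : |t| ≤ T) : |scale q * latticePos q t| ≤ T + 1 := by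
  have h3 := scale_mul_latticePos_le hq t
  have h4 := lt_scale_mul_latticePos hq t
  have h5 := scale_le h2
  rw [abs_le] at ht ⊢
  constructor <;> linarith

theorem abs_rate_mul_sub_le (hq : q ∈ Ioo (0 : ℝ) 1) (h2 : 1 / 2 ≤ q) {T : ℝ} {k : ℤ}
    (hk : |scale q * k| ≤ T) : |rate q * k - scale q * k| ≤ 4 * T * scale q := by
  have h3 := scale_pos hq
  have h4 := scale_le_rate hq
  have h5 := rate_sub_scale_le_sq hq h2
  rw [← sub_mul, abs_mul, abs_of_nonneg (sub_nonneg.2 h4)]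
  rw [abs_mul, abs_of_pos h3] at hk
  calc (rate q - scale q) * |(k : ℝ)| ≤ 4 * scale q ^ 2 * |(k : ℝ)| := by gcongr
    _ = 4 * (scale q * |(k : ℝ)|) * scale q := by ring
    _ ≤ _ := by gcongr

theorem abs_rate_mul_le (hq : q ∈ Ioo (0 : ℝ) 1) (h2 : 1 / 2 ≤ q) {T : ℝ} {k : ℤ}
    (hk : |scale q * k| ≤ T) : |rate q * k| ≤ 2 * T := by
  have h3 := scale_pos hq
  rw [abs_mul, abs_of_nonneg (h3.le.trans (scale_le_rate hq))]
  rw [abs_mul, abs_of_pos h3] at hk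
  have := mul_le_mul_of_nonneg_right (rate_le hq h2) (abs_nonneg (k : ℝ))
  linarith

theorem expTime_mem_Icc (hq : q ∈ Ioo (0 : ℝ) 1) (h2 : 1 / 2 ≤ q) {T : ℝ} {k : ℤ}
    (hk : |scale q * k| ≤ T) :
    expTime q k ∈ Icc (Real.exp (4 * T))⁻¹ (Real.exp (4 * T)) := by
  have h := abs_le.1 (abs_rate_mul_le hq h2 hk)
  rw [expTime_eq_exp hq.1, ← Real.exp_neg]
  exact ⟨Real.exp_le_exp.2 (by linarith), Real.exp_le_exp.2 (by linarith)⟩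

theorem expTime_sub_le (hq : q ∈ Ioo (0 : ℝ) 1) (h2 : 1 / 2 ≤ q) {j k : ℤ} (hjk : j ≤ k) :
    expTime q k - expTime q j ≤ expTime q k * (4 * (scale q * k - scale q * j)) := by
  have h1 := expTime_pos hq.1 k
  have h3 : expTime q j = expTime q k * Real.exp (-(2 * (rate q * (k - j)))) := by
    rw [expTime_eq_exp hq.1, expTime_eq_exp hq.1, ← Real.exp_add]
    ring_nf
  have h4 := Real.add_one_le_exp (-(2 * (rate q * (k - j))))
  have h5 : (0 : ℝ) ≤ k - j := sub_nonneg.2 (by exact_mod_cast hjk)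
  have h6 := mul_le_mul_of_nonneg_right (rate_le hq h2) h5
  rw [h3]
  nlinarith

end Rate

/-- The logarithm of the martingale, centred at its value for a deterministic martingale. -/
noncomputable def logMart (q : ℝ) (k : ℤ) (μ : YoungDiagram) : ℝ :=
  Real.log ((expMart q k μ + expTime q k) / (1 + expTime q k))

/-- The deviation of the rescaled boundary from Vershik's curve. -/
noncomputable def deviation (q : ℝ) (μ : YoungDiagram) (t : ℝ) : ℝ :=
  scale q * boundary μ (t / scale q) - vershikCurve t

section Comparison

variable {q : ℝ} (hq : q ∈ Ioo (0 : ℝ) 1) (μ : YoungDiagram)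
include hq

/-- The path is an explicit function of the martingale: `rate q * X_k` is Vershik's curve at
`rate q * k` plus the logarithm of the martingale. -/
theorem logMart_eq (k : ℤ) :
    logMart q k μ = rate q * boundaryPath μ k - vershikCurve (rate q * k) := by
  have h1 := expTime_pos hq.1 k
  have h2 := expMart_nonneg hq k μ
  have h3 : expMart q k μ + expTime q k = expTime q k * (q ^ downSteps μ k)⁻¹ := by
    rw [expMart]; ring
  have h4 : 0 < q ^ downSteps μ k := pow_pos hq.1 _
  rw [logMart, Real.log_div (by positivity) (by positivity), vershikCurve_eq, ← expTime_eq_exp hq.1,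
    h3, Real.log_mul h1.ne' (by positivity), Real.log_inv, Real.log_pow, boundaryPath_eq]
  nth_rewrite 1 [expTime_eq_exp hq.1]
  rw [Real.log_exp, rate]
  push_cast
  ring

theorem abs_deviation_sub_le (s t : ℝ) :
    |deviation q μ s - deviation q μ t| ≤ 2 * |s - t| := by
  have h1 := abs_boundary_sub_le μ (s / scale q) (t / scale q)
  have h2 := abs_vershikCurve_sub_le s t
  have h3 := scale_pos hq
  rw [← sub_div, abs_div, abs_of_pos h3, le_div_iff₀ h3] at h1
  have h4 : deviation q μ s - deviation q μ t =
      scale q * (boundary μ (s / scale q) - boundary μ (t / scale q)) -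
        (vershikCurve s - vershikCurve t) := by
    rw [deviation, deviation]; ring
  rw [h4]
  refine (abs_sub _ _).trans ?_
  rw [abs_mul, abs_of_pos h3]
  linarith

theorem deviation_lattice_sub_logMart (k : ℤ) :
    deviation q μ (scale q * k) - logMart q k μ = -((rate q - scale q) * boundaryPath μ k) +
      (vershikCurve (rate q * k) - vershikCurve (scale q * k)) := by
  have h3 := scale_pos hq
  rw [logMart_eq hq, deviation, mul_div_cancel_left₀ _ h3.ne', boundary_intCast]
  ring

theorem abs_deviation_sub_lattice_le (t : ℝ) :
    |deviation q μ t - deviation q μ (scale q * latticePos q t)| ≤ 2 * scale q := by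
  refine (abs_deviation_sub_le hq μ _ _).trans ?_
  have h1 := scale_mul_latticePos_le hq t
  have h2 := lt_scale_mul_latticePos hq t
  rw [abs_of_nonneg (by linarith)]
  linarith

/-- The deviation is the logarithm of the martingale, up to an error of order `scale q`. -/
theorem abs_deviation_sub_logMart_le (h2 : 1 / 2 ≤ q) {T t : ℝ} (ht : |t| ≤ T) :
    |deviation q μ t - logMart q (latticePos q t) μ| ≤
      scale q * (4 * |logMart q (latticePos q t) μ| + 12 * T + 18) := by
  have h3 := scale_pos hq
  set k := latticePos q t with hk
  have hkT : |scale q * k| ≤ T + 1 := abs_scale_mul_latticePos_le hq h2 ht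
  have e1 := abs_deviation_sub_lattice_le hq μ t
  have e2 := deviation_lattice_sub_logMart hq μ k
  have e3 := (abs_vershikCurve_sub_le (rate q * k) (scale q * k)).trans
    (abs_rate_mul_sub_le hq h2 hkT)
  have hX : (0 : ℝ) ≤ boundaryPath μ k := by
    have : 0 ≤ boundaryPath μ k := by rw [boundaryPath]; positivity
    exact_mod_cast this
  -- the path is not bounded; it is estimated by the martingale itself
  have e4 : |(rate q - scale q) * boundaryPath μ k| ≤
      scale q * (4 * (|logMart q k μ| + 2 * (T + 1) + 1)) := by
    have f1 := scale_le_rate hq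
    have f2 := rate_sub_scale_le hq
    have f3 := growth_le hq h2
    have f4 := growth_pos hq
    have f6 : 0 ≤ rate q := h3.le.trans f1
    rw [abs_of_nonneg (mul_nonneg (sub_nonneg.2 f1) hX)]
    have f5 : rate q * boundaryPath μ k ≤ |logMart q k μ| + 2 * (T + 1) + 1 := by
      have g1 := logMart_eq hq μ k
      have g2 := abs_vershikCurve_le (rate q * k)
      have g3 := abs_rate_mul_le hq h2 hkT
      linarith [le_abs_self (logMart q k μ), le_abs_self (vershikCurve (rate q * k))]
    calc (rate q - scale q) * boundaryPath μ k ≤ (scale q * growth q) * boundaryPath μ k := by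
          gcongr
      _ ≤ (rate q * (4 * scale q)) * boundaryPath μ k := by gcongr
      _ = scale q * (4 * (rate q * boundaryPath μ k)) := by ring
      _ ≤ _ := by gcongr
  have e5 : |deviation q μ (scale q * k) - logMart q k μ| ≤ _ :=
    (e2 ▸ abs_add_le _ _ : _ ≤ |-((rate q - scale q) * (boundaryPath μ k : ℝ))| +
      |vershikCurve (rate q * k) - vershikCurve (scale q * k)|)
  rw [abs_neg] at e5
  have e6 := abs_sub_le (deviation q μ t) (deviation q μ (scale q * k)) (logMart q k μ)
  linarith

/-- The increments of the deviation are those of the logarithm of the martingale, up to an error of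
order `scale q` that does not depend on the partition. -/
theorem abs_deviation_increment_sub_le (h2 : 1 / 2 ≤ q) {T s t : ℝ} (hs : |s| ≤ T)
    (ht : |t| ≤ T) :
    |(deviation q μ s - deviation q μ t) -
      (logMart q (latticePos q s) μ - logMart q (latticePos q t) μ)| ≤
      scale q * (16 * T + 20) := by
  have h3 := scale_pos hq
  set k := latticePos q s with hk
  set j := latticePos q t with hj
  have hkT : |scale q * k| ≤ T + 1 := abs_scale_mul_latticePos_le hq h2 hs
  have hjT : |scale q * j| ≤ T + 1 := abs_scale_mul_latticePos_le hq h2 ht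
  have e1 := abs_le.1 (abs_deviation_sub_lattice_le hq μ s)
  have e1' := abs_le.1 (abs_deviation_sub_lattice_le hq μ t)
  have e2 := deviation_lattice_sub_logMart hq μ k
  have e2' := deviation_lattice_sub_logMart hq μ j
  have e3 := abs_le.1 ((abs_vershikCurve_sub_le (rate q * k) (scale q * k)).trans
    (abs_rate_mul_sub_le hq h2 hkT))
  have e3' := abs_le.1 ((abs_vershikCurve_sub_le (rate q * j) (scale q * j)).trans
    (abs_rate_mul_sub_le hq h2 hjT))
  have e4 : |(rate q - scale q) * (boundaryPath μ k - boundaryPath μ j)| ≤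
      8 * (T + 1) * scale q := by
    have f1 := scale_le_rate hq
    have f2 := rate_sub_scale_le_sq hq h2
    have f3 := abs_boundary_sub_le μ k j
    rw [boundary_intCast, boundary_intCast] at f3
    rw [abs_mul, abs_of_nonneg (sub_nonneg.2 f1)]
    have f4 : scale q * |(k : ℝ) - j| ≤ 2 * (T + 1) := by
      have g1 : scale q * |(k : ℝ) - j| = |scale q * k - scale q * j| := by
        rw [← mul_sub, abs_mul, abs_of_pos h3]
      rw [g1]
      exact (abs_sub _ _).trans (by linarith)
    calc (rate q - scale q) * |(boundaryPath μ k - boundaryPath μ j : ℝ)|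
        ≤ 4 * scale q ^ 2 * |(k : ℝ) - j| := by gcongr
      _ = 4 * scale q * (scale q * |(k : ℝ) - j|) := by ring
      _ ≤ 4 * scale q * (2 * (T + 1)) := by gcongr
      _ = _ := by ring
  have e4 := abs_le.1 e4
  rw [abs_le]
  constructor <;> linarith [e1.1, e1.2, e1'.1, e1'.2, e3.1, e3.2, e3'.1, e3'.2, e4.1, e4.2]

end Comparison

/-! ### The logarithm of the martingale -/

theorem abs_log_sub_log_le {c u v : ℝ} (hc : 0 < c) (hu : c ≤ u) (hv : c ≤ v) :
    |Real.log u - Real.log v| ≤ |u - v| / c := by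
  have key : ∀ u v : ℝ, c ≤ u → c ≤ v → Real.log u - Real.log v ≤ |u - v| / c := by
    intro u v hu hv
    have hu0 := hc.trans_le hu
    have hv0 := hc.trans_le hv
    rw [← Real.log_div hu0.ne' hv0.ne']
    refine (Real.log_le_sub_one_of_pos (by positivity)).trans ?_
    rw [div_sub_one hv0.ne']
    calc (u - v) / v ≤ |u - v| / v := by gcongr; exact le_abs_self _
      _ ≤ _ := by gcongr
  rw [abs_le]
  constructor
  · have := key v u hv hu
    rw [abs_sub_comm] at this
    linarith
  · exact key u v hu hv

theorem abs_log_sub_sub_one_le {c u : ℝ} (hc : 0 < c) (hu : c ≤ u) :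
    |Real.log u - (u - 1)| ≤ (u - 1) ^ 2 / c := by
  have hu0 := hc.trans_le hu
  have h1 := Real.log_le_sub_one_of_pos hu0
  have h2 := Real.one_sub_inv_le_log_of_pos hu0
  rw [abs_of_nonpos (by linarith)]
  have h3 : (u - 1) - (1 - u⁻¹) = (u - 1) ^ 2 / u := by field_simp
  calc -(Real.log u - (u - 1)) ≤ (u - 1) ^ 2 / u := by rw [← h3]; linarith
    _ ≤ _ := by gcongr

section LogMart

variable {q : ℝ} (hq : q ∈ Ioo (0 : ℝ) 1) (μ : YoungDiagram) {B : ℝ} (hB : 0 < B)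
include hq hB

theorem inv_one_add_le {k : ℤ} (hk : B⁻¹ ≤ expTime q k) :
    (1 + B)⁻¹ ≤ (expMart q k μ + expTime q k) / (1 + expTime q k) := by
  have h1 := expTime_pos hq.1 k
  have h2 := expMart_nonneg hq k μ
  have h3 : 1 ≤ expTime q k * B := by
    rwa [inv_le_iff_one_le_mul₀ hB] at hk
  rw [inv_le_iff_one_le_mul₀ (by positivity), div_mul_eq_mul_div, one_le_div (by positivity)]
  nlinarith [mul_nonneg h2 hB.le]

theorem abs_logMart_le {k : ℤ} (hk : B⁻¹ ≤ expTime q k) :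
    |logMart q k μ| ≤ (1 + B) * |expMart q k μ - 1| := by
  have h1 := expTime_pos hq.1 k
  have h := abs_log_sub_log_le (by positivity) (inv_one_add_le hq μ hB hk)
    (inv_le_one_of_one_le₀ (by linarith : 1 ≤ 1 + B))
  rw [Real.log_one, sub_zero, div_inv_eq_mul, div_sub_one (by positivity), add_sub_add_right_eq_sub,
    abs_div, abs_of_pos (by positivity : 0 < 1 + expTime q k), mul_comm] at h
  refine h.trans ?_
  gcongr
  exact div_le_self (abs_nonneg _) (by linarith)

/-- Linearisation of the logarithm: the martingale enters the fluctuations with the weight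
`1 / (1 + expTime q k)`. -/
theorem abs_logMart_sub_linear_le {k : ℤ} (hk : B⁻¹ ≤ expTime q k) :
    |logMart q k μ - (expMart q k μ - 1) / (1 + expTime q k)| ≤
      (1 + B) * (expMart q k μ - 1) ^ 2 := by
  have h1 := expTime_pos hq.1 k
  have h := abs_log_sub_sub_one_le (by positivity) (inv_one_add_le hq μ hB hk)
  rw [div_inv_eq_mul, div_sub_one (by positivity), add_sub_add_right_eq_sub, mul_comm,
    div_pow] at h
  refine h.trans ?_
  gcongr
  exact div_le_self (sq_nonneg _) (one_le_pow₀ (by linarith))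

theorem abs_logMart_sub_logMart_le {j k : ℤ} (hj : B⁻¹ ≤ expTime q j) (hk : B⁻¹ ≤ expTime q k) :
    |logMart q k μ - logMart q j μ| ≤ (1 + B) * (|expMart q k μ - expMart q j μ| +
      |expMart q j μ - 1| * |expTime q k - expTime q j|) := by
  have h1 := expTime_pos hq.1 k
  have h1' := expTime_pos hq.1 j
  have h := abs_log_sub_log_le (by positivity) (inv_one_add_le hq μ hB hk)
    (inv_one_add_le hq μ hB hj)
  rw [div_inv_eq_mul, mul_comm] at h
  refine h.trans ?_
  gcongr
  have h2 : (expMart q k μ + expTime q k) / (1 + expTime q k) -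
      (expMart q j μ + expTime q j) / (1 + expTime q j) =
      (expMart q k μ - expMart q j μ) / (1 + expTime q k) -
      (expMart q j μ - 1) * (expTime q k - expTime q j) /
        ((1 + expTime q k) * (1 + expTime q j)) := by
    field_simp
    ring
  rw [h2]
  refine (abs_sub _ _).trans (add_le_add ?_ ?_)
  · rw [abs_div, abs_of_pos (by positivity : 0 < 1 + expTime q k)]
    exact div_le_self (abs_nonneg _) (by linarith)
  · rw [abs_div, abs_mul, abs_of_pos (by positivity :
      0 < (1 + expTime q k) * (1 + expTime q j))]
    exact div_le_self (by positivity) (by nlinarith)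

end LogMart

/-! ### Fourth moments of the fluctuations -/

theorem expect_martAlg_sub_one_pow_four_le (q : Ioo (0 : ℝ) 1) (ha : growth (q : ℝ) ≤ 1) {B : ℝ}
    (hB : 1 ≤ B) {k : ℤ} (hk : expTime (q : ℝ) k ≤ B) :
    expect q ((martAlg q k - 1) ^ 4) ≤ 11 * B ^ 3 * growth (q : ℝ) ^ 2 := by
  rw [expect_martAlg_sub_one_pow_four]
  have h1 := expTime_pos q.2.1 k
  have h2 := growth_pos q.2
  set a := growth (q : ℝ)
  set x := expTime (q : ℝ) k
  have h3 : 3 * x + a * (x ^ 2 + 5 * x + 1) + a ^ 2 * x ≤ 11 * B ^ 2 := by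
    have e1 : a * (x ^ 2 + 5 * x + 1) ≤ 1 * (B ^ 2 + 5 * B + 1) := by gcongr
    have e2 : a ^ 2 * x ≤ 1 * B := by
      gcongr
      exact pow_le_one₀ h2.le ha
    nlinarith
  calc a ^ 2 * x * (3 * x + a * (x ^ 2 + 5 * x + 1) + a ^ 2 * x)
      ≤ a ^ 2 * B * (11 * B ^ 2) := by gcongr
    _ = _ := by ring

/-- The fourth moment of an increment is at most of the order of the square of its variance. The
bound has no term of lower order, because `expTime` increases by at least `growth q * expTime q j`
if it increases at all. -/
theorem expect_martAlg_sub_pow_four_le (q : Ioo (0 : ℝ) 1) (ha : growth (q : ℝ) ≤ 1) {B : ℝ}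
    (hB : 1 ≤ B) {j k : ℤ} (hjk : j ≤ k) (hj : B⁻¹ ≤ expTime (q : ℝ) j)
    (hk : expTime (q : ℝ) k ≤ B) :
    expect q ((martAlg q k - martAlg q j) ^ 4) ≤
      14 * B ^ 3 * growth (q : ℝ) ^ 2 * (expTime (q : ℝ) k - expTime q j) ^ 2 := by
  rw [expect_martAlg_sub_pow_four q hjk]
  have h1 := expTime_pos q.2.1 k
  have h1' := expTime_pos q.2.1 j
  have h2 := growth_pos q.2
  rcases hjk.eq_or_lt with rfl | hlt
  · simp
  have h4 : growth (q : ℝ) * expTime q j ≤ expTime q k - expTime q j := by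
    have h5 := expTime_mono q.2 (show j + 1 ≤ k from hlt)
    rw [expTime_succ q.2.1] at h5
    linarith
  have h3 : expTime (q : ℝ) j ≤ expTime q k := expTime_mono q.2 hjk
  have h6 : 1 ≤ expTime (q : ℝ) j * B := by
    rwa [inv_le_iff_one_le_mul₀ (by linarith)] at hj
  set a := growth (q : ℝ)
  set x := expTime (q : ℝ) k
  set y := expTime (q : ℝ) j
  have h7 : a ≤ B * (x - y) := by
    nlinarith [mul_le_mul_of_nonneg_left h4 (by linarith : 0 ≤ B)]
  have hu : 0 ≤ x - y := sub_nonneg.2 h3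
  have hyB : y ≤ B := h3.trans hk
  have h8 : x ^ 2 + (5 - 3 * y) * x + 3 * y ^ 2 - 9 * y + 1 ≤ 10 * B ^ 2 := by
    nlinarith [mul_nonneg h1'.le (sub_nonneg.2 h3)]
  have h9 : 3 * (x - y) + a * (x ^ 2 + (5 - 3 * y) * x + 3 * y ^ 2 - 9 * y + 1) +
      a ^ 2 * (x - 3 * y) ≤ 14 * B ^ 3 * (x - y) := by
    have e1 : a * (x ^ 2 + (5 - 3 * y) * x + 3 * y ^ 2 - 9 * y + 1) ≤
        (B * (x - y)) * (10 * B ^ 2) :=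
      (mul_le_mul_of_nonneg_left h8 h2.le).trans (by gcongr)
    have e2 : a ^ 2 * (x - 3 * y) ≤ (B * (x - y)) * B := by
      calc a ^ 2 * (x - 3 * y) ≤ a ^ 2 * B := by gcongr; linarith
        _ ≤ a * B := by
          gcongr
          nlinarith
        _ ≤ _ := by gcongr
    have e3 : B * B ≤ B ^ 3 := by nlinarith [mul_nonneg (by linarith : 0 ≤ B) (sub_nonneg.2 hB)]
    have e4 : 1 ≤ B ^ 3 := one_le_pow₀ hB
    nlinarith [mul_le_mul_of_nonneg_right e3 hu, mul_le_mul_of_nonneg_right e4 hu]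
  calc a ^ 2 * (x - y) * _ ≤ a ^ 2 * (x - y) * (14 * B ^ 3 * (x - y)) := by gcongr
    _ = _ := by ring

/-- A bound for `expTime` at the lattice positions of `[-T, T]`. -/
noncomputable def timeBound (T : ℝ) : ℝ := Real.exp (4 * (T + 1))

theorem one_le_timeBound {T : ℝ} (hT : 0 ≤ T) : 1 ≤ timeBound T :=
  Real.one_le_exp (by linarith)

section Fluctuation

variable {q : ℝ} (hq : q ∈ Ioo (0 : ℝ) 1) (h2 : 1 / 2 ≤ q) {T : ℝ} (hT : 0 ≤ T)
include hq h2

theorem expTime_latticePos_mem_Icc {t : ℝ} (ht : |t| ≤ T) :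
    expTime q (latticePos q t) ∈ Icc (timeBound T)⁻¹ (timeBound T) :=
  expTime_mem_Icc hq h2 (abs_scale_mul_latticePos_le hq h2 ht)

theorem abs_deviation_le (μ : YoungDiagram) {t : ℝ} (ht : |t| ≤ T) :
    |deviation q μ t| ≤ 2 * (1 + timeBound T) * |expMart q (latticePos q t) μ - 1| +
      scale q * (12 * T + 18) := by
  have h1 := abs_deviation_sub_logMart_le hq μ h2 ht
  have h3 := abs_logMart_le hq μ (Real.exp_pos _) (expTime_latticePos_mem_Icc hq h2 ht).1
  have h4 := scale_le h2
  have h5 := abs_sub_abs_le_abs_sub (deviation q μ t) (logMart q (latticePos q t) μ)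
  rw [← timeBound] at h3
  nlinarith [abs_nonneg (logMart q (latticePos q t) μ)]

include hT in
/-- The increment of the deviation over `[t, s]` is controlled by the martingale at two lattice
positions. They are the ones below `t` and `s` if `s - t` exceeds the lattice spacing; otherwise
they coincide, and it is the Lipschitz continuity of the boundary that gives the bound. -/
theorem exists_abs_deviation_sub_le {s t : ℝ} (hs : |s| ≤ T) (ht : |t| ≤ T) (hts : t ≤ s) :
    ∃ j k : ℤ, j ≤ k ∧ (timeBound T)⁻¹ ≤ expTime q j ∧ expTime q j ≤ timeBound T ∧
      expTime q k ≤ timeBound T ∧ expTime q k - expTime q j ≤ 8 * timeBound T * (s - t) ∧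
      ∀ μ, |deviation q μ s - deviation q μ t| + (s - t) * |deviation q μ t| ≤
        ((1 + timeBound T) * (8 * timeBound T + 2) + (16 * T + 20) + 2 * T * (12 * T + 18)) *
          (|expMart q k μ - expMart q j μ| + (s - t) * |expMart q j μ - 1| +
            min (s - t) (scale q)) := by
  obtain ⟨hj1, hj2⟩ := expTime_latticePos_mem_Icc hq h2 ht
  obtain ⟨hk1, hk2⟩ := expTime_latticePos_mem_Icc hq h2 hs
  have hB := one_le_timeBound hT
  have hε := scale_pos hq
  have hε4 := scale_le h2
  set B := timeBound T
  have hh : 0 ≤ s - t := sub_nonneg.2 hts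
  have hh2 : s - t ≤ 2 * T := by linarith [(abs_le.1 hs).2, (abs_le.1 ht).1]
  set h := s - t with hdef
  rcases lt_or_ge h (scale q) with hlt | hge
  · refine ⟨latticePos q t, latticePos q t, le_rfl, hj1, hj2, hj2, ?_, fun μ => ?_⟩
    · rw [sub_self]
      positivity
    · have e1 := abs_deviation_sub_le hq μ s t
      have e2 := mul_le_mul_of_nonneg_left (abs_deviation_le hq h2 μ ht) hh
      rw [← hdef, abs_of_nonneg hh] at e1
      rw [min_eq_left hlt.le, sub_self, abs_zero, zero_add]
      set N := |expMart q (latticePos q t) μ - 1|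
      have hN : 0 ≤ h * N := by positivity
      have e3 : h * (scale q * (12 * T + 18)) ≤ h * (1 / 4 * (12 * T + 18)) := by gcongr
      have e4 : 0 ≤ h * T := by positivity
      have e5 : 0 ≤ h * (2 * T * (12 * T + 18)) := by positivity
      have e6 : 0 ≤ (1 + B) * (8 * B + 2) * h := by positivity
      have e7 : 0 ≤ ((1 + B) * (8 * B) + (16 * T + 20) + 2 * T * (12 * T + 18)) * (h * N) := by
        positivity
      nlinarith
  · have hjk : latticePos q t ≤ latticePos q s :=
      Int.floor_le_floor (by gcongr)
    have hu : expTime q (latticePos q s) - expTime q (latticePos q t) ≤ 8 * B * h := by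
      have e1 := expTime_sub_le hq h2 hjk
      have e2 := scale_mul_latticePos_le hq s
      have e3 := lt_scale_mul_latticePos hq t
      refine e1.trans ?_
      calc _ ≤ B * (4 * (2 * h)) := by
            gcongr
            · exact mul_nonneg (by norm_num) (sub_nonneg.2 (by gcongr))
            · linarith
        _ = _ := by ring
    refine ⟨latticePos q t, latticePos q s, hjk, hj1, hj2, hk2, hu, fun μ => ?_⟩
    have e1 := abs_deviation_increment_sub_le hq μ h2 hs ht
    have e2 := mul_le_mul_of_nonneg_left (abs_deviation_le hq h2 μ ht) hh
    have e3 := abs_logMart_sub_logMart_le hq μ (by linarith : 0 < B) hj1 hk1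
    have e4 := abs_sub_abs_le_abs_sub (deviation q μ s - deviation q μ t)
      (logMart q (latticePos q s) μ - logMart q (latticePos q t) μ)
    rw [abs_of_nonneg (sub_nonneg.2 (expTime_mono hq hjk))] at e3
    rw [min_eq_right hge]
    set N := |expMart q (latticePos q t) μ - 1|
    set Δ := |expMart q (latticePos q s) μ - expMart q (latticePos q t) μ|
    have hN : 0 ≤ N := abs_nonneg _
    have hΔ : 0 ≤ Δ := abs_nonneg _
    have e5 : (1 + B) * (Δ + N * (expTime q (latticePos q s) - expTime q (latticePos q t))) ≤
        (1 + B) * (Δ + N * (8 * B * h)) := by gcongr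
    have e6 : h * (scale q * (12 * T + 18)) ≤ 2 * T * (scale q * (12 * T + 18)) := by gcongr
    have f1 : 0 ≤ ((1 + B) * (8 * B + 1) + (16 * T + 20) + 2 * T * (12 * T + 18)) * Δ := by
      positivity
    have f2 : 0 ≤ ((16 * T + 20) + 2 * T * (12 * T + 18)) * (h * N) := by positivity
    have f3 : 0 ≤ (1 + B) * (8 * B + 2) * scale q := by positivity
    linarith

end Fluctuation

theorem cosh_le_exp_abs (t : ℝ) : Real.cosh t ≤ Real.exp |t| := by
  rw [← Real.cosh_abs, Real.cosh_eq]
  have := Real.exp_le_exp.2 (by linarith [abs_nonneg t] : -|t| ≤ |t|)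
  linarith

theorem abs_cosh_sub_cosh_le {T s t : ℝ} (hs : |s| ≤ T) (ht : |t| ≤ T) :
    |Real.cosh s - Real.cosh t| ≤ Real.exp T * |s - t| := by
  refine (convex_Icc (-T) T).norm_image_sub_le_of_norm_deriv_le
    (fun x _ => Real.differentiable_cosh x) (fun x hx => ?_) (abs_le.1 ht) (abs_le.1 hs)
  rw [Real.deriv_cosh, Real.norm_eq_abs, abs_le]
  have h1 := Real.sinh_lt_cosh x
  have h2 := (cosh_le_exp_abs x).trans (Real.exp_le_exp.2 (abs_le.2 hx))
  have h3 := Real.exp_pos (-x)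
  have h4 := Real.cosh_add_sinh x
  have h5 := Real.exp_pos x
  constructor <;> linarith

theorem fluctuation_apply (q : ℝ) (μ : YoungDiagram) (t : ℝ) :
    fluctuation q μ t = √2 * Real.cosh t / √(scale q) * deviation q μ t := rfl

theorem abs_fluctuation_le {q : ℝ} (μ : YoungDiagram) {T t : ℝ} (ht : |t| ≤ T) :
    |fluctuation q μ t| ≤ 2 * Real.exp T / √(scale q) * |deviation q μ t| := by
  have h1 := (cosh_le_exp_abs t).trans (Real.exp_le_exp.2 ht)
  have h2 := (Real.cosh_pos t).le
  have h3 : √2 ≤ 2 := Real.sqrt_le_iff.2 ⟨by norm_num, by norm_num⟩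
  rw [fluctuation_apply, abs_mul, abs_of_nonneg (by positivity)]
  gcongr

theorem abs_fluctuation_sub_le {q : ℝ} (μ : YoungDiagram) {T s t : ℝ} (hs : |s| ≤ T)
    (ht : |t| ≤ T) :
    |fluctuation q μ s - fluctuation q μ t| ≤ 2 * Real.exp T / √(scale q) *
      (|deviation q μ s - deviation q μ t| + |s - t| * |deviation q μ t|) := by
  have h1 := (cosh_le_exp_abs s).trans (Real.exp_le_exp.2 hs)
  have h2 := (Real.cosh_pos s).le
  have h3 : √2 ≤ 2 := Real.sqrt_le_iff.2 ⟨by norm_num, by norm_num⟩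
  have h4 := abs_cosh_sub_cosh_le hs ht
  have h5 : fluctuation q μ s - fluctuation q μ t = √2 / √(scale q) *
      (Real.cosh s * (deviation q μ s - deviation q μ t) +
        (Real.cosh s - Real.cosh t) * deviation q μ t) := by
    rw [fluctuation_apply, fluctuation_apply]
    ring
  rw [h5, abs_mul, abs_of_nonneg (by positivity : 0 ≤ √2 / √(scale q))]
  calc _ ≤ √2 / √(scale q) * (Real.exp T * |deviation q μ s - deviation q μ t| +
        (Real.exp T * |s - t|) * |deviation q μ t|) := by
        gcongr
        refine (abs_add_le _ _).trans ?_
        rw [abs_mul, abs_mul, abs_of_nonneg h2]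
        gcongr
    _ = √2 * Real.exp T / √(scale q) *
      (|deviation q μ s - deviation q μ t| + |s - t| * |deviation q μ t|) := by ring
    _ ≤ _ := by gcongr

theorem add_pow_four_le (a b c : ℝ) : (a + b + c) ^ 4 ≤ 27 * (a ^ 4 + b ^ 4 + c ^ 4) := by
  have h1 : (a + b + c) ^ 2 ≤ 3 * (a ^ 2 + b ^ 2 + c ^ 2) := by
    nlinarith [sq_nonneg (a - b), sq_nonneg (b - c), sq_nonneg (a - c)]
  have h2 : (a ^ 2 + b ^ 2 + c ^ 2) ^ 2 ≤ 3 * (a ^ 4 + b ^ 4 + c ^ 4) := by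
    nlinarith [sq_nonneg (a ^ 2 - b ^ 2), sq_nonneg (b ^ 2 - c ^ 2), sq_nonneg (a ^ 2 - c ^ 2)]
  calc (a + b + c) ^ 4 = ((a + b + c) ^ 2) ^ 2 := by ring
    _ ≤ (3 * (a ^ 2 + b ^ 2 + c ^ 2)) ^ 2 := by gcongr
    _ = 9 * (a ^ 2 + b ^ 2 + c ^ 2) ^ 2 := by ring
    _ ≤ _ := by linarith

/-- Markov's inequality for a fourth moment. -/
theorem measure_lt_abs_le {Ω : Type*} [MeasurableSpace Ω] (P : Measure Ω) [IsFiniteMeasure P]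
    {X Y : Ω → ℝ} (hXY : ∀ ω, |X ω| ≤ Y ω) (hY : Integrable (fun ω => Y ω ^ 4) P) {a V : ℝ}
    (ha : 0 < a) (hV : ∫ ω, Y ω ^ 4 ∂P ≤ V) :
    P {ω | a < |X ω|} ≤ ENNReal.ofReal (V / a ^ 4) := by
  have h1 := mul_meas_ge_le_integral_of_nonneg (.of_forall fun ω => by positivity) hY (a ^ 4)
  have h2 : P {ω | a < |X ω|} ≤ P {ω | a ^ 4 ≤ Y ω ^ 4} :=
    measure_mono fun ω hω => pow_le_pow_left₀ ha.le (hω.le.trans (hXY ω)) 4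
  refine h2.trans ?_
  rw [← ofReal_measureReal]
  apply ENNReal.ofReal_le_ofReal
  rw [le_div_iff₀' (by positivity)]
  exact h1.trans hV

/-- Kolmogorov's moment condition, uniformly in `q`. -/
theorem exists_measure_fluctuation_sub_le {T : ℝ} (hT : 0 ≤ T) :
    ∃ C : ℝ, ∀ q : Ioo (0 : ℝ) 1, 1 / 2 ≤ (q : ℝ) → ∀ s ∈ Icc (-T) T, ∀ t ∈ Icc (-T) T,
      ∀ a > 0, partitionLaw q {μ | a < |fluctuation q μ s - fluctuation q μ t|} ≤
        ENNReal.ofReal (C * |s - t| ^ 2 / a ^ 4) := by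
  set B := timeBound T with hBdef
  set C₁ := (1 + B) * (8 * B + 2) + (16 * T + 20) + 2 * T * (12 * T + 18)
  set C₂ := 27 * (14 * B ^ 3 * 16 * (8 * B) ^ 2 + 11 * B ^ 3 * 16 * (2 * T) ^ 2 + 1)
  refine ⟨(2 * Real.exp T * C₁) ^ 4 * C₂, fun q h2 s hs t ht a ha => ?_⟩
  wlog hts : t ≤ s generalizing s t
  · have := this t ht s hs (not_le.1 hts).le
    simpa only [abs_sub_comm] using this
  have hB : 1 ≤ B := one_le_timeBound hT
  have hs' := abs_le.2 hs
  have ht' := abs_le.2 ht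
  obtain ⟨j, k, hjk, hj, hj', hk, hu, hdev⟩ := exists_abs_deviation_sub_le q.2 h2 hT hs' ht' hts
  have hh : 0 ≤ s - t := sub_nonneg.2 hts
  have hh2 : s - t ≤ 2 * T := by linarith [hs.2, ht.1]
  rw [abs_of_nonneg hh]
  set h := s - t with hdef
  set ε := scale (q : ℝ) with hε
  have hε0 : 0 < ε := scale_pos q.2
  have ha1 := growth_le_one q.2 h2
  have ha4 : growth (q : ℝ) ≤ 4 * ε := growth_le q.2 h2
  have ha0 := growth_pos q.2
  set G : YoungDiagram → ℝ := fun μ =>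
    |expMart (q : ℝ) k μ - expMart q j μ| + h * |expMart q j μ - 1| + min h ε
  set c := 2 * Real.exp T / √ε * C₁ with hc
  have hmin : 0 ≤ min h ε := le_min hh hε0.le
  have hG0 : ∀ μ, 0 ≤ G μ := fun μ => by positivity
  have hXY : ∀ μ, |fluctuation q μ s - fluctuation q μ t| ≤ c * G μ := by
    intro μ
    refine (abs_fluctuation_sub_le μ hs' ht').trans ?_
    rw [abs_of_nonneg hh, hc, mul_assoc]
    gcongr
    exact hdev μ
  have hI1 : Integrable (fun μ => (expMart (q : ℝ) k μ - expMart q j μ) ^ 4) (partitionLaw q) :=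
    (((moderate_expMart q.2 k).sub q.2 (moderate_expMart q.2 j)).pow q.2 4).integrable
  have hI2 : Integrable (fun μ => (expMart (q : ℝ) j μ - 1) ^ 4) (partitionLaw q) :=
    Moderate.integrable q ((martAlg q j - 1) ^ 4).2
  have hE1 : ∫ μ, (expMart (q : ℝ) k μ - expMart q j μ) ^ 4 ∂(partitionLaw q) ≤ _ :=
    expect_martAlg_sub_pow_four_le q ha1 hB hjk hj hk
  have hE2 : ∫ μ, (expMart (q : ℝ) j μ - 1) ^ 4 ∂(partitionLaw q) ≤ _ :=
    expect_martAlg_sub_one_pow_four_le q ha1 hB hj'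
  have hGle : ∀ μ, G μ ^ 4 ≤ 27 * ((expMart (q : ℝ) k μ - expMart q j μ) ^ 4 +
      h ^ 4 * (expMart (q : ℝ) j μ - 1) ^ 4 + (min h ε) ^ 4) := by
    intro μ
    refine (add_pow_four_le _ _ _).trans (le_of_eq ?_)
    rw [mul_pow, Even.pow_abs (by decide), Even.pow_abs (by decide)]
  have hI12 : Integrable (fun μ => (expMart (q : ℝ) k μ - expMart q j μ) ^ 4 +
      h ^ 4 * (expMart (q : ℝ) j μ - 1) ^ 4) (partitionLaw q) := hI1.add (hI2.const_mul (h ^ 4))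
  have hIb : Integrable (fun μ => 27 * ((expMart (q : ℝ) k μ - expMart q j μ) ^ 4 +
      h ^ 4 * (expMart (q : ℝ) j μ - 1) ^ 4 + (min h ε) ^ 4)) (partitionLaw q) :=
    (hI12.add (integrable_const _)).const_mul 27
  have hIG : Integrable (fun μ => G μ ^ 4) (partitionLaw q) := by
    refine hIb.mono' .of_discrete (.of_forall fun μ => ?_)
    rw [Real.norm_of_nonneg (by have := hG0 μ; positivity)]
    exact hGle μ
  have hEG : ∫ μ, G μ ^ 4 ∂(partitionLaw q) ≤ C₂ * (ε ^ 2 * h ^ 2) := by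
    refine (integral_mono hIG hIb hGle).trans ?_
    rw [integral_const_mul, integral_add hI12 (integrable_const _),
      integral_add hI1 (hI2.const_mul _), integral_const_mul, integral_const]
    simp only [probReal_univ, one_smul]
    have e1 : 14 * B ^ 3 * growth (q : ℝ) ^ 2 * (expTime (q : ℝ) k - expTime q j) ^ 2 ≤
        14 * B ^ 3 * (4 * ε) ^ 2 * (8 * B * h) ^ 2 := by
      have := sub_nonneg.2 (expTime_mono q.2 hjk)
      gcongr
    have e2 : h ^ 4 * (11 * B ^ 3 * growth (q : ℝ) ^ 2) ≤
        h ^ 2 * (2 * T) ^ 2 * (11 * B ^ 3 * (4 * ε) ^ 2) := by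
      rw [show h ^ 4 = h ^ 2 * h ^ 2 by ring]
      gcongr
    have e3 : (min h ε) ^ 4 ≤ ε ^ 2 * h ^ 2 := by
      rw [show (min h ε) ^ 4 = (min h ε) ^ 2 * (min h ε) ^ 2 by ring]
      gcongr
      · exact min_le_right _ _
      · exact min_le_left _ _
    have e4 := mul_le_mul_of_nonneg_left hE2 (by positivity : 0 ≤ h ^ 4)
    calc _ ≤ 27 * (14 * B ^ 3 * (4 * ε) ^ 2 * (8 * B * h) ^ 2 +
          h ^ 2 * (2 * T) ^ 2 * (11 * B ^ 3 * (4 * ε) ^ 2) + ε ^ 2 * h ^ 2) := by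
          linarith
      _ = _ := by ring
  refine measure_lt_abs_le _ hXY (by simpa only [mul_pow] using hIG.const_mul (c ^ 4)) ha ?_
  simp only [mul_pow]
  rw [integral_const_mul]
  calc c ^ 4 * ∫ μ, G μ ^ 4 ∂(partitionLaw q) ≤ c ^ 4 * (C₂ * (ε ^ 2 * h ^ 2)) := by gcongr
    _ = _ := by
      have e : √ε ^ 4 = ε ^ 2 := by
        rw [show √ε ^ 4 = (√ε ^ 2) ^ 2 by ring, Real.sq_sqrt hε0.le]
      rw [hc, div_mul_eq_mul_div, div_pow, e]
      field_simp

/-- The first absolute moment of the fluctuation at `0` is bounded, uniformly in `q`. -/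
theorem integral_abs_fluctuation_zero_le (q : Ioo (0 : ℝ) 1) (h2 : 1 / 2 ≤ (q : ℝ)) :
    Integrable (fun μ => |fluctuation q μ 0|) (partitionLaw q) ∧
    ∫ μ, |fluctuation q μ 0| ∂(partitionLaw q) ≤
      2 * (2 * (1 + timeBound 0) * (2 * √(timeBound 0)) + 18) := by
  have hε0 := scale_pos q.2
  have hε4 := scale_le h2
  set B := timeBound 0
  set k := latticePos (q : ℝ) 0
  have hs := Real.sqrt_pos.2 hε0
  have hB : 0 < B := Real.exp_pos _
  have hle : ∀ μ, |fluctuation q μ 0| ≤ 2 / √(scale q) * (2 * (1 + B) * |expMart q k μ - 1| +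
      scale q * 18) := by
    intro μ
    refine (abs_fluctuation_le μ abs_zero.le).trans ?_
    rw [Real.exp_zero, mul_one]
    gcongr
    simpa using abs_deviation_le q.2 h2 μ abs_zero.le
  have hI0 : Integrable (fun μ => |expMart (q : ℝ) k μ - 1|) (partitionLaw q) :=
    (Moderate.integrable q (martAlg q k - 1).2).abs
  have hI : Integrable (fun μ => 2 / √(scale q) * (2 * (1 + B) * |expMart q k μ - 1| +
      scale q * 18)) (partitionLaw q) :=
    ((hI0.const_mul _).add (integrable_const _)).const_mul _
  have hIF : Integrable (fun μ => |fluctuation q μ 0|) (partitionLaw q) := by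
    refine hI.mono' .of_discrete (.of_forall fun μ => ?_)
    rw [Real.norm_of_nonneg (abs_nonneg _)]
    exact hle μ
  refine ⟨hIF, (integral_mono hIF hI hle).trans ?_⟩
  rw [integral_const_mul, integral_add (hI0.const_mul _) (integrable_const _), integral_const_mul,
    integral_const]
  simp only [probReal_univ, one_smul]
  have e1 : ∫ μ, |expMart (q : ℝ) k μ - 1| ∂(partitionLaw q) ≤ √(scale q) * (2 * √B) := by
    refine (integral_abs_expMart_sub_one_le q k).trans ?_
    have e2 : growth (q : ℝ) * expTime q k ≤ (4 * scale q) * B := by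
      gcongr
      · exact (expTime_pos q.2.1 k).le
      · exact growth_le q.2 h2
      · exact (expTime_latticePos_mem_Icc q.2 h2 abs_zero.le).2
    refine (Real.sqrt_le_sqrt e2).trans (le_of_eq ?_)
    rw [Real.sqrt_mul (by positivity), Real.sqrt_mul (by norm_num),
      show (4 : ℝ) = 2 ^ 2 by norm_num, Real.sqrt_sq (by norm_num)]
    ring
  have e3 : scale (q : ℝ) * 18 ≤ √(scale q) * 18 := by
    have : scale (q : ℝ) = √(scale q) * √(scale q) := (Real.mul_self_sqrt hε0.le).symm
    have h1 : √(scale (q : ℝ)) ≤ 1 := Real.sqrt_le_one.2 (by linarith)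
    nlinarith
  calc _ ≤ 2 / √(scale q) * (2 * (1 + B) * (√(scale q) * (2 * √B)) + √(scale q) * 18) := by
        gcongr
    _ = _ := by
      field_simp

/-! ### Finite-dimensional distributions -/

/-- The filter `q → 1⁻` on the open unit interval. -/
def nearOne : Filter (Ioo (0 : ℝ) 1) := comap Subtype.val (𝓝[<] 1)

instance : nearOne.NeBot := by
  refine comap_neBot fun s hs => ?_
  obtain ⟨x, hx, hxs⟩ := Filter.nonempty_of_mem
    (inter_mem (Ioo_mem_nhdsLT (zero_lt_one (α := ℝ))) hs)
  exact ⟨⟨x, hx⟩, hxs⟩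

theorem tendsto_val_nearOne : Tendsto (fun q : Ioo (0 : ℝ) 1 => (q : ℝ)) nearOne (𝓝 1) :=
  tendsto_comap.mono_right inf_le_left

theorem eventually_half_le_nearOne : ∀ᶠ q : Ioo (0 : ℝ) 1 in nearOne, 1 / 2 ≤ (q : ℝ) :=
  tendsto_val_nearOne.eventually (Ici_mem_nhds (by norm_num : (1 / 2 : ℝ) < 1))

theorem tendsto_scale_nearOne :
    Tendsto (fun q : Ioo (0 : ℝ) 1 => scale (q : ℝ)) nearOne (𝓝 0) := by
  have := (tendsto_val_nearOne.const_sub 1).div_const 2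
  rwa [sub_self, zero_div] at this

theorem tendsto_growth_nearOne :
    Tendsto (fun q : Ioo (0 : ℝ) 1 => growth (q : ℝ)) nearOne (𝓝 0) := by
  have := (tendsto_val_nearOne.const_sub 1).div tendsto_val_nearOne one_ne_zero
  rwa [sub_self, zero_div] at this

theorem tendsto_expTime_latticePos (t : ℝ) :
    Tendsto (fun q : Ioo (0 : ℝ) 1 => expTime (q : ℝ) (latticePos q t)) nearOne
      (𝓝 (Real.exp (2 * t))) := by
  have h : Tendsto (fun q : Ioo (0 : ℝ) 1 => rate (q : ℝ) * latticePos q t) nearOne (𝓝 t) := by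
    rw [tendsto_iff_dist_tendsto_zero]
    refine squeeze_zero' (.of_forall fun _ => dist_nonneg)
      (eventually_half_le_nearOne.mono fun q h2 => ?_)
      (g := fun q : Ioo (0 : ℝ) 1 => (4 * (|t| + 1) + 1) * scale (q : ℝ))
      (by simpa using tendsto_scale_nearOne.const_mul (4 * (|t| + 1) + 1))
    have h1 := abs_rate_mul_sub_le q.2 h2 (abs_scale_mul_latticePos_le q.2 h2 (le_refl |t|))
    have h3 := scale_mul_latticePos_le q.2 t
    have h4 := lt_scale_mul_latticePos q.2 t
    rw [Real.dist_eq]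
    rw [abs_le] at h1 ⊢
    constructor <;> linarith [h1.1, h1.2]
  refine ((Real.continuous_exp.tendsto _).comp (h.const_mul 2)).congr fun q => ?_
  exact (expTime_eq_exp q.2.1 _).symm

/-- The factor between the linearised fluctuation at `t` and the normalised martingale. -/
noncomputable def linearFactor (q t : ℝ) : ℝ :=
  √2 * Real.cosh t / √(scale q) * (√(growth q) / (1 + expTime q (latticePos q t)))

/-- The limit is `2 cosh t / (1 + e ^ (2 t)) = e ^ (-t)`, since `growth q / scale q → 2`. -/
theorem tendsto_linearFactor (t : ℝ) :
    Tendsto (fun q : Ioo (0 : ℝ) 1 => linearFactor q t) nearOne (𝓝 (Real.exp (-t))) := by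
  have h1 : Tendsto (fun q : Ioo (0 : ℝ) 1 => √2 * Real.cosh t * √(2 / (q : ℝ)) /
      (1 + expTime (q : ℝ) (latticePos q t))) nearOne
      (𝓝 (√2 * Real.cosh t * √(2 / 1) / (1 + Real.exp (2 * t)))) :=
    (((tendsto_const_nhds.div tendsto_val_nearOne one_ne_zero).sqrt).const_mul _).div
      ((tendsto_expTime_latticePos t).const_add 1) (by positivity)
  have h2 : √2 * Real.cosh t * √(2 / 1) / (1 + Real.exp (2 * t)) = Real.exp (-t) := by
    have e1 : √(2 : ℝ) * √2 = 2 := Real.mul_self_sqrt (by norm_num)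
    have e2 : Real.exp (2 * t) = Real.exp t * Real.exp t := by rw [← Real.exp_add]; ring_nf
    have e3 : Real.exp t * Real.exp (-t) = 1 := by rw [← Real.exp_add]; simp
    rw [div_one, mul_right_comm, e1, Real.cosh_eq, div_eq_iff (by positivity), e2]
    linear_combination -Real.exp t * e3
  rw [h2] at h1
  refine h1.congr fun q => ?_
  have h3 := scale_pos q.2
  have h4 : growth (q : ℝ) = scale q * (2 / q) := by rw [growth_eq]; ring
  have h5 := Real.sqrt_pos.2 h3
  have h6 := expTime_pos q.2.1 (latticePos q t)
  rw [linearFactor, h4, Real.sqrt_mul h3.le]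
  field_simp

theorem integrable_expMart_sub_one (q : Ioo (0 : ℝ) 1) (k : ℤ) :
    Integrable (fun μ => expMart (q : ℝ) k μ - 1) (partitionLaw q) :=
  ((moderate_expMart q.2 k).sub q.2 (.const 1)).integrable

theorem integral_abs_normMart_le (q : Ioo (0 : ℝ) 1) (k : ℤ) :
    ∫ μ, |normMart (q : ℝ) k μ| ∂(partitionLaw q) ≤ √(expTime q k) := by
  have h1 := Real.sqrt_pos.2 (growth_pos q.2)
  have h2 := integral_abs_expMart_sub_one_le q k
  rw [Real.sqrt_mul (growth_pos q.2).le] at h2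
  simp only [normMart, abs_div, abs_of_pos h1]
  rw [integral_div, div_le_iff₀' h1]
  exact h2

/-- The fluctuation at `t` is close in `L¹` to the normalised martingale at time `e ^ (2 t)`
multiplied by `e ^ (-t)`. -/
theorem integral_abs_fluctuation_sub_le (q : Ioo (0 : ℝ) 1) (h2 : 1 / 2 ≤ (q : ℝ)) {T t : ℝ}
    (hT : 0 ≤ T) (ht : |t| ≤ T) :
    Integrable (fun μ => |fluctuation q μ t - Real.exp (-t) * normMart q (latticePos q t) μ|)
      (partitionLaw q) ∧
    ∫ μ, |fluctuation q μ t - Real.exp (-t) * normMart q (latticePos q t) μ| ∂(partitionLaw q) ≤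
      2 * Real.exp T * √(scale q) * (4 * (1 + timeBound T) * (2 * √(timeBound T)) + 12 * T + 18 +
        4 * timeBound T * (1 + timeBound T)) +
        |linearFactor q t - Real.exp (-t)| * √(timeBound T) := by
  obtain ⟨hQ1, hQ2⟩ := expTime_latticePos_mem_Icc q.2 h2 ht
  have hB := one_le_timeBound hT
  have hε0 := scale_pos q.2
  have hε4 := scale_le h2
  have ha0 := growth_pos q.2
  have ha4 := growth_le q.2 h2
  have hQ := expTime_pos q.2.1 (latticePos q t)
  set B := timeBound T
  set k := latticePos (q : ℝ) t with hk
  set ε := scale (q : ℝ) with hε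
  set δ := |linearFactor q t - Real.exp (-t)|
  have hs := Real.sqrt_pos.2 hε0
  have hsa := Real.sqrt_pos.2 ha0
  have hle : ∀ μ, |fluctuation q μ t - Real.exp (-t) * normMart q k μ| ≤
      2 * Real.exp T / √ε * (ε * (4 * (1 + B) * |expMart q k μ - 1| + (12 * T + 18)) +
        (1 + B) * (expMart q k μ - 1) ^ 2) + δ * |normMart q k μ| := by
    intro μ
    have e1 : fluctuation q μ t - Real.exp (-t) * normMart q k μ =
        √2 * Real.cosh t / √ε * (deviation q μ t - (expMart q k μ - 1) / (1 + expTime q k)) +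
          (linearFactor q t - Real.exp (-t)) * normMart q k μ := by
      rw [fluctuation_apply, linearFactor, normMart, ← hk, ← hε]
      field_simp
      ring
    have e2 := abs_deviation_sub_logMart_le q.2 μ h2 ht
    have e3 := abs_logMart_sub_linear_le q.2 μ (by linarith : 0 < B) hQ1
    have e4 := abs_logMart_le q.2 μ (by linarith : 0 < B) hQ1
    have e5 := abs_sub_le (deviation q μ t) (logMart q k μ)
      ((expMart q k μ - 1) / (1 + expTime q k))
    have h1 := (cosh_le_exp_abs t).trans (Real.exp_le_exp.2 ht)
    have hc := (Real.cosh_pos t).le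
    have h3 : √2 ≤ 2 := Real.sqrt_le_iff.2 ⟨by norm_num, by norm_num⟩
    rw [e1]
    refine (abs_add_le _ _).trans ?_
    rw [abs_mul, abs_mul, abs_of_nonneg (by positivity : 0 ≤ √2 * Real.cosh t / √ε)]
    gcongr
    refine e5.trans (add_le_add (e2.trans ?_) e3)
    rw [← hk, ← hε, add_assoc, mul_assoc 4]
    gcongr
  have hIp := integrable_expMart_sub_one q k
  have hIp2 : Integrable (fun μ => (expMart (q : ℝ) k μ - 1) ^ 2) (partitionLaw q) :=
    (((moderate_expMart q.2 k).sub q.2 (.const 1)).pow q.2 2).integrable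
  have hIW : Integrable (fun μ => |normMart (q : ℝ) k μ|) (partitionLaw q) :=
    (hIp.div_const _).abs
  have hI1 : Integrable (fun μ => 4 * (1 + B) * |expMart (q : ℝ) k μ - 1| + (12 * T + 18))
      (partitionLaw q) := (hIp.abs.const_mul _).add (integrable_const _)
  have hI2 : Integrable (fun μ => ε * (4 * (1 + B) * |expMart (q : ℝ) k μ - 1| + (12 * T + 18)) +
      (1 + B) * (expMart (q : ℝ) k μ - 1) ^ 2) (partitionLaw q) :=
    (hI1.const_mul _).add (hIp2.const_mul _)
  have hI3 := (hI2.const_mul (2 * Real.exp T / √ε)).add (hIW.const_mul δ)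
  have hIF : Integrable (fun μ => |fluctuation q μ t - Real.exp (-t) * normMart q k μ|)
      (partitionLaw q) := by
    refine hI3.mono' .of_discrete (.of_forall fun μ => ?_)
    rw [Real.norm_of_nonneg (abs_nonneg _)]
    exact hle μ
  refine ⟨hIF, (integral_mono hIF hI3 hle).trans ?_⟩
  rw [integral_add' (hI2.const_mul _) (hIW.const_mul _), integral_const_mul, integral_const_mul,
    integral_add (hI1.const_mul _) (hIp2.const_mul _), integral_const_mul, integral_const_mul,
    integral_add (hIp.abs.const_mul _) (integrable_const _), integral_const_mul, integral_const]
  simp only [probReal_univ, one_smul]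
  have g1 : growth (q : ℝ) * expTime q k ≤ (4 * ε) * B := by gcongr
  have g2 : ∫ μ, |expMart (q : ℝ) k μ - 1| ∂(partitionLaw q) ≤ 2 * √B := by
    refine (integral_abs_expMart_sub_one_le q k).trans ?_
    calc √(growth q * expTime q k) ≤ √(2 ^ 2 * B) := Real.sqrt_le_sqrt (by nlinarith)
      _ = _ := by rw [Real.sqrt_mul (by norm_num), Real.sqrt_sq (by norm_num)]
  have g3 : ∫ μ, (expMart (q : ℝ) k μ - 1) ^ 2 ∂(partitionLaw q) ≤ 4 * ε * B :=
    (expect_martAlg_sub_one_sq q k).le.trans g1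
  have g4 := (integral_abs_normMart_le q k).trans (Real.sqrt_le_sqrt hQ2)
  calc _ ≤ 2 * Real.exp T / √ε * (ε * (4 * (1 + B) * (2 * √B) + (12 * T + 18)) +
        (1 + B) * (4 * ε * B)) + δ * √B := by gcongr
    _ = 2 * Real.exp T * (ε / √ε) * (4 * (1 + B) * (2 * √B) + 12 * T + 18 +
        4 * B * (1 + B)) + δ * √B := by ring
    _ = _ := by rw [Real.div_sqrt]

theorem tendsto_integral_abs_fluctuation_sub (t : ℝ) :
    Tendsto (fun q : Ioo (0 : ℝ) 1 => ∫ μ, |fluctuation q μ t -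
      Real.exp (-t) * normMart q (latticePos q t) μ| ∂(partitionLaw q)) nearOne (𝓝 0) := by
  refine squeeze_zero' (.of_forall fun q => integral_nonneg fun μ => abs_nonneg _)
    (eventually_half_le_nearOne.mono fun q h2 =>
      (integral_abs_fluctuation_sub_le q h2 (abs_nonneg t) le_rfl).2) ?_
  have h1 : Tendsto (fun q : Ioo (0 : ℝ) 1 => √(scale (q : ℝ))) nearOne (𝓝 0) := by
    simpa using tendsto_scale_nearOne.sqrt
  have h2 : Tendsto (fun q : Ioo (0 : ℝ) 1 => |linearFactor q t - Real.exp (-t)|) nearOne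
      (𝓝 0) := by
    simpa using ((tendsto_linearFactor t).sub_const (Real.exp (-t))).abs
  simpa using ((h1.const_mul (2 * Real.exp |t|)).mul_const _).add (h2.mul_const _)

/-- Lattice positions respect minima, which turns minima of positions into minima of macroscopic
times. -/
theorem latticePos_min {q : ℝ} (hq : q ∈ Ioo (0 : ℝ) 1) (s t : ℝ) :
    min (latticePos q s) (latticePos q t) = latticePos q (min s t) := by
  have hm : Monotone (latticePos q) := fun s t h => by
    have := scale_pos hq
    exact Int.floor_le_floor (by gcongr)
  exact (hm.map_min).symm

section Marginals

variable (w : ℝ →₀ ℝ)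

/-- The coefficients of the normalised martingale in the limit of `evalSum w (fluctuation q μ)`. -/
noncomputable def martCoeff (t : w.support) : ℝ := w t * Real.exp (-t)

/-- A number `T` such that `w` is supported in `[-T, T]`. -/
noncomputable def supportBound : ℝ := ∑ t ∈ w.support, |t|

theorem supportBound_nonneg : 0 ≤ supportBound w := Finset.sum_nonneg fun _ _ => abs_nonneg _

theorem abs_le_supportBound (t : w.support) : |(t : ℝ)| ≤ supportBound w :=
  Finset.single_le_sum (f := fun t : ℝ => |t|) (fun _ _ => abs_nonneg _) t.2

/-- The limit is the covariance of `e ^ (-t) W(e ^ (2 t))` for a Brownian motion `W`, which is that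
of the stationary Ornstein–Uhlenbeck process. -/
theorem tendsto_stoppedVar :
    Tendsto (fun q : Ioo (0 : ℝ) 1 => stoppedVar q (martCoeff w) (fun t => latticePos q t)
      (latticePos q (supportBound w))) nearOne (𝓝 (ouVar w)) := by
  have h : ouVar w = ∑ s : w.support, ∑ t : w.support,
      martCoeff w s * martCoeff w t * Real.exp (2 * min (s : ℝ) t) := by
    rw [ouVar, Finsupp.sum, ← Finset.sum_coe_sort]
    refine Finset.sum_congr rfl fun s _ => ?_
    rw [Finsupp.sum, ← Finset.sum_coe_sort]
    refine Finset.sum_congr rfl fun t _ => ?_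
    have : -|(t : ℝ) - s| = -s + -t + 2 * min (s : ℝ) t := by
      rcases le_total (s : ℝ) t with h | h
      · rw [min_eq_left h, abs_of_nonneg (sub_nonneg.2 h)]
        ring
      · rw [min_eq_right h, abs_of_nonpos (sub_nonpos.2 h)]
        ring
    rw [this, Real.exp_add, Real.exp_add, martCoeff, martCoeff]
    ring
  rw [h]
  refine tendsto_finsetSum _ fun s _ => tendsto_finsetSum _ fun t _ => ?_
  refine ((tendsto_expTime_latticePos _).const_mul _).congr fun q => ?_
  rw [latticePos_min q.2, latticePos_min q.2, min_eq_right (a := supportBound w)]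
  exact (min_le_left _ _).trans ((le_abs_self _).trans (abs_le_supportBound w s))

theorem tendsto_charFun_stoppedSum :
    Tendsto (fun q : Ioo (0 : ℝ) 1 => ∫ μ, Complex.exp (stoppedSum q (martCoeff w)
      (fun t => latticePos q t) (latticePos q (supportBound w)) μ * Complex.I) ∂(partitionLaw q))
      nearOne (𝓝 (Real.exp (-(ouVar w / 2)) : ℝ)) := by
  have hT := supportBound_nonneg w
  set φ : Ioo (0 : ℝ) 1 → ℂ := fun q => ∫ μ, Complex.exp (stoppedSum q (martCoeff w)
      (fun t => latticePos q t) (latticePos q (supportBound w)) μ * Complex.I) ∂(partitionLaw q)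
  set V : Ioo (0 : ℝ) 1 → ℝ := fun q => stoppedVar q (martCoeff w) (fun t => latticePos q t)
      (latticePos q (supportBound w))
  set b := ∑ t, |martCoeff w t|
  set B := timeBound (supportBound w) with hBdef
  have hB : 1 ≤ B := one_le_timeBound hT
  have hV : Tendsto V nearOne (𝓝 (ouVar w)) := tendsto_stoppedVar w
  have h1 : Tendsto (fun q => (Real.exp (V q / 2) : ℝ) * φ q) nearOne (𝓝 1) := by
    rw [tendsto_iff_norm_sub_tendsto_zero]
    refine squeeze_zero' (.of_forall fun _ => norm_nonneg _)
      (eventually_half_le_nearOne.mono fun q h2 => ?_)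
      (g := fun q : Ioo (0 : ℝ) 1 => Real.exp (b ^ 2 * B / 2) *
        (4 * b ^ 3 * (1 + B + B ^ 2) + b ^ 2 * B + b ^ 4 * B) * √(growth q) * B) ?_
    · have hK := (expTime_latticePos_mem_Icc q.2 h2 (abs_of_nonneg hT).le).2
      refine (norm_charFun_stoppedSum_sub_one_le q (growth_le_one q.2 h2) (martCoeff w)
        (fun t => latticePos q t) hB hK).trans ?_
      gcongr
    · have h3 : Tendsto (fun q : Ioo (0 : ℝ) 1 => √(growth (q : ℝ))) nearOne (𝓝 0) := by
        simpa using tendsto_growth_nearOne.sqrt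
      simpa using (h3.const_mul _).mul_const B
  have h2 : Tendsto (fun q => ((Real.exp (-(V q / 2)) : ℝ) : ℂ)) nearOne
      (𝓝 (Real.exp (-(ouVar w / 2)) : ℝ)) :=
    (Complex.continuous_ofReal.tendsto _).comp
      ((Real.continuous_exp.tendsto _).comp (hV.div_const 2).neg)
  have h3 := h2.mul h1
  rw [mul_one] at h3
  refine h3.congr fun q => ?_
  rw [← mul_assoc, ← Complex.ofReal_mul, ← Real.exp_add, neg_add_cancel, Real.exp_zero,
    Complex.ofReal_one, one_mul]

theorem norm_cexp_mul_I_sub_le (x y : ℝ) :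
    ‖Complex.exp (x * Complex.I) - Complex.exp (y * Complex.I)‖ ≤ |x - y| := by
  have h1 := Real.norm_exp_I_mul_ofReal_sub_one_le (x := x - y)
  have h2 : Complex.exp (x * Complex.I) - Complex.exp (y * Complex.I) =
      Complex.exp (y * Complex.I) * (Complex.exp (Complex.I * (x - y : ℝ)) - 1) := by
    rw [mul_sub, ← Complex.exp_add, mul_one]
    congr 2
    push_cast
    ring
  rw [h2, norm_mul, Complex.norm_exp_ofReal_mul_I, one_mul]
  exact h1

/-- Convergence of the finite-dimensional distributions of the fluctuations, in terms of
characteristic functions. -/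
theorem tendsto_charFun_fluctuation :
    Tendsto (fun q : Ioo (0 : ℝ) 1 => ∫ μ, Complex.exp (evalSum w (fluctuation q μ) * Complex.I)
      ∂(partitionLaw q)) nearOne (𝓝 (Real.exp (-(ouVar w / 2)) : ℝ)) := by
  refine (tendsto_charFun_stoppedSum w).congr_dist ?_
  refine squeeze_zero' (.of_forall fun _ => dist_nonneg)
    (eventually_half_le_nearOne.mono fun q h2 => ?_)
    (g := fun q : Ioo (0 : ℝ) 1 => ∑ t : w.support, |w t| * ∫ μ, |fluctuation q μ t -
      Real.exp (-t) * normMart q (latticePos q t) μ| ∂(partitionLaw q)) ?_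
  · have hI : ∀ f : YoungDiagram → ℝ,
        Integrable (fun μ => Complex.exp (f μ * Complex.I)) (partitionLaw q) := fun f =>
      Integrable.of_bound .of_discrete 1 (.of_forall fun μ => by
        rw [Complex.norm_exp_ofReal_mul_I])
    have hIt : ∀ t : w.support, Integrable (fun μ => |w t| * |fluctuation q μ t -
        Real.exp (-t) * normMart q (latticePos q t) μ|) (partitionLaw q) := fun t =>
      (integral_abs_fluctuation_sub_le q h2 (supportBound_nonneg w)
        (abs_le_supportBound w t)).1.const_mul _
    rw [dist_comm, dist_eq_norm, ← integral_sub (hI _) (hI _)]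
    simp_rw [← integral_const_mul]
    rw [← integral_finsetSum _ fun t _ => hIt t]
    refine norm_integral_le_of_norm_le (integrable_finsetSum _ fun t _ => hIt t)
      (.of_forall fun μ => (norm_cexp_mul_I_sub_le _ _).trans ?_)
    rw [evalSum, Finsupp.sum, ← Finset.sum_coe_sort, stoppedSum, ← Finset.sum_sub_distrib]
    refine (Finset.abs_sum_le_sum_abs _ _).trans (Finset.sum_le_sum fun t _ => le_of_eq ?_)
    rw [← abs_mul, martCoeff, latticePos_min q.2,
      min_eq_right ((le_abs_self _).trans (abs_le_supportBound w t))]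
    congr 1
    ring
  · have : Tendsto (fun q : Ioo (0 : ℝ) 1 => ∑ t : w.support, |w t| * ∫ μ, |fluctuation q μ t -
        Real.exp (-t) * normMart q (latticePos q t) μ| ∂(partitionLaw q)) nearOne
        (𝓝 (∑ t : w.support, |w t| * 0)) :=
      tendsto_finsetSum _ fun t _ => (tendsto_integral_abs_fluctuation_sub t).const_mul _
    simpa using this

end Marginals

/-! ### Weak convergence in the Skorokhod space -/

/-- The rescaled fluctuation as a continuous function, the preimage of `fluctuation q μ` under
`toSkorokhod`. -/
noncomputable def continuousFluctuation (q : ℝ) (μ : YoungDiagram) : C(ℝ, ℝ) where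
  toFun := fluctuation q μ
  continuous_toFun := by
    have h1 := continuous_boundary μ
    have h2 := continuous_vershikCurve
    have h : (fluctuation q μ : ℝ → ℝ) = fun s => Real.sqrt 2 * Real.cosh s / Real.sqrt (scale q) *
      (scale q * boundary μ (s / scale q) - vershikCurve s) := rfl
    rw [h]
    fun_prop

/-- The law of the rescaled fluctuation on the space of continuous functions. -/
noncomputable def fluctuationLaw (q : Ioo (0 : ℝ) 1) : ProbabilityMeasure C(ℝ, ℝ) :=
  ⟨(partitionLaw q).map (continuousFluctuation q),
    Measure.isProbabilityMeasure_map Measurable.of_discrete.aemeasurable⟩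

theorem coe_fluctuationLaw (q : Ioo (0 : ℝ) 1) :
    (fluctuationLaw q : Measure C(ℝ, ℝ)) = (partitionLaw q).map (continuousFluctuation q) := rfl

theorem fluctuationLaw_setOf_lt (q : Ioo (0 : ℝ) 1) {g : C(ℝ, ℝ) → ℝ} (hg : Continuous g)
    (a : ℝ) : (fluctuationLaw q : Measure C(ℝ, ℝ)) {f | a < g f} =
      partitionLaw q {μ | a < g (continuousFluctuation q μ)} := by
  rw [coe_fluctuationLaw, Measure.map_apply Measurable.of_discrete
    (measurableSet_lt measurable_const hg.measurable)]
  rfl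

theorem isTightMeasureSet_fluctuationLaw :
    IsTightMeasureSet {ν : Measure C(ℝ, ℝ) |
      ∃ q : Ioo (0 : ℝ) 1, 1 / 2 ≤ (q : ℝ) ∧ (fluctuationLaw q : Measure C(ℝ, ℝ)) = ν} := by
  refine isTightMeasureSet_of_increments (fun ε hε => ?_) fun n => ?_
  · set C := 2 * (2 * (1 + timeBound 0) * (2 * √(timeBound 0)) + 18)
    obtain ⟨R, hR0, hR⟩ : ∃ R : ℝ, 0 < R ∧ ENNReal.ofReal (C / R) ≤ ε := by
      have h : Tendsto (fun R : ℝ => ENNReal.ofReal (C / R)) atTop (𝓝 0) := by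
        simpa using ENNReal.tendsto_ofReal (tendsto_const_nhds.div_atTop tendsto_id)
      exact ((eventually_gt_atTop 0).and (h.eventually (ge_mem_nhds hε))).exists
    refine ⟨R, ?_⟩
    rintro _ ⟨q, h2, rfl⟩
    rw [fluctuationLaw_setOf_lt q (g := fun f => |f 0|) (by fun_prop)]
    obtain ⟨hI, hle⟩ := integral_abs_fluctuation_zero_le q h2
    have h1 := mul_meas_ge_le_integral_of_nonneg
      (.of_forall fun μ => abs_nonneg (fluctuation q μ 0)) hI R
    refine (measure_mono fun μ (hμ : R < |fluctuation q μ 0|) => hμ.le).trans (le_trans ?_ hR)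
    change partitionLaw q {μ | R ≤ |fluctuation q μ 0|} ≤ _
    rw [← ofReal_measureReal]
    apply ENNReal.ofReal_le_ofReal
    rw [le_div_iff₀' hR0]
    exact h1.trans hle
  · obtain ⟨C, hC⟩ := exists_measure_fluctuation_sub_le (Nat.cast_nonneg (α := ℝ) n)
    refine ⟨C, ?_⟩
    rintro _ ⟨q, h2, rfl⟩ s hs t ht a ha
    rw [fluctuationLaw_setOf_lt q (g := fun f => |f s - f t|) (by fun_prop)]
    exact hC q h2 s hs t ht a ha

theorem tendsto_charFun_fluctuationLaw (w : ℝ →₀ ℝ) :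
    Tendsto (fun q => ∫ f : C(ℝ, ℝ), Complex.exp (evalSum w f * Complex.I)
      ∂(fluctuationLaw q : Measure C(ℝ, ℝ))) nearOne (𝓝 (Real.exp (-(ouVar w / 2)) : ℝ)) := by
  refine (tendsto_charFun_fluctuation w).congr fun q => ?_
  have hc : Continuous fun f : C(ℝ, ℝ) => Complex.exp (evalSum w f * Complex.I) := by
    have := continuous_evalSum w
    fun_prop
  rw [coe_fluctuationLaw, integral_map Measurable.of_discrete.aemeasurable
    hc.aestronglyMeasurable]
  rfl

/-- The laws of the fluctuations converge weakly on the space of continuous functions. -/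
theorem exists_tendsto_fluctuationLaw :
    ∃ μ₀ : ProbabilityMeasure C(ℝ, ℝ), Tendsto fluctuationLaw nearOne (𝓝 μ₀) ∧
      ∀ w, ∫ f : C(ℝ, ℝ), Complex.exp (evalSum w f * Complex.I) ∂(μ₀ : Measure _) =
        (Real.exp (-(ouVar w / 2)) : ℝ) := by
  -- tightness holds for `1 / 2 ≤ q` only
  set r : Ioo (0 : ℝ) 1 → Ioo (0 : ℝ) 1 := fun q =>
    ⟨max q (1 / 2), lt_max_of_lt_left q.2.1, max_lt q.2.2 (by norm_num)⟩
  have hr : ∀ᶠ q in nearOne, r q = q :=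
    eventually_half_le_nearOne.mono fun q h => Subtype.ext (max_eq_left h)
  obtain ⟨μ₀, h1, h2⟩ := exists_tendsto_of_isTightMeasureSet (fun q => fluctuationLaw (r q))
    (isTightMeasureSet_fluctuationLaw.subset (by
      rintro _ ⟨q, rfl⟩
      exact ⟨r q, le_max_right _ _, rfl⟩))
    (fun w => (Real.exp (-(ouVar w / 2)) : ℝ)) fun w =>
      (tendsto_charFun_fluctuationLaw w).congr' (hr.mono fun q h => by simp only [h])
  exact ⟨μ₀, h1.congr' (hr.mono fun q h => by rw [h]), h2⟩

end UnconfinedPartitions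

theorem mainTheorem3 :
    ∃ (P : MeasureTheory.Measure UnconfinedPartitions.SkorokhodSpace)
      (_ : MeasureTheory.IsProbabilityMeasure P),
      UnconfinedPartitions.IsStationaryOU
        (fun (t : ℝ) (Y : UnconfinedPartitions.SkorokhodSpace) => Y t) P ∧
      MeasureTheory.TendstoInDistribution
        (fun q : Set.Ioo (0 : ℝ) 1 => UnconfinedPartitions.fluctuation q)
        (Filter.comap (Subtype.val : Set.Ioo (0 : ℝ) 1 → ℝ) (nhdsWithin 1 (Set.Iio 1)))
        (fun Y : UnconfinedPartitions.SkorokhodSpace => Y)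
        UnconfinedPartitions.partitionLaw P := by
  obtain ⟨μ₀, h1, h2⟩ := UnconfinedPartitions.exists_tendsto_fluctuationLaw
  have hc := UnconfinedPartitions.continuous_toSkorokhod
  have hP := Measure.isProbabilityMeasure_map (μ := (μ₀ : Measure C(ℝ, ℝ)))
    hc.measurable.aemeasurable
  refine ⟨(μ₀ : Measure C(ℝ, ℝ)).map UnconfinedPartitions.toSkorokhod, hP,
    UnconfinedPartitions.isStationaryOU_map_toSkorokhod h2,
    ⟨fun q => Measurable.of_discrete.aemeasurable, measurable_id.aemeasurable, ?_⟩⟩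
  have h3 := ProbabilityMeasure.tendsto_map_of_tendsto_of_continuous _ μ₀ h1 hc
  have h4 : μ₀.map hc.measurable.aemeasurable =
      ⟨Measure.map (fun Y => Y) ((μ₀ : Measure C(ℝ, ℝ)).map UnconfinedPartitions.toSkorokhod),
        Measure.isProbabilityMeasure_map measurable_id.aemeasurable⟩ :=
    Subtype.ext Measure.map_id'.symm
  rw [← h4]
  exact h3.congr fun q => Subtype.ext (Measure.map_map hc.measurable Measurable.of_discrete)
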